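/- **Conventions.** A spinor is $z=(z^0,z^1)\in\mathbb C^2$; put $\langle z|w\rangle=\bar z^0w^0+\bar z^1w^1$, $|z]=(-\bar z^1,\bar z^0)$, $[z|w\rangle=z^0w^1-z^1w^0$, and $d\mu(z)=\pi^{-2}e^{-\langle z|z\rangle}d^4z$. Let $\Gamma$ be a finite oriented graph (loops and multiple links allowed) all of whose nodes have exactly three half-links; such is the graph dual to the triangulated boundary of a 3-cell $\triangle$ (nodes = triangles, links = edges). For a link $l$ let $z_l$, $\tilde z_l$ be spinors at its source $s(l)$ and target $t(l)$, and let $J_n$ be the sum of the spins at the half-links of a node $n$. The scaleless spin network evaluation is the generating function $$\mathcal S_\Gamma=\sum_{\{j_l\}\subset\mathbb N/2}\mathcal S_\Gamma^{\{j_l\}},\qquad \mathcal S_\Gamma^{\{j_l\}}(z,\tilde z)=\prod_n (J_n+1)!\prod_l\frac1{(2j_l)!}\int_{SU(2)^{N}}\prod_n dh_n\prod_l [\tilde z_l|h_{t(l)}^{-1}h_{s(l)}|z_l\rangle^{2j_l},$$ with normalized Haar measure $dh_n$. **Gluing.** Let $a\neq b$ be two nodes (two triangles) joined by two links $e_1,e_2$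 (two shared edges), and let $p\ne q$ be the remaining links at $a$ and at $b$. The links at $a$ are outgoing, the links at $b$ are incoming; the spinors at $a$ are $z_1,z_2,z_3$ (on $e_1,e_2,p$), those at $b$ are $\tilde w_1,\tilde w_2,\tilde w_3$ (on $e_1,e_2,q$). Gluing the two triangles (Type III) makes $e_1,e_2$ and the vertex between them internal. The dual graph $\Gamma'$ of the new boundary is obtained from $\Gamma$ by deleting $a,b,e_1,e_2$ and replacing $p,q$ by one link from $s(q)$ to $t(p)$, which keeps the spinor of $q$ at its source and that of $p$ at its target. Let $$\mathcal A_e=\sum_{k\ge0}\frac{\bigl(\sum_{i=1}^3\langle z_i|\tilde w_i]\bigr)^{2k}}{(k+1)!^2(2k)!},\qquad \mathcal A_f(x)=\langle x|x\rangle-1,\qquad G(\mathcal A_f(x))=e^{-(1+\mathcal A_f(x))}=e^{-\langle x|x\rangle},$$ and let $x_1\in\{z_1,\tilde w_1\}$, $x_2\in\{z_2,\tilde w_2\}$ be arbitrary choices of base spinors for $e_1$ and $e_2$. All integrals of $\mathcal S_\Gamma$ below are taken spin by spin, i.e. each $\mathcal S_\Gamma^{\{j_l\}}$ is integrated separately and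 the results are summed over the spins. **Claim (gauge-fixed gluing).** For every value of the spinor $x_2$ (which is not integrated) and of the boundary spinors, $$\mathcal S_{\Gamma'}=\int\prod_{y\in\{z_1,z_2,z_3,\tilde w_1,\tilde w_2,\tilde w_3\}\setminus\{x_2\}}d\mu(y)\;\mathcal S_\Gamma\;\mathcal A_e\;\mathcal A_f(x_1)\;G(\mathcal A_f(x_2)).$$ Precisely: for all spins the integral of $\mathcal S_\Gamma^{\{j_l\}}\mathcal A_e\mathcal A_f(x_1)G(\mathcal A_f(x_2))$ converges absolutely; for all spins $\{j'_l\}$ of $\Gamma'$ (the spin of the new link being identified with that of $q$) the sum of these integrals over the spins of $e_1,e_2,p$ converges absolutely to $\mathcal S_{\Gamma'}^{\{j'_l\}}$; and their sum over all spins of $\Gamma$ converges absolutely to $\mathcal S_{\Gamma'}$ wherever the spin expansion of $\mathcal S_{\Gamma'}$ converges absolutely, which it does for all sufficiently small boundary spinors. **Claim (no gauge fixing).** If $G(\mathcal A_f(x_2))$ is replaced by $\mathcal A_f(x_2)$ and $x_2$ is integrated too, the integral of each $\mathcal S_\Gamma^{\{j_l\}}\mathcal A_e\mathcal A_f(x_1)\mathcal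 A_f(x_2)$ still converges absolutely, and formally $$\mathcal S_{\Gamma'}\,\delta_{SU(2)}(\mathbb I)=\int\prod_{y\in\{z_1,z_2,z_3,\tilde w_1,\tilde w_2,\tilde w_3\}}d\mu(y)\;\mathcal S_\Gamma\;\mathcal A_e\;\mathcal A_f(x_1)\;\mathcal A_f(x_2),\qquad \delta_{SU(2)}(g)=\sum_{j\in\mathbb N/2}(2j+1)\chi_j(g),$$ in the following sense: for every $M\in\mathbb N$, if the sum over the spin of $e_2$ is cut off at $2j_{e_2}\le M$, the right-hand side is, in the same two senses as above, $\mathcal S_{\Gamma'}$ times the partial sum $\sum_{2j\le M}(2j+1)\chi_j(\mathbb I)$. These partial sums tend to infinity, and without the cut-off the sum over the spins of the right-hand side is never absolutely convergent. -/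

import Mathlib

open MeasureTheory Filter Topology

/-! ## Spinors -/

/-- Spinors `|z⟩ ∈ ℂ²`, with components `z 0`, `z 1`. -/
abbrev Spinor : Type := Fin 2 → ℂ

namespace Spinor

/-- The norm squared `⟨z|z⟩ = |z⁰|² + |z¹|²`. -/
noncomputable def normSq (z : Spinor) : ℝ := ‖z 0‖ ^ 2 + ‖z 1‖ ^ 2

/-- The dual spinor `|z] = (-conj z¹, conj z⁰)`. -/
noncomputable def dual (z : Spinor) : Spinor := ![-(starRingEnd ℂ) (z 1), (starRingEnd ℂ) (z 0)]

/-- The hermitian product `⟨z|w⟩ = conj z⁰ w⁰ + conj z¹ w¹`. -/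
noncomputable def herm (z w : Spinor) : ℂ := (starRingEnd ℂ) (z 0) * w 0 + (starRingEnd ℂ) (z 1) * w 1

/-- The holomorphic product `[z|w⟩ = z⁰ w¹ - z¹ w⁰`. -/
noncomputable def bracket (z w : Spinor) : ℂ := herm (dual z) w

/-- The Gaussian probability measure `dμ(z) = π⁻² e^{-⟨z|z⟩} d⁴z` on spinors. -/
noncomputable def gaussian : Measure Spinor :=
  (volume : Measure Spinor).withDensity
    (fun z => ENNReal.ofReal (Real.exp (-normSq z) / Real.pi ^ 2))

end Spinor

/-! ## The group `SU(2)` and its Haar measure -/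

/-- The group `SU(2)`. -/
abbrev SU2 : Type := ↥(Matrix.specialUnitaryGroup (Fin 2) ℂ)

namespace SU2

noncomputable instance : MeasurableSpace SU2 := borel SU2

instance : BorelSpace SU2 := ⟨rfl⟩

instance : IsTopologicalGroup SU2 where
  continuous_inv :=
    Continuous.subtype_mk (continuous_star.comp continuous_subtype_val) _

instance : CompactSpace SU2 := by
  suffices IsCompact (Matrix.specialUnitaryGroup (Fin 2) ℂ : Set (Matrix (Fin 2) (Fin 2) ℂ)) from
    isCompact_iff_compactSpace.1 this
  have hK : IsCompact (Set.univ.pi fun _ : Fin 2 => Set.univ.pi fun _ : Fin 2 =>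
      Metric.closedBall (0 : ℂ) 1) :=
    isCompact_univ_pi fun _ => isCompact_univ_pi fun _ => isCompact_closedBall _ _
  refine IsCompact.of_isClosed_subset hK ?_ ?_
  · have h1 : IsClosed {A : Matrix (Fin 2) (Fin 2) ℂ | A * star A = 1} :=
      isClosed_eq (continuous_id.mul continuous_star) continuous_const
    have h2 : IsClosed {A : Matrix (Fin 2) (Fin 2) ℂ | A.det = 1} :=
      isClosed_eq (Continuous.matrix_det continuous_id) continuous_const
    convert h1.inter h2 using 1
    ext A
    simp [Matrix.mem_specialUnitaryGroup_iff, Matrix.mem_unitaryGroup_iff]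
  · intro A hA i _ j _
    refine mem_closedBall_zero_iff.2 ?_
    exact entry_norm_bound_of_unitary (Matrix.specialUnitaryGroup_le_unitaryGroup hA) i j

/-- The normalized Haar measure of `SU(2)`. -/
noncomputable def haar : Measure SU2 := Measure.haarMeasure ⊤

/-- The action `g|z⟩` of `SU(2)` on spinors. -/
noncomputable def act (g : SU2) (z : Spinor) : Spinor := g.1.mulVec z

open Polynomial in
/-- The matrix of `g` in the irreducible representation of spin `n / 2`, realized on the
homogeneous polynomials of degree `n` in two variables, in the basis of monomials
(dehomogenized, so that the `a`-th monomial is `X ^ a`). -/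
noncomputable def wigner (n : ℕ) (g : SU2) : Matrix (Fin (n + 1)) (Fin (n + 1)) ℂ :=
  fun b a => ((C (g.1 0 0) * X + C (g.1 1 0)) ^ (a : ℕ) *
    (C (g.1 0 1) * X + C (g.1 1 1)) ^ (n - (a : ℕ))).coeff (b : ℕ)

/-- The character of the irreducible representation of spin `n / 2`. -/
noncomputable def character (n : ℕ) (g : SU2) : ℂ := (wigner n g).trace

/-- The partial sums `∑_{2j ≤ M} (2j + 1) χ_j(g)` of the Peter-Weyl expansion of the delta
distribution of `SU(2)` at the identity. -/
noncomputable def deltaCutoff (M : ℕ) (g : SU2) : ℂ :=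
  ∑ n ∈ Finset.range (M + 1), ((n : ℂ) + 1) * character n g

end SU2

/-! ## Trivalent graphs and scaleless spin networks -/

/-- A closed oriented three-valent graph with nodes `N` and links `L`; loops and multiple links
are allowed.  It is the graph dual to a closed surface made of triangles: the nodes are the
triangles, the links are the edges. -/
structure TrivalentGraph (N L : Type*) [Fintype L] [DecidableEq N] where
  src : L → N
  tgt : L → N
  trivalent : ∀ n : N,
    (Finset.univ.filter fun l => src l = n).card +
      (Finset.univ.filter fun l => tgt l = n).card = 3

namespace TrivalentGraph

variable {N L : Type*} [DecidableEq N] [Fintype L] [DecidableEq L]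

/-- `2 J_n`, where `J_n` is the sum of the spins of the half-links at the node `n`. A spin `j` is
given by the natural number `k = 2 j`. -/
def twoJ (Γ : TrivalentGraph N L) (k : L → ℕ) (n : N) : ℕ :=
  (∑ l ∈ Finset.univ.filter (fun l => Γ.src l = n), k l) +
    ∑ l ∈ Finset.univ.filter (fun l => Γ.tgt l = n), k l

/-- The coherent spin network state with spins `k / 2`
`∫ ∏ dh_n ∏_l [j_l, z̃_l| h_{t(l)}⁻¹ g_l h_{s(l)} |j_l, z_l⟩`. Spinors live on half-links: the
spinor `z_l` at the source of `l` is `ζ (l, false)` and the spinor `z̃_l` at its target is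
`ζ (l, true)`. The coherent states satisfy `[j, z̃| g |j, z⟩ = [z̃|g|z⟩ ^ (2 j)`. -/
noncomputable def spinNetwork [Fintype N] (Γ : TrivalentGraph N L) (k : L → ℕ) (ζ : L × Bool → Spinor)
    (g : L → SU2) : ℂ :=
  ∫ h : N → SU2,
    ∏ l, (Spinor.bracket (ζ (l, true))
      (SU2.act ((h (Γ.tgt l))⁻¹ * g l * h (Γ.src l)) (ζ (l, false)))) ^ k l
    ∂(Measure.pi fun _ => SU2.haar)

/-- The part with spins `k / 2` of the scaleless spin network state, evaluated at the identity:
`∏_n (J_n + 1)! ∏_l 1 / (2 j_l)! ∫ ∏ dh_n ∏_l [j_l, z̃_l| h_{t(l)}⁻¹ h_{s(l)} |j_l, z_l⟩`.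
If `2 J_n` is odd for some node then the integral vanishes, so that the rounding in the factorial
is harmless. -/
noncomputable def scalelessTerm [Fintype N] (Γ : TrivalentGraph N L) (k : L → ℕ) (ζ : L × Bool → Spinor) :
    ℂ :=
  (∏ n, ((Γ.twoJ k n / 2 + 1).factorial : ℂ)) * (∏ l, ((k l).factorial : ℂ)⁻¹) *
    Γ.spinNetwork k ζ 1

/-- The scaleless spin network evaluation: the sum over all spins. -/
noncomputable def scaleless [Fintype N] (Γ : TrivalentGraph N L) (ζ : L × Bool → Spinor) : ℂ :=
  ∑' k : L → ℕ, Γ.scalelessTerm k ζ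

/-! ## Gluing two triangles which share two edges -/

/-- Two distinct nodes `a`, `b` (dual to two triangles) joined by the two links `e₁`, `e₂` (dual to
the two shared edges). The remaining half-link of `a` belongs to the link `p`, the remaining
half-link of `b` to another link `q`. The links at `a` are outgoing, those at `b` are incoming. -/
structure TypeIII (Γ : TrivalentGraph N L) where
  a : N
  b : N
  e₁ : L
  e₂ : L
  p : L
  q : L
  a_ne_b : a ≠ b
  e₁_ne_e₂ : e₁ ≠ e₂
  p_ne_e₁ : p ≠ e₁
  p_ne_e₂ : p ≠ e₂
  q_ne_e₁ : q ≠ e₁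
  q_ne_e₂ : q ≠ e₂
  p_ne_q : p ≠ q
  src_e₁ : Γ.src e₁ = a
  src_e₂ : Γ.src e₂ = a
  src_p : Γ.src p = a
  tgt_e₁ : Γ.tgt e₁ = b
  tgt_e₂ : Γ.tgt e₂ = b
  tgt_q : Γ.tgt q = b

namespace TypeIII

variable {Γ : TrivalentGraph N L} (T : Γ.TypeIII)

/-- The nodes after gluing: the two glued triangles are not in the boundary any more. -/
abbrev Nodes : Type _ := {n : N // n ≠ T.a ∧ n ≠ T.b}

/-- The links after gluing: the shared edges become internal and the edges dual to `p` and `q` are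
identified; the resulting link is called `q`. -/
abbrev Links : Type _ := {l : L // l ≠ T.e₁ ∧ l ≠ T.e₂ ∧ l ≠ T.p}

/-- The target after gluing: the new link `q` runs from the source of `q` to the target of `p`. -/
def newTgt (l : L) : N := if l = T.q then Γ.tgt T.p else Γ.tgt l

theorem filter_src_a :
    (Finset.univ.filter fun l => Γ.src l = T.a) = {T.e₁, T.e₂, T.p} := by
  symm
  refine Finset.eq_of_subset_of_card_le ?_ ?_
  · intro l hl
    simp only [Finset.mem_insert, Finset.mem_singleton] at hl
    rcases hl with rfl | rfl | rfl <;> simp [T.src_e₁, T.src_e₂, T.src_p]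
  · have h := Γ.trivalent T.a
    have : ({T.e₁, T.e₂, T.p} : Finset L).card = 3 :=
      Finset.card_eq_three.2 ⟨_, _, _, T.e₁_ne_e₂, T.p_ne_e₁.symm, T.p_ne_e₂.symm, rfl⟩
    omega

theorem filter_tgt_b :
    (Finset.univ.filter fun l => Γ.tgt l = T.b) = {T.e₁, T.e₂, T.q} := by
  symm
  refine Finset.eq_of_subset_of_card_le ?_ ?_
  · intro l hl
    simp only [Finset.mem_insert, Finset.mem_singleton] at hl
    rcases hl with rfl | rfl | rfl <;> simp [T.tgt_e₁, T.tgt_e₂, T.tgt_q]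
  · have h := Γ.trivalent T.b
    have : ({T.e₁, T.e₂, T.q} : Finset L).card = 3 :=
      Finset.card_eq_three.2 ⟨_, _, _, T.e₁_ne_e₂, T.q_ne_e₁.symm, T.q_ne_e₂.symm, rfl⟩
    omega

theorem tgt_ne_a (l : L) : Γ.tgt l ≠ T.a := by
  intro hl
  have h := Γ.trivalent T.a
  rw [T.filter_src_a,
    Finset.card_eq_three.2 ⟨_, _, _, T.e₁_ne_e₂, T.p_ne_e₁.symm, T.p_ne_e₂.symm, rfl⟩] at h
  have h0 : (Finset.univ.filter fun l => Γ.tgt l = T.a).card = 0 := by omega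
  rw [Finset.card_eq_zero] at h0
  have : l ∈ (Finset.univ.filter fun l => Γ.tgt l = T.a) := by simp [hl]
  simp [h0] at this

theorem src_ne_b (l : L) : Γ.src l ≠ T.b := by
  intro hl
  have h := Γ.trivalent T.b
  rw [T.filter_tgt_b,
    Finset.card_eq_three.2 ⟨_, _, _, T.e₁_ne_e₂, T.q_ne_e₁.symm, T.q_ne_e₂.symm, rfl⟩] at h
  have h0 : (Finset.univ.filter fun l => Γ.src l = T.b).card = 0 := by omega
  rw [Finset.card_eq_zero] at h0
  have : l ∈ (Finset.univ.filter fun l => Γ.src l = T.b) := by simp [hl]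
  simp [h0] at this

theorem src_eq_a {l : L} (h : Γ.src l = T.a) : l = T.e₁ ∨ l = T.e₂ ∨ l = T.p := by
  have : l ∈ (Finset.univ.filter fun l => Γ.src l = T.a) := by simp [h]
  simpa [T.filter_src_a] using this

theorem tgt_eq_b {l : L} (h : Γ.tgt l = T.b) : l = T.e₁ ∨ l = T.e₂ ∨ l = T.q := by
  have : l ∈ (Finset.univ.filter fun l => Γ.tgt l = T.b) := by simp [h]
  simpa [T.filter_tgt_b] using this

theorem src_mem (l : T.Links) : Γ.src l.1 ≠ T.a ∧ Γ.src l.1 ≠ T.b :=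
  ⟨fun h => by rcases T.src_eq_a h with h | h | h <;> simp_all [l.2], T.src_ne_b _⟩

theorem newTgt_mem (l : T.Links) : T.newTgt l.1 ≠ T.a ∧ T.newTgt l.1 ≠ T.b := by
  unfold newTgt
  split_ifs with h
  · refine ⟨T.tgt_ne_a _, fun h' => ?_⟩
    rcases T.tgt_eq_b h' with h' | h' | h'
    · exact T.p_ne_e₁ h'
    · exact T.p_ne_e₂ h'
    · exact T.p_ne_q h'
  · refine ⟨T.tgt_ne_a _, fun h' => ?_⟩
    rcases T.tgt_eq_b h' with h' | h' | h'
    · exact l.2.1 h'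
    · exact l.2.2.1 h'
    · exact h h'

/-- The graph dual to the boundary after gluing. -/
def glued : TrivalentGraph T.Nodes T.Links where
  src l := ⟨Γ.src l.1, T.src_mem l⟩
  tgt l := ⟨T.newTgt l.1, T.newTgt_mem l⟩
  trivalent n := by
    rw [← Γ.trivalent n.1]
    congr 1
    · refine Finset.card_bij (fun l _ => l.1) ?_ ?_ ?_
      · intro l hl
        simpa [Subtype.ext_iff] using hl
      · intro l _ l' _ h
        exact Subtype.ext h
      · intro l hl
        simp only [Finset.mem_filter, Finset.mem_univ, true_and] at hl
        refine ⟨⟨l, ?_, ?_, ?_⟩, ?_, rfl⟩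
        · rintro rfl; exact n.2.1 (hl ▸ T.src_e₁)
        · rintro rfl; exact n.2.1 (hl ▸ T.src_e₂)
        · rintro rfl; exact n.2.1 (hl ▸ T.src_p)
        · simpa [Subtype.ext_iff] using hl
    · refine Finset.card_bij (fun l _ => if l.1 = T.q then T.p else l.1) ?_ ?_ ?_
      · intro l hl
        simp only [Finset.mem_filter, Finset.mem_univ, true_and, Subtype.ext_iff, newTgt] at hl ⊢
        split_ifs at hl ⊢ <;> exact hl
      · intro l _ l' _ h
        apply Subtype.ext
        have h1 := l.2.2.2
        have h2 := l'.2.2.2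
        split_ifs at h <;> simp_all
      · intro l hl
        simp only [Finset.mem_filter, Finset.mem_univ, true_and] at hl
        by_cases hp : l = T.p
        · refine ⟨⟨T.q, T.q_ne_e₁, T.q_ne_e₂, T.p_ne_q.symm⟩, ?_, ?_⟩
          · subst hp
            simpa [Subtype.ext_iff, newTgt] using hl
          · simp [hp]
        · have hq : l ≠ T.q := by rintro rfl; exact n.2.2 (hl ▸ T.tgt_q)
          refine ⟨⟨l, ?_, ?_, hp⟩, ?_, ?_⟩
          · rintro rfl; exact n.2.2 (hl ▸ T.tgt_e₁)
          · rintro rfl; exact n.2.2 (hl ▸ T.tgt_e₂)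
          · simpa [Subtype.ext_iff, newTgt, hq] using hl
          · simp [hq]

/-- The spinors on the boundary after gluing: the new link `q` carries the spinor of `q` at its
source and the spinor of `p` at its target, the other half-links keep their spinors. -/
def boundarySpinors (ζ : L × Bool → Spinor) : T.Links × Bool → Spinor :=
  fun x => if x.1.1 = T.q ∧ x.2 = true then ζ (T.p, true) else ζ (x.1.1, x.2)

/-- The six half-links at the two glued triangles. -/
def halfLinks : Finset (L × Bool) :=
  {(T.e₁, false), (T.e₂, false), (T.p, false), (T.e₁, true), (T.e₂, true), (T.q, true)}

end TypeIII

end TrivalentGraph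

/-! ## Amplitudes -/

/-- The spinors `ζ`, replaced by `η` on the half-links in `A`. -/
def overwrite {X : Type*} [DecidableEq X] (A : Finset X) (ζ : X → Spinor) (η : A → Spinor) :
    X → Spinor :=
  fun x => if h : x ∈ A then η ⟨x, h⟩ else ζ x

/-- The edge amplitude `∑_k (∑_l ⟨z_l|w_l])^{2k} / ((k+1)!² (2k)!)`
of two glued triangles. -/
noncomputable def edgeAmplitude (z w : Fin 3 → Spinor) : ℂ :=
  ∑' k : ℕ, (∑ l, Spinor.herm (z l) (Spinor.dual (w l))) ^ (2 * k) /
    (((k + 1).factorial : ℂ) ^ 2 * ((2 * k).factorial : ℂ))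

/-- The face amplitude `⟨z|z⟩ - 1`. -/
noncomputable def faceAmplitude (z : Spinor) : ℝ := Spinor.normSq z - 1

/-- The gauge-fixing function `G(A) = e^{-(1 + A)}` of a face amplitude `A`, so that
`G (faceAmplitude z) = e^{-⟨z|z⟩}`. -/
noncomputable def gaugeFixing (A : ℝ) : ℝ := Real.exp (-(1 + A))

namespace TrivalentGraph.TypeIII

variable {N L : Type*} [Fintype N] [DecidableEq N] [Fintype L] [DecidableEq L]
  {Γ : TrivalentGraph N L} (T : Γ.TypeIII)

/-- The edge amplitude gluing the triangles dual to `a` and `b`. -/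
noncomputable def edge (ζ : L × Bool → Spinor) : ℂ :=
  edgeAmplitude ![ζ (T.e₁, false), ζ (T.e₂, false), ζ (T.p, false)]
    ![ζ (T.e₁, true), ζ (T.e₂, true), ζ (T.q, true)]

/-- The half-links whose spinors are integrated over when the spinor on the half-link `x` is kept
fixed. -/
def fixedHalfLinks (x : L × Bool) : Finset (L × Bool) := T.halfLinks.erase x

/-- The part with spins `k / 2` of the gauge-fixed gluing integrand, with the face amplitude of
`e₁` based at the half-link `(e₁, c₁)` and the gauge-fixing factor of `e₂` at `(e₂, c₂)`. -/
noncomputable def gaugeFixedIntegrand (c₁ c₂ : Bool) (k : L → ℕ) (ζ : L × Bool → Spinor) : ℂ :=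
  Γ.scalelessTerm k ζ * T.edge ζ * (faceAmplitude (ζ (T.e₁, c₁)) : ℂ) *
    (gaugeFixing (faceAmplitude (ζ (T.e₂, c₂))) : ℂ)

/-- The contribution of the spins `k / 2` to the gauge-fixed gluing: the integral over the spinors
on the six half-links of the two triangles, except the one on `(e₂, c₂)`. -/
noncomputable def gaugeFixedGluing (c₁ c₂ : Bool) (k : L → ℕ) (ζ : L × Bool → Spinor) : ℂ :=
  ∫ η : T.fixedHalfLinks (T.e₂, c₂) → Spinor,
    T.gaugeFixedIntegrand c₁ c₂ k (overwrite _ ζ η) ∂(Measure.pi fun _ => Spinor.gaussian)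

/-- The gluing integrand without gauge fixing: the face amplitude of `e₂` replaces the gauge-fixing
factor. -/
noncomputable def ungaugedIntegrand (c₁ c₂ : Bool) (k : L → ℕ) (ζ : L × Bool → Spinor) : ℂ :=
  Γ.scalelessTerm k ζ * T.edge ζ * (faceAmplitude (ζ (T.e₁, c₁)) : ℂ) *
    (faceAmplitude (ζ (T.e₂, c₂)) : ℂ)

/-- The contribution of the spins `k / 2` to the gluing without gauge fixing: the integral over the
spinors on all six half-links of the two triangles. -/
noncomputable def ungaugedGluing (c₁ c₂ : Bool) (k : L → ℕ) (ζ : L × Bool → Spinor) : ℂ :=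
  ∫ η : T.halfLinks → Spinor,
    T.ungaugedIntegrand c₁ c₂ k (overwrite _ ζ η) ∂(Measure.pi fun _ => Spinor.gaussian)

/-- The restriction of spins to the boundary after gluing. -/
def boundarySpins (k : L → ℕ) : T.Links → ℕ := fun l => k l.1

end TrivalentGraph.TypeIII

/-!
Why the gluing formulas hold.  Write `n₁, n₂, n, m` for twice the spins of `e₁, e₂, p, q`, and keep
the `SU(2)` elements at the nodes fixed at first.  A link contributes a power of a holomorphic
linear form in each of its spinors, and the edge amplitude contributes the powers of
`s = ⟨z₁|w̃₁] + ⟨z₂|w̃₂] + ⟨z₃|w̃₃]`.  Integrated against the Gaussian measure, `sᵐ / m!` acts as a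
reproducing kernel (`Spinor.integral_linear_pow_mul_dpow`): the integrals over the spinors of `p`
and `q` at the glued triangles force `n = m` and join the two links through the group element
`h_a h_b⁻¹`.  The integrals over one spinor on each of `e₁`, `e₂` close these links up into powers
of `⟨z|h_b⁻¹ h_a|z⟩`, `z` being the base spinor.  The face amplitude of `e₁` turns the integral over
its base spinor into `(n₁ + 1) n₁! χ_{n₁}(h_b⁻¹ h_a)`, by diagonalization in `SU(2)`
(`TypeIII.marginal_fixedHalfLinks`).

The group elements `h_a`, `h_b` now only occur in these three factors.  Averaging the other two
by invariance of the Haar measure replaces them by `χ_{n₂} / (n₂ + 1)` and `χ_n / (n + 1)`, by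
Schur's lemma (`SU2.integral_bracket_conj_pow`, `SU2.integral_herm_conj_pow`), and decouples them
from the rest of the graph, which is the spin network of the glued graph.  What remains is
`∫ χ_{n₁} χ_{n₂} χ_n`, the Clebsch-Gordan multiplicity `N`; it vanishes when `n₁ + n₂ + n` is odd.
Otherwise a single term of the edge amplitude survives, and its `(k + 1)!²` cancels the factorials
of the two glued nodes.  This gives the closed forms `TypeIII.gaugeFixedGluing_eq` and
`TypeIII.ungaugedGluing_eq`: if `n = m`, the integral is the term of the glued graph times
`γ = (n₁ + 1) N / ((n₂ + 1) (n + 1))` times, with gauge fixing, the Poisson weight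
`e^{-x} x^{n₂} / n₂!` with `x = ⟨x₂|x₂⟩`, and without it `(n₂ + 1)²`; it vanishes if `n ≠ m`.

All weights are nonnegative.  By the Clebsch-Gordan decomposition `γ` has sum `1` over `n₁`
(`SU2.hasSum_couplingWeight`), and the Poisson weights have sum `1` over `n₂`, while the weights
`(n₂ + 1)²` with `n₂ ≤ M` add up to the cut-off delta function at the identity.  The sums over the
spins therefore reduce to those of the glued graph (`TypeIII.hasSum_gluing`), whose spin expansion
is dominated by a geometric series for small spinors (`TrivalentGraph.norm_scalelessTerm_le`).
-/

/-! ### Gaussian integrals over spinors -/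

namespace Spinor

theorem normSq_nonneg (z : Spinor) : 0 ≤ normSq z := by unfold normSq; positivity

theorem continuous_normSq : Continuous normSq := by unfold normSq; fun_prop

theorem continuous_dual : Continuous dual := by
  unfold dual
  refine continuous_pi fun i => ?_
  fin_cases i
  · exact (Complex.continuous_conj.comp (continuous_apply 1)).neg
  · exact Complex.continuous_conj.comp (continuous_apply 0)

/-- Only the phase-invariant monomials have a nonzero Gaussian integral over `ℂ`. -/
theorem integral_pow_mul_conj_pow (i j : ℕ) :
    ∫ z : ℂ, z ^ i * (starRingEnd ℂ) z ^ j * (Real.exp (-‖z‖ ^ 2) : ℂ) =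
      if i = j then (Real.pi : ℂ) * (i.factorial : ℂ) else 0 := by
  split_ifs with h
  · subst h
    have h1 : ∀ z : ℂ, z ^ i * (starRingEnd ℂ) z ^ i * (Real.exp (-‖z‖ ^ 2) : ℂ) =
        ((‖z‖ ^ ((2 * i : ℕ) : ℝ) * Real.exp (-‖z‖ ^ (2 : ℝ)) : ℝ) : ℂ) := by
      intro z
      rw [← mul_pow, Complex.mul_conj, Complex.normSq_eq_norm_sq, Real.rpow_natCast,
        Real.rpow_two]
      push_cast
      ring
    simp_rw [h1]
    rw [integral_complex_ofReal, Complex.integral_rpow_mul_exp_neg_rpow (by norm_num)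
      (by have : (0 : ℝ) ≤ ((2 * i : ℕ) : ℝ) := by positivity
          linarith)]
    have h2 : (((2 * i : ℕ) : ℝ) + 2) / 2 = (i : ℝ) + 1 := by push_cast; ring
    rw [h2, Real.Gamma_nat_eq_factorial]
    push_cast
    ring
  · -- the rotation by `π / (i - j)` changes the sign of the integrand
    have hij : (i : ℝ) - j ≠ 0 := sub_ne_zero.2 (by exact_mod_cast h)
    set a : Circle := Circle.exp (Real.pi / (i - j)) with ha
    have hneg : (a : ℂ) ^ i * (starRingEnd ℂ) (a : ℂ) ^ j = -1 := by
      rw [← Circle.coe_inv_eq_conj, ha, ← Circle.exp_neg, Circle.coe_exp, Circle.coe_exp,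
        ← Complex.exp_nat_mul, ← Complex.exp_nat_mul, ← Complex.exp_add, ← Complex.exp_pi_mul_I]
      congr 1
      have : (i : ℂ) - j ≠ 0 := by exact_mod_cast hij
      push_cast
      field_simp
      ring
    have h1 := ((rotation a).measurePreserving).integral_comp
      (rotation a).toHomeomorph.measurableEmbedding
      (fun z : ℂ => z ^ i * (starRingEnd ℂ) z ^ j * (Real.exp (-‖z‖ ^ 2) : ℂ))
    have h2 : ∀ z : ℂ, (rotation a z) ^ i * (starRingEnd ℂ) (rotation a z) ^ j *
        (Real.exp (-‖rotation a z‖ ^ 2) : ℂ) =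
        -(z ^ i * (starRingEnd ℂ) z ^ j * (Real.exp (-‖z‖ ^ 2) : ℂ)) := by
      intro z
      rw [LinearIsometryEquiv.norm_map, rotation_apply, map_mul, mul_pow, mul_pow]
      linear_combination (z ^ i * (starRingEnd ℂ) z ^ j * (Real.exp (-‖z‖ ^ 2) : ℂ)) * hneg
    simp_rw [h2] at h1
    rw [integral_neg] at h1
    exact self_eq_neg.1 h1.symm

theorem integral_gaussian (f : Spinor → ℂ) :
    ∫ z, f z ∂gaussian = ∫ z, ((Real.exp (-normSq z) / Real.pi ^ 2 : ℝ) : ℂ) * f z := by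
  unfold gaussian
  rw [integral_withDensity_eq_integral_toReal_smul]
  · refine integral_congr_ae (ae_of_all _ fun z => ?_)
    simp only
    rw [ENNReal.toReal_ofReal (by positivity), Complex.real_smul]
  · have := continuous_normSq
    fun_prop
  · exact ae_of_all _ fun _ => ENNReal.ofReal_lt_top

theorem integral_monomial (i j k l : ℕ) :
    ∫ z, z 0 ^ i * z 1 ^ j * ((starRingEnd ℂ) (z 0) ^ k * (starRingEnd ℂ) (z 1) ^ l) ∂gaussian =
      if i = k ∧ j = l then (i.factorial : ℂ) * (j.factorial : ℂ) else 0 := by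
  rw [integral_gaussian]
  have h : ∀ z : Spinor, ((Real.exp (-normSq z) / Real.pi ^ 2 : ℝ) : ℂ) *
      (z 0 ^ i * z 1 ^ j * ((starRingEnd ℂ) (z 0) ^ k * (starRingEnd ℂ) (z 1) ^ l)) =
      ((Real.pi : ℂ) ^ 2)⁻¹ * ∏ n : Fin 2, (fun z : ℂ => z ^ (![i, j] n) *
        (starRingEnd ℂ) z ^ (![k, l] n) * (Real.exp (-‖z‖ ^ 2) : ℂ)) (z n) := by
    intro z
    simp only [Fin.prod_univ_two, normSq, neg_add, Real.exp_add, Matrix.cons_val_zero,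
      Matrix.cons_val_one]
    push_cast
    ring
  simp_rw [h]
  rw [integral_const_mul, integral_fintype_prod_volume_eq_prod (fun n : Fin 2 => fun z : ℂ =>
    z ^ (![i, j] n) * (starRingEnd ℂ) z ^ (![k, l] n) * (Real.exp (-‖z‖ ^ 2) : ℂ))]
  simp only [Fin.prod_univ_two, integral_pow_mul_conj_pow, Matrix.cons_val_zero,
    Matrix.cons_val_one]
  have hpi : (Real.pi : ℂ) ≠ 0 := by exact_mod_cast Real.pi_ne_zero
  by_cases h1 : i = k <;> by_cases h2 : j = l <;> simp [h1, h2]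
  field_simp

theorem integrable_exp_mul_normSq {c : ℝ} (hc : c < 1) :
    Integrable (fun z => Real.exp (c * normSq z)) gaussian := by
  unfold gaussian
  rw [integrable_withDensity_iff_integrable_smul₀' (by have := continuous_normSq; fun_prop)
    (ae_of_all _ fun _ => ENNReal.ofReal_lt_top)]
  have h1 : Integrable fun z : ℂ => Real.exp (-(1 - c) * ‖z‖ ^ 2) := by
    have h := (GaussianFourier.integrable_cexp_neg_mul_sq_norm_add (V := ℂ)
      (b := ((1 - c : ℝ) : ℂ)) (by simpa using hc) 0 0).norm
    refine h.congr (ae_of_all _ fun z => ?_)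
    simp only [zero_mul, add_zero, Complex.norm_exp]
    congr 1
    rw [← Complex.ofReal_pow, ← Complex.ofReal_neg, ← Complex.ofReal_mul, Complex.ofReal_re]
  have h2 := (Integrable.fintype_prod (ι := Fin 2) (f := fun _ (z : ℂ) =>
    Real.exp (-(1 - c) * ‖z‖ ^ 2)) (fun _ => h1)).const_mul ((Real.pi ^ 2)⁻¹)
  refine h2.congr (ae_of_all _ fun z => ?_)
  simp only
  rw [ENNReal.toReal_ofReal (by positivity), smul_eq_mul, Fin.prod_univ_two, ← Real.exp_add,
    div_mul_eq_mul_div, ← Real.exp_add, div_eq_inv_mul]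
  congr 2
  unfold normSq
  ring

instance : IsProbabilityMeasure gaussian := by
  have h := integral_monomial 0 0 0 0
  simp only [pow_zero, mul_one, and_self, if_true, Nat.factorial_zero, Nat.cast_one,
    integral_const, Measure.real, Complex.real_smul] at h
  have h' : (gaussian Set.univ).toReal = 1 := by exact_mod_cast h
  refine ⟨?_⟩
  rwa [ENNReal.toReal_eq_one_iff] at h'

end Spinor

/-- Continuous functions of polynomial growth with respect to a weight `ρ`. -/
structure Tame {Y : Type*} [TopologicalSpace Y] (ρ : Y → ℝ) (f : Y → ℂ) : Prop where
  cont : Continuous f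
  bound : ∃ C : ℝ, ∃ D : ℕ, ∀ y, ‖f y‖ ≤ C * (1 + ρ y) ^ D

namespace Tame

variable {Y Y' : Type*} [TopologicalSpace Y] [TopologicalSpace Y'] {ρ : Y → ℝ} {ρ' : Y' → ℝ}
  {f g : Y → ℂ}

theorem const (c : ℂ) : Tame ρ fun _ => c := ⟨continuous_const, ‖c‖, 0, by simp⟩

theorem exists_bound (hρ : ∀ y, 0 ≤ ρ y) (hf : Tame ρ f) :
    ∃ C : ℝ, 0 ≤ C ∧ ∃ D : ℕ, ∀ y, ‖f y‖ ≤ C * (1 + ρ y) ^ D := by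
  obtain ⟨C, D, h⟩ := hf.bound
  refine ⟨|C|, abs_nonneg _, D, fun y => (h y).trans ?_⟩
  have := hρ y
  gcongr
  exact le_abs_self C

theorem mul (hρ : ∀ y, 0 ≤ ρ y) (hf : Tame ρ f) (hg : Tame ρ g) : Tame ρ fun y => f y * g y := by
  obtain ⟨C, hC, D, h⟩ := hf.exists_bound hρ
  obtain ⟨C', hC', D', h'⟩ := hg.exists_bound hρ
  refine ⟨hf.cont.mul hg.cont, C * C', D + D', fun y => ?_⟩
  have := hρ y
  calc ‖f y * g y‖ = ‖f y‖ * ‖g y‖ := norm_mul _ _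
    _ ≤ (C * (1 + ρ y) ^ D) * (C' * (1 + ρ y) ^ D') := by
      gcongr
      exacts [h y, h' y]
    _ = _ := by ring

theorem add (hρ : ∀ y, 0 ≤ ρ y) (hf : Tame ρ f) (hg : Tame ρ g) : Tame ρ fun y => f y + g y := by
  obtain ⟨C, hC, D, h⟩ := hf.exists_bound hρ
  obtain ⟨C', hC', D', h'⟩ := hg.exists_bound hρ
  refine ⟨hf.cont.add hg.cont, C + C', D + D', fun y => ?_⟩
  have h1 : 1 ≤ 1 + ρ y := by linarith [hρ y]
  calc ‖f y + g y‖ ≤ ‖f y‖ + ‖g y‖ := norm_add_le _ _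
    _ ≤ C * (1 + ρ y) ^ D + C' * (1 + ρ y) ^ D' := add_le_add (h y) (h' y)
    _ ≤ C * (1 + ρ y) ^ (D + D') + C' * (1 + ρ y) ^ (D + D') := by
      gcongr <;> first | exact h1 | omega
    _ = _ := by ring

theorem pow (hρ : ∀ y, 0 ≤ ρ y) (hf : Tame ρ f) (n : ℕ) : Tame ρ fun y => f y ^ n := by
  induction n with
  | zero => simpa using const 1
  | succ n ih => simpa only [pow_succ] using ih.mul hρ hf

theorem prod (hρ : ∀ y, 0 ≤ ρ y) {ι : Type*} (s : Finset ι) {f : ι → Y → ℂ}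
    (hf : ∀ i, Tame ρ (f i)) : Tame ρ fun y => ∏ i ∈ s, f i y := by
  classical
  induction s using Finset.induction_on with
  | empty => simpa using const 1
  | insert i s hi ih => simpa only [Finset.prod_insert hi] using (hf i).mul hρ ih

theorem comp (hρ : ∀ y, 0 ≤ ρ y) (hf : Tame ρ f) {φ : Y' → Y} (hφ : Continuous φ)
    (h : ∀ y, ρ (φ y) ≤ ρ' y) : Tame ρ' fun y => f (φ y) := by
  obtain ⟨C, hC, D, hb⟩ := hf.exists_bound hρ
  refine ⟨hf.cont.comp hφ, C, D, fun y => (hb _).trans ?_⟩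
  have := hρ (φ y)
  gcongr
  exact h y

/-- Polynomial growth is dominated by exponential growth at any positive rate. -/
theorem exists_le_exp (hρ : ∀ y, 0 ≤ ρ y) (hf : Tame ρ f) {c : ℝ} (hc : 0 < c) :
    ∃ C : ℝ, 0 ≤ C ∧ ∀ y, ‖f y‖ ≤ C * Real.exp (c * ρ y) := by
  obtain ⟨C, hC, D, hb⟩ := hf.exists_bound hρ
  refine ⟨C * ((D.factorial : ℝ) / c ^ D * Real.exp c), by positivity, fun y => (hb y).trans ?_⟩
  have h1 := Real.pow_div_factorial_le_exp (c * (1 + ρ y)) (by have := hρ y; positivity) D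
  rw [mul_assoc, mul_assoc, ← Real.exp_add]
  refine mul_le_mul_of_nonneg_left ?_ hC
  rw [div_le_iff₀ (by positivity), mul_pow] at h1
  rw [div_mul_eq_mul_div, le_div_iff₀ (by positivity)]
  calc (1 + ρ y) ^ D * c ^ D = c ^ D * (1 + ρ y) ^ D := mul_comm _ _
    _ ≤ _ := h1
    _ = _ := by rw [mul_comm]; ring_nf

end Tame

namespace Spinor

theorem tame_apply (i : Fin 2) : Tame normSq fun z => z i := by
  refine ⟨continuous_apply i, 1, 1, fun z => ?_⟩
  have h : ‖z i‖ ^ 2 ≤ normSq z := by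
    unfold normSq
    fin_cases i <;> simp
  nlinarith [sq_nonneg (‖z i‖ - 1)]

theorem tame_conj_apply (i : Fin 2) : Tame normSq fun z => (starRingEnd ℂ) (z i) :=
  ⟨Complex.continuous_conj.comp (continuous_apply i), by simpa using (tame_apply i).bound⟩

theorem tame_normSq : Tame normSq fun z => (normSq z : ℂ) := by
  refine ⟨Complex.continuous_ofReal.comp continuous_normSq, 1, 1, fun z => ?_⟩
  have := normSq_nonneg z
  rw [Complex.norm_real, Real.norm_of_nonneg this]
  linarith

theorem _root_.Tame.integrable_gaussian {f : Spinor → ℂ} (hf : Tame normSq f) :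
    Integrable f gaussian := by
  obtain ⟨C, _, h⟩ := hf.exists_le_exp normSq_nonneg (c := 1 / 2) (by norm_num)
  exact ((integrable_exp_mul_normSq (c := 1 / 2) (by norm_num)).const_mul C).mono'
    hf.cont.aestronglyMeasurable (ae_of_all _ h)

/-- A power of a linear form is reproduced by the Gaussian measure. -/
theorem integral_linear_pow_mul_herm_pow (α β : ℂ) (u : Spinor) (n m : ℕ) :
    ∫ z, (α * z 0 + β * z 1) ^ n * herm z u ^ m ∂gaussian =
      if n = m then (n.factorial : ℂ) * (α * u 0 + β * u 1) ^ n else 0 := by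
  have h1 : ∀ z : Spinor, (α * z 0 + β * z 1) ^ n * herm z u ^ m =
      ∑ i ∈ Finset.range (n + 1), ∑ k ∈ Finset.range (m + 1),
        (α ^ i * β ^ (n - i) * (n.choose i : ℂ) * (u 0 ^ k * u 1 ^ (m - k) * (m.choose k : ℂ))) *
        (z 0 ^ i * z 1 ^ (n - i) *
          ((starRingEnd ℂ) (z 0) ^ k * (starRingEnd ℂ) (z 1) ^ (m - k))) := by
    intro z
    rw [herm, add_pow, add_pow, Finset.sum_mul_sum]
    refine Finset.sum_congr rfl fun i _ => Finset.sum_congr rfl fun k _ => ?_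
    simp only [mul_pow]
    ring
  simp_rw [h1]
  have hint : ∀ i k : ℕ, Integrable (fun z : Spinor =>
      (α ^ i * β ^ (n - i) * (n.choose i : ℂ) * (u 0 ^ k * u 1 ^ (m - k) * (m.choose k : ℂ))) *
        (z 0 ^ i * z 1 ^ (n - i) *
          ((starRingEnd ℂ) (z 0) ^ k * (starRingEnd ℂ) (z 1) ^ (m - k)))) gaussian := by
    intro i k
    have hρ := normSq_nonneg
    exact (Tame.integrable_gaussian
      ((((tame_apply 0).pow hρ i).mul hρ ((tame_apply 1).pow hρ _)).mul
        hρ (((tame_conj_apply 0).pow hρ k).mul hρ ((tame_conj_apply 1).pow hρ _)))).const_mul _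
  rw [integral_finsetSum _ fun i _ => integrable_finsetSum _ fun k _ => hint i k]
  simp_rw [integral_finsetSum _ fun k _ => hint _ k, integral_const_mul, integral_monomial]
  split_ifs with h
  · subst h
    rw [add_pow, Finset.mul_sum]
    refine Finset.sum_congr rfl fun i hi => ?_
    have hi' : i ≤ n := Nat.lt_succ_iff.1 (Finset.mem_range.1 hi)
    rw [Finset.sum_eq_single i (fun k _ hk => by simp [Ne.symm hk]) (fun h => absurd hi h)]
    simp only [and_self, if_true, mul_pow]
    have hc : (n.choose i : ℂ) * (i.factorial : ℂ) * ((n - i).factorial : ℂ) = n.factorial := by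
      exact_mod_cast Nat.choose_mul_factorial_mul_factorial hi'
    rw [← hc]
    ring
  · refine Finset.sum_eq_zero fun i hi => Finset.sum_eq_zero fun k hk => ?_
    rw [Finset.mem_range] at hi hk
    rw [if_neg (by omega), mul_zero]

/-- The reproducing property in the presence of further terms in the exponentiated bracket: the
power of the linear form selects one term of the binomial expansion. -/
theorem integral_linear_pow_mul_add_herm_pow (α β C : ℂ) (u : Spinor) (n m : ℕ) :
    ∫ z, (α * z 0 + β * z 1) ^ n * ((C + herm z u) ^ m / (m.factorial : ℂ)) ∂gaussian =
      if n ≤ m then (α * u 0 + β * u 1) ^ n * (C ^ (m - n) / ((m - n).factorial : ℂ)) else 0 := by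
  have h1 : ∀ z : Spinor, (α * z 0 + β * z 1) ^ n * ((C + herm z u) ^ m / (m.factorial : ℂ)) =
      ∑ k ∈ Finset.range (m + 1), (C ^ (m - k) * (m.choose k : ℂ) / (m.factorial : ℂ)) *
        ((α * z 0 + β * z 1) ^ n * herm z u ^ k) := by
    intro z
    rw [add_comm C, add_pow (herm z u) C m, Finset.sum_div, Finset.mul_sum]
    refine Finset.sum_congr rfl fun k _ => ?_
    ring
  simp_rw [h1]
  have hρ := normSq_nonneg
  have hint : ∀ k : ℕ, Integrable (fun z : Spinor => (C ^ (m - k) * (m.choose k : ℂ) /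
      (m.factorial : ℂ)) * ((α * z 0 + β * z 1) ^ n * herm z u ^ k)) gaussian := by
    intro k
    refine (Tame.integrable_gaussian (Tame.mul hρ
      (Tame.pow hρ (.add hρ (.mul hρ (.const α) (tame_apply 0))
        (.mul hρ (.const β) (tame_apply 1))) n) (Tame.pow hρ ?_ k))).const_mul _
    exact .add hρ (.mul hρ (tame_conj_apply 0) (.const _)) (.mul hρ (tame_conj_apply 1) (.const _))
  rw [integral_finsetSum _ fun k _ => hint k]
  simp_rw [integral_const_mul, integral_linear_pow_mul_herm_pow]
  split_ifs with h
  · rw [Finset.sum_eq_single n (fun k _ hk => by simp [Ne.symm hk])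
      (fun h' => absurd (Finset.mem_range.2 (Nat.lt_succ_of_le h)) h'), if_pos rfl]
    have hc : (m.choose n : ℂ) * (n.factorial : ℂ) * ((m - n).factorial : ℂ) = m.factorial := by
      exact_mod_cast Nat.choose_mul_factorial_mul_factorial h
    have h2 : ((m - n).factorial : ℂ) ≠ 0 := by exact_mod_cast (Nat.factorial_pos _).ne'
    have h3 : (m.factorial : ℂ) ≠ 0 := by exact_mod_cast (Nat.factorial_pos _).ne'
    field_simp
    rw [← hc]
    ring
  · refine Finset.sum_eq_zero fun k hk => ?_
    rw [Finset.mem_range] at hk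
    rw [if_neg (by omega), mul_zero]

theorem normSq_eq_mul_conj (z : Spinor) :
    (normSq z : ℂ) = z 0 * (starRingEnd ℂ) (z 0) + z 1 * (starRingEnd ℂ) (z 1) := by
  rw [Complex.mul_conj, Complex.mul_conj, Complex.normSq_eq_norm_sq, Complex.normSq_eq_norm_sq]
  unfold normSq
  push_cast
  rfl

theorem integral_diagonal_pow (a b : ℂ) (n : ℕ) :
    ∫ z, (a * (z 0 * (starRingEnd ℂ) (z 0)) + b * (z 1 * (starRingEnd ℂ) (z 1))) ^ n ∂gaussian =
      (n.factorial : ℂ) * ∑ i ∈ Finset.range (n + 1), a ^ i * b ^ (n - i) := by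
  have h1 : ∀ z : Spinor,
      (a * (z 0 * (starRingEnd ℂ) (z 0)) + b * (z 1 * (starRingEnd ℂ) (z 1))) ^ n =
      ∑ i ∈ Finset.range (n + 1), (a ^ i * b ^ (n - i) * (n.choose i : ℂ)) *
        (z 0 ^ i * z 1 ^ (n - i) *
          ((starRingEnd ℂ) (z 0) ^ i * (starRingEnd ℂ) (z 1) ^ (n - i))) := by
    intro z
    rw [add_pow]
    refine Finset.sum_congr rfl fun i _ => ?_
    simp only [mul_pow]
    ring
  simp_rw [h1]
  have hρ := normSq_nonneg
  rw [integral_finsetSum _ fun i _ => (Tame.integrable_gaussian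
    ((((tame_apply 0).pow hρ i).mul hρ ((tame_apply 1).pow hρ _)).mul
      hρ (((tame_conj_apply 0).pow hρ i).mul hρ ((tame_conj_apply 1).pow hρ _)))).const_mul _,
    Finset.mul_sum]
  refine Finset.sum_congr rfl fun i hi => ?_
  have hi' : i ≤ n := Nat.lt_succ_iff.1 (Finset.mem_range.1 hi)
  have hc : (n.choose i : ℂ) * (i.factorial : ℂ) * ((n - i).factorial : ℂ) = n.factorial := by
    exact_mod_cast Nat.choose_mul_factorial_mul_factorial hi'
  rw [integral_const_mul, integral_monomial, if_pos ⟨rfl, rfl⟩, ← hc]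
  ring

/-- A radial integration by parts: in the Gaussian integral of a bihomogeneous polynomial of degree
`(n, n)`, the face amplitude `⟨z|z⟩ - 1` amounts to the factor `n + 1`. -/
theorem integral_faceAmplitude_mul_diagonal_pow (a b : ℂ) (n : ℕ) :
    ∫ z, (faceAmplitude z : ℂ) *
      (a * (z 0 * (starRingEnd ℂ) (z 0)) + b * (z 1 * (starRingEnd ℂ) (z 1))) ^ n ∂gaussian =
      ((n : ℂ) + 1) * (n.factorial : ℂ) * ∑ i ∈ Finset.range (n + 1), a ^ i * b ^ (n - i) := by
  have h1 : ∀ z : Spinor, (faceAmplitude z : ℂ) *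
      (a * (z 0 * (starRingEnd ℂ) (z 0)) + b * (z 1 * (starRingEnd ℂ) (z 1))) ^ n =
      ∑ i ∈ Finset.range (n + 1), (a ^ i * b ^ (n - i) * (n.choose i : ℂ)) *
        (z 0 ^ (i + 1) * z 1 ^ (n - i) *
            ((starRingEnd ℂ) (z 0) ^ (i + 1) * (starRingEnd ℂ) (z 1) ^ (n - i)) +
          z 0 ^ i * z 1 ^ (n - i + 1) *
            ((starRingEnd ℂ) (z 0) ^ i * (starRingEnd ℂ) (z 1) ^ (n - i + 1)) +
          -(z 0 ^ i * z 1 ^ (n - i) *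
            ((starRingEnd ℂ) (z 0) ^ i * (starRingEnd ℂ) (z 1) ^ (n - i)))) := by
    intro z
    rw [add_pow, Finset.mul_sum]
    refine Finset.sum_congr rfl fun i _ => ?_
    have h2 : (faceAmplitude z : ℂ) =
        z 0 * (starRingEnd ℂ) (z 0) + z 1 * (starRingEnd ℂ) (z 1) - 1 := by
      rw [← normSq_eq_mul_conj, faceAmplitude]
      push_cast
      rfl
    rw [h2]
    simp only [mul_pow]
    ring
  simp_rw [h1]
  have hρ := normSq_nonneg
  have hmon : ∀ i j : ℕ, Integrable (fun z : Spinor => z 0 ^ i * z 1 ^ j *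
      ((starRingEnd ℂ) (z 0) ^ i * (starRingEnd ℂ) (z 1) ^ j)) gaussian := fun i j =>
    Tame.integrable_gaussian ((((tame_apply 0).pow hρ i).mul hρ ((tame_apply 1).pow hρ j)).mul
      hρ (((tame_conj_apply 0).pow hρ i).mul hρ ((tame_conj_apply 1).pow hρ j)))
  have hmon2 : ∀ i j : ℕ, Integrable (fun z : Spinor =>
      z 0 ^ (i + 1) * z 1 ^ j * ((starRingEnd ℂ) (z 0) ^ (i + 1) * (starRingEnd ℂ) (z 1) ^ j) +
        z 0 ^ i * z 1 ^ (j + 1) *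
          ((starRingEnd ℂ) (z 0) ^ i * (starRingEnd ℂ) (z 1) ^ (j + 1))) gaussian :=
    fun i j => (hmon (i + 1) j).add (hmon i (j + 1))
  have hmon3 : ∀ i j : ℕ, Integrable (fun z : Spinor =>
      -(z 0 ^ i * z 1 ^ j * ((starRingEnd ℂ) (z 0) ^ i * (starRingEnd ℂ) (z 1) ^ j))) gaussian :=
    fun i j => (hmon i j).neg
  rw [integral_finsetSum, Finset.mul_sum]
  swap
  · exact fun i _ => Integrable.const_mul ((hmon2 i (n - i)).add (hmon3 i (n - i))) _
  refine Finset.sum_congr rfl fun i hi => ?_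
  have hi' : i ≤ n := Nat.lt_succ_iff.1 (Finset.mem_range.1 hi)
  have hc : (n.choose i : ℂ) * (i.factorial : ℂ) * ((n - i).factorial : ℂ) = n.factorial := by
    exact_mod_cast Nat.choose_mul_factorial_mul_factorial hi'
  rw [integral_const_mul, integral_add (hmon2 i (n - i)) (hmon3 i (n - i)),
    integral_add (hmon (i + 1) (n - i)) (hmon i (n - i + 1)), integral_neg,
    integral_monomial, integral_monomial, integral_monomial, if_pos ⟨rfl, rfl⟩,
    if_pos ⟨rfl, rfl⟩, if_pos ⟨rfl, rfl⟩, ← hc, Nat.factorial_succ, Nat.factorial_succ]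
  have hn : ((n - i : ℕ) : ℂ) = n - i := by push_cast [hi']; ring
  push_cast
  rw [hn]
  ring

theorem integral_normSq_pow (n : ℕ) :
    ∫ z, (normSq z : ℂ) ^ n ∂gaussian = (n.factorial : ℂ) * ((n : ℂ) + 1) := by
  have h := integral_diagonal_pow 1 1 n
  simp only [one_mul, one_pow, mul_one, Finset.sum_const, Finset.card_range, nsmul_eq_mul] at h
  simp_rw [normSq_eq_mul_conj]
  rw [h]
  push_cast
  ring

theorem integral_faceAmplitude_mul_normSq_pow (n : ℕ) :
    ∫ z, (faceAmplitude z : ℂ) * (normSq z : ℂ) ^ n ∂gaussian =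
      (n.factorial : ℂ) * ((n : ℂ) + 1) ^ 2 := by
  have h := integral_faceAmplitude_mul_diagonal_pow 1 1 n
  simp only [one_mul, one_pow, mul_one, Finset.sum_const, Finset.card_range, nsmul_eq_mul] at h
  simp_rw [normSq_eq_mul_conj]
  rw [h]
  push_cast
  ring

end Spinor

/-! ### The Haar measure and the characters of `SU(2)` -/

namespace SU2

instance : SecondCountableTopology SU2 :=
  have : SecondCountableTopology (Matrix (Fin 2) (Fin 2) ℂ) :=
    inferInstanceAs (SecondCountableTopology (Fin 2 → Fin 2 → ℂ))
  TopologicalSpace.Subtype.secondCountableTopology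
    (Matrix.specialUnitaryGroup (Fin 2) ℂ : Set (Matrix (Fin 2) (Fin 2) ℂ))

instance : haar.IsHaarMeasure := by unfold haar; infer_instance

instance : IsProbabilityMeasure haar := by
  refine ⟨?_⟩
  have h := Measure.haarMeasure_self (K₀ := (⊤ : TopologicalSpace.PositiveCompacts SU2))
  simpa [haar] using h

instance : haar.IsMulRightInvariant := by
  refine ⟨fun g => ?_⟩
  have : IsProbabilityMeasure (Measure.map (fun x => x * g) haar) :=
    Measure.isProbabilityMeasure_map (measurable_mul_const g).aemeasurable
  have : (Measure.map (fun x => x * g) haar).IsHaarMeasure :=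
    Measure.isHaarMeasure_map_mul_right _ g
  exact Measure.isHaarMeasure_eq_of_isProbabilityMeasure _ _

theorem coe_mul (g h : SU2) : (g * h).1 = g.1 * h.1 := rfl

theorem coe_inv (g : SU2) : (g⁻¹).1 = star g.1 := rfl

theorem coe_inv_eq_adjugate (g : SU2) : (g⁻¹).1 = g.1.adjugate := by
  have h1 : g.1 * star g.1 = 1 := Matrix.mem_unitaryGroup_iff.1 g.2.1
  have h2 : g.1.det = 1 := (Matrix.mem_specialUnitaryGroup_iff.1 g.2).2
  calc star g.1 = (g.1.adjugate * g.1) * star g.1 := by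
        rw [Matrix.adjugate_mul, h2, one_smul, one_mul]
    _ = g.1.adjugate := by rw [mul_assoc, h1, mul_one]

theorem apply_one_one (g : SU2) : g.1 1 1 = (starRingEnd ℂ) (g.1 0 0) := by
  have h := congrFun (congrFun (coe_inv_eq_adjugate g) 0) 0
  rw [coe_inv, Matrix.adjugate_fin_two] at h
  simpa [Matrix.star_apply] using h.symm

theorem apply_zero_one (g : SU2) : g.1 0 1 = -(starRingEnd ℂ) (g.1 1 0) := by
  have h := congrFun (congrFun (coe_inv_eq_adjugate g) 0) 1
  rw [coe_inv, Matrix.adjugate_fin_two] at h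
  have h' : (starRingEnd ℂ) (g.1 1 0) = -g.1 0 1 := by simpa [Matrix.star_apply] using h
  rw [h', neg_neg]

theorem det_eq (g : SU2) :
    g.1 0 0 * (starRingEnd ℂ) (g.1 0 0) + g.1 1 0 * (starRingEnd ℂ) (g.1 1 0) = 1 := by
  have h := (Matrix.mem_specialUnitaryGroup_iff.1 g.2).2
  rw [Matrix.det_fin_two, apply_one_one, apply_zero_one] at h
  linear_combination h

/-- The element of `SU(2)` with a given unit spinor as its first column. -/
noncomputable def ofUnit (z : Spinor) (hz : Spinor.normSq z = 1) : SU2 :=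
  ⟨!![z 0, -(starRingEnd ℂ) (z 1); z 1, (starRingEnd ℂ) (z 0)], by
    have h : z 0 * (starRingEnd ℂ) (z 0) + z 1 * (starRingEnd ℂ) (z 1) = 1 := by
      rw [← Spinor.normSq_eq_mul_conj, hz, Complex.ofReal_one]
    rw [Matrix.mem_specialUnitaryGroup_iff, Matrix.mem_unitaryGroup_iff]
    constructor
    · ext i j
      fin_cases i <;> fin_cases j <;>
        simp [Matrix.mul_apply, Fin.sum_univ_two, Matrix.star_apply]
      · linear_combination h
      · ring
      · ring
      · linear_combination h
    · rw [Matrix.det_fin_two_of]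
      linear_combination h⟩

theorem act_apply (g : SU2) (z : Spinor) (i : Fin 2) :
    act g z i = g.1 i 0 * z 0 + g.1 i 1 * z 1 := by
  simp [act, Matrix.mulVec, dotProduct, Fin.sum_univ_two]

theorem act_mul (g h : SU2) (z : Spinor) : act (g * h) z = act g (act h z) := by
  rw [act, act, act, Matrix.mulVec_mulVec, coe_mul]

theorem act_one (z : Spinor) : act 1 z = z := by simp [act]

theorem act_smul (g : SU2) (c : ℂ) (z : Spinor) : act g (c • z) = c • act g z := by
  simp [act, Matrix.mulVec_smul]

theorem herm_act_act (g : SU2) (z w : Spinor) :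
    Spinor.herm (act g z) (act g w) = Spinor.herm z w := by
  simp only [Spinor.herm, act_apply, apply_one_one, apply_zero_one, map_add, map_mul, map_neg,
    Complex.conj_conj]
  linear_combination ((starRingEnd ℂ) (z 0) * w 0 + (starRingEnd ℂ) (z 1) * w 1) * det_eq g

theorem dual_act (g : SU2) (z : Spinor) : Spinor.dual (act g z) = act g (Spinor.dual z) := by
  ext i
  fin_cases i <;>
    simp only [Spinor.dual, act_apply, apply_one_one, apply_zero_one, map_add, map_mul, map_neg,
      Complex.conj_conj, Fin.mk_zero, Fin.mk_one,
      Matrix.cons_val_zero, Matrix.cons_val_one] <;> ring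

theorem bracket_act_act (g : SU2) (z w : Spinor) :
    Spinor.bracket (act g z) (act g w) = Spinor.bracket z w := by
  rw [Spinor.bracket, dual_act, herm_act_act, Spinor.bracket]

theorem bracket_act_left (g : SU2) (z w : Spinor) :
    Spinor.bracket (act g z) w = Spinor.bracket z (act g⁻¹ w) := by
  rw [← bracket_act_act g⁻¹, ← act_mul, inv_mul_cancel, act_one]

theorem _root_.Spinor.herm_self (z : Spinor) : Spinor.herm z z = (Spinor.normSq z : ℂ) := by
  rw [Spinor.normSq_eq_mul_conj, Spinor.herm]
  ring

theorem normSq_act (g : SU2) (z : Spinor) : Spinor.normSq (act g z) = Spinor.normSq z := by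
  have h := herm_act_act g z z
  rw [Spinor.herm_self, Spinor.herm_self] at h
  exact_mod_cast h

theorem _root_.Spinor.normSq_smul (c : ℂ) (z : Spinor) :
    Spinor.normSq (c • z) = ‖c‖ ^ 2 * Spinor.normSq z := by
  simp only [Spinor.normSq, Pi.smul_apply, smul_eq_mul, norm_mul]
  ring

theorem _root_.Spinor.normSq_eq_zero {z : Spinor} : Spinor.normSq z = 0 ↔ z = 0 := by
  constructor
  · intro h
    unfold Spinor.normSq at h
    have h0 : ‖z 0‖ ^ 2 = 0 := by nlinarith [sq_nonneg ‖z 0‖, sq_nonneg ‖z 1‖]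
    have h1 : ‖z 1‖ ^ 2 = 0 := by nlinarith [sq_nonneg ‖z 0‖, sq_nonneg ‖z 1‖]
    ext i
    fin_cases i
    · simpa using h0
    · simpa using h1
  · rintro rfl
    simp [Spinor.normSq]

/-- `SU(2)` acts transitively on the spheres in `ℂ²`. -/
theorem exists_act_eq (z : Spinor) :
    ∃ (k : SU2) (r : ℝ), act k ((r : ℂ) • ![1, 0]) = z := by
  by_cases hz : z = 0
  · exact ⟨1, 0, by simp [act_one, hz]⟩
  · have h0 : Spinor.normSq z ≠ 0 := fun h => hz (Spinor.normSq_eq_zero.1 h)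
    have hpos : 0 < Spinor.normSq z := lt_of_le_of_ne (Spinor.normSq_nonneg z) h0.symm
    set r := Real.sqrt (Spinor.normSq z) with hr
    have hr0 : (r : ℂ) ≠ 0 := by exact_mod_cast (Real.sqrt_pos.2 hpos).ne'
    have hu : Spinor.normSq ((r : ℂ)⁻¹ • z) = 1 := by
      rw [Spinor.normSq_smul, norm_inv, Complex.norm_real, Real.norm_of_nonneg (Real.sqrt_nonneg _),
        inv_pow, Real.sq_sqrt hpos.le, inv_mul_cancel₀ h0]
    refine ⟨ofUnit _ hu, r, ?_⟩
    rw [act_smul]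
    ext i
    fin_cases i <;> simp [act_apply, ofUnit, hr0]

/-- Every element of `SU(2)` is conjugate to a diagonal one. -/
theorem exists_conj_diagonal (g : SU2) : ∃ k : SU2, (k⁻¹ * g * k).1 1 0 = 0 := by
  obtain ⟨a, ha⟩ := Module.End.exists_eigenvalue (Matrix.toLin' g.1)
  obtain ⟨v, hv⟩ := ha.exists_hasEigenvector
  obtain ⟨k, r, hk⟩ := exists_act_eq v
  have hr : (r : ℂ) ≠ 0 := by
    intro h
    apply hv.2
    rw [← hk, h, act_smul, zero_smul]
  have hgv : act g v = a • v := by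
    have := hv.apply_eq_smul
    rwa [Matrix.toLin'_apply] at this
  have h : act (k⁻¹ * g * k) ![1, 0] = a • ![1, 0] := by
    have h1 : act k ![1, 0] = (r : ℂ)⁻¹ • v := by
      rw [← hk, act_smul, smul_smul, inv_mul_cancel₀ hr, one_smul]
    rw [act_mul, act_mul, h1, act_smul, hgv, smul_comm, ← h1, act_smul, ← act_mul, inv_mul_cancel,
      act_one]
  exact ⟨k, by simpa [act_apply] using congrFun h 1⟩

theorem continuous_entry (i j : Fin 2) : Continuous fun g : SU2 => g.1 i j :=
  (continuous_apply j).comp ((continuous_apply i).comp continuous_subtype_val)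

theorem continuous_act : Continuous fun p : SU2 × Spinor => act p.1 p.2 := by
  refine continuous_pi fun i => ?_
  simp only [act_apply]
  have h0 := (continuous_entry i 0).comp (continuous_fst (X := SU2) (Y := Spinor))
  have h1 := (continuous_entry i 1).comp (continuous_fst (X := SU2) (Y := Spinor))
  exact (h0.mul ((continuous_apply 0).comp continuous_snd)).add
    (h1.mul ((continuous_apply 1).comp continuous_snd))

/-- The Gaussian measure on spinors is invariant under `SU(2)`: the image of the Lebesgue measure
under a linear automorphism is a multiple of it, and here the factor is `1` by normalization. -/
theorem measurePreserving_act (g : SU2) :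
    MeasurePreserving (act g) Spinor.gaussian Spinor.gaussian := by
  have hc : ∀ h : SU2, Continuous (act h) := fun h =>
    continuous_act.comp (continuous_const.prodMk continuous_id)
  let e : Spinor ≃L[ℝ] Spinor :=
    { toFun := act g
      invFun := act g⁻¹
      map_add' := fun x y => by simp [act, Matrix.mulVec_add]
      map_smul' := fun c x => by
        simp only [RingHom.id_apply]
        have := act_smul g (c : ℂ) x
        simpa using this
      left_inv := fun x => by rw [← act_mul, inv_mul_cancel, act_one]
      right_inv := fun x => by rw [← act_mul, mul_inv_cancel, act_one]
      continuous_toFun := hc g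
      continuous_invFun := hc g⁻¹ }
  have : (Measure.map (act g) (volume : Measure Spinor)).IsAddHaarMeasure :=
    e.isAddHaarMeasure_map volume
  have hv : Measure.map (act g) (volume : Measure Spinor) =
      (Measure.map (act g) (volume : Measure Spinor)).addHaarScalarFactor volume • volume :=
    Measure.isAddLeftInvariant_eq_smul _ _
  set c := (Measure.map (act g) (volume : Measure Spinor)).addHaarScalarFactor volume
  set ρ : Spinor → ENNReal := fun z => ENNReal.ofReal (Real.exp (-Spinor.normSq z) / Real.pi ^ 2)
    with hρ
  have hρm : Measurable ρ := by
    have := Spinor.continuous_normSq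
    fun_prop
  have hmap : Measure.map (act g) Spinor.gaussian = c • Spinor.gaussian := by
    have h1 : Spinor.gaussian = volume.withDensity ρ := rfl
    ext s hs
    rw [Measure.map_apply (hc g).measurable hs, Measure.smul_apply, h1,
      withDensity_apply _ ((hc g).measurable hs), withDensity_apply _ hs,
      ← lintegral_indicator hs, ← lintegral_indicator ((hc g).measurable hs)]
    rw [← lintegral_smul_measure, ← hv, lintegral_map (hρm.indicator hs) (hc g).measurable]
    refine lintegral_congr fun z => ?_
    simp only [Set.indicator, hρ, normSq_act]
    rfl
  refine ⟨(hc g).measurable, ?_⟩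
  have : IsProbabilityMeasure (Measure.map (act g) Spinor.gaussian) :=
    Measure.isProbabilityMeasure_map (hc g).aemeasurable
  have h1 : (1 : ENNReal) = (c : ENNReal) * 1 := by
    have := congrArg (fun m : Measure Spinor => m Set.univ) hmap
    simpa only [measure_univ, Measure.smul_apply, ENNReal.smul_def, smul_eq_mul] using this
  rw [mul_one] at h1
  have h2 : c = 1 := by exact_mod_cast h1.symm
  rw [hmap, h2, one_smul]

/-- The character of the irreducible representation of spin `n / 2`, as the Chebyshev polynomial
`S` of the trace. -/
noncomputable def chi (n : ℕ) (g : SU2) : ℂ := (Polynomial.Chebyshev.S ℂ n).eval g.1.trace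

theorem chi_conj (n : ℕ) (k g : SU2) : chi n (k * g * k⁻¹) = chi n g := by
  have : (k * g * k⁻¹).1.trace = g.1.trace := by
    rw [mul_assoc, coe_mul, Matrix.trace_mul_comm, ← coe_mul, mul_assoc, inv_mul_cancel, mul_one]
  rw [chi, chi, this]

theorem continuous_chi (n : ℕ) : Continuous (chi n) := by
  unfold chi
  refine (Polynomial.continuous _).comp ?_
  simp only [Matrix.trace_fin_two]
  exact (continuous_entry 0 0).add (continuous_entry 1 1)

/-- The Chebyshev polynomial `S` at a trace is the sum of the weights of the spin `n / 2`
representation. -/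
theorem eval_S_add {a b : ℂ} (hab : a * b = 1) (n : ℕ) :
    (Polynomial.Chebyshev.S ℂ n).eval (a + b) =
      ∑ i ∈ Finset.range (n + 1), a ^ i * b ^ (n - i) := by
  have hs : ∀ m : ℕ, ∑ i ∈ Finset.range (m + 2), a ^ i * b ^ (m + 1 - i) =
      b * ∑ i ∈ Finset.range (m + 1), a ^ i * b ^ (m - i) + a ^ (m + 1) := by
    intro m
    rw [Finset.sum_range_succ, Finset.mul_sum]
    congr 1
    · refine Finset.sum_congr rfl fun i hi => ?_
      rw [Finset.mem_range] at hi
      rw [Nat.succ_sub (by omega), pow_succ]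
      ring
    · simp
  induction n using Nat.twoStepInduction with
  | zero => simp
  | one => simp [Finset.sum_range_succ]; ring
  | more n ih0 ih1 =>
    have h := Polynomial.Chebyshev.S_add_two ℂ n
    have e1 : ((n + 2 : ℕ) : ℤ) = (n : ℤ) + 2 := by push_cast; ring
    have e2 : ((n + 1 : ℕ) : ℤ) = (n : ℤ) + 1 := by push_cast; ring
    rw [e1, h, Polynomial.eval_sub, Polynomial.eval_mul, Polynomial.eval_X, ih0, ← e2, ih1,
      hs (n + 1), hs n]
    linear_combination (∑ i ∈ Finset.range (n + 1), a ^ i * b ^ (n - i)) * hab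

/-- The Gaussian integral of a function of `⟨z|z⟩` and `⟨z|g|z⟩` may be computed for `g` diagonal,
by invariance of the Gaussian measure. -/
theorem exists_diagonal_integral (g : SU2) : ∃ a b : ℂ, a * b = 1 ∧ a + b = g.1.trace ∧
    ∀ F : ℝ → ℂ → ℂ, ∫ z, F (Spinor.normSq z) (Spinor.herm z (act g z)) ∂Spinor.gaussian =
      ∫ z, F (Spinor.normSq z) (a * (z 0 * (starRingEnd ℂ) (z 0)) +
        b * (z 1 * (starRingEnd ℂ) (z 1))) ∂Spinor.gaussian := by
  obtain ⟨k, h10⟩ := exists_conj_diagonal g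
  obtain ⟨a, h00⟩ : ∃ a, (k⁻¹ * g * k).1 0 0 = a := ⟨_, rfl⟩
  refine ⟨a, (starRingEnd ℂ) a, ?_, ?_, fun F => ?_⟩
  · have := det_eq (k⁻¹ * g * k)
    simpa [h00, h10] using this
  · have h1 : (k⁻¹ * g * k).1.trace = g.1.trace := by
      rw [coe_mul, Matrix.trace_mul_comm, ← coe_mul, ← mul_assoc, mul_inv_cancel, one_mul]
    rw [← h1, Matrix.trace_fin_two, apply_one_one, h00]
  · have hc : Continuous (act k) := continuous_act.comp (continuous_const.prodMk continuous_id)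
    have hme : MeasurableEmbedding (act k) := by
      let e : Spinor ≃ₜ Spinor :=
        { toFun := act k
          invFun := act k⁻¹
          left_inv := fun x => by rw [← act_mul, inv_mul_cancel, act_one]
          right_inv := fun x => by rw [← act_mul, mul_inv_cancel, act_one]
          continuous_toFun := hc
          continuous_invFun := continuous_act.comp (continuous_const.prodMk continuous_id) }
      exact e.measurableEmbedding
    rw [← (measurePreserving_act k).integral_comp hme]
    refine integral_congr_ae (ae_of_all _ fun z => ?_)
    simp only
    congr 1
    · rw [normSq_act]
    · rw [← herm_act_act k⁻¹, ← act_mul, ← act_mul, ← act_mul, inv_mul_cancel, act_one, ← mul_assoc,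
        Spinor.herm, act_apply, act_apply, h00, h10, apply_one_one, apply_zero_one, h00, h10]
      simp
      ring

theorem integral_herm_act_pow (n : ℕ) (g : SU2) :
    ∫ z, Spinor.herm z (act g z) ^ n ∂Spinor.gaussian = (n.factorial : ℂ) * chi n g := by
  obtain ⟨a, b, hab, htr, h⟩ := exists_diagonal_integral g
  rw [h fun _ x => x ^ n, Spinor.integral_diagonal_pow, chi, ← htr, eval_S_add hab]

theorem integral_faceAmplitude_mul_herm_act_pow (n : ℕ) (g : SU2) :
    ∫ z, (faceAmplitude z : ℂ) * Spinor.herm z (act g z) ^ n ∂Spinor.gaussian =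
      ((n : ℂ) + 1) * (n.factorial : ℂ) * chi n g := by
  obtain ⟨a, b, hab, htr, h⟩ := exists_diagonal_integral g
  have := h fun s x => ((s - 1 : ℝ) : ℂ) * x ^ n
  refine Eq.trans this ?_
  rw [chi, ← htr, eval_S_add hab]
  exact Spinor.integral_faceAmplitude_mul_diagonal_pow a b n

end SU2

/-! ### Schur orthogonality and the Clebsch-Gordan multiplicities -/

namespace SU2

/-- Continuous functions on a compact space are integrable for finite measures. -/
theorem _root_.Continuous.integrable_of_compactSpace {X : Type*} [TopologicalSpace X]
    [CompactSpace X] [MeasurableSpace X] [OpensMeasurableSpace X] [SecondCountableTopology X]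
    {μ : Measure X} [IsFiniteMeasure μ] {f : X → ℂ} (hf : Continuous f) : Integrable f μ :=
  hf.integrable_of_hasCompactSupport (HasCompactSupport.of_compactSpace f)

/-- The diagonal element of `SU(2)` with entries `exp (± i t)`. -/
noncomputable def torus (t : ℝ) : SU2 :=
  ofUnit ![Complex.exp (t * Complex.I), 0] (by simp [Spinor.normSq, Complex.norm_exp_ofReal_mul_I])

theorem torus_apply (t : ℝ) : (torus t).1 0 0 = Complex.exp (t * Complex.I) ∧
    (torus t).1 1 0 = 0 := by
  simp [torus, ofUnit]

theorem conj_exp (t : ℝ) : (starRingEnd ℂ) (Complex.exp (t * Complex.I)) =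
    Complex.exp (-(t * Complex.I)) := by
  rw [← Complex.exp_conj, map_mul, Complex.conj_I, Complex.conj_ofReal, mul_neg]

theorem torus_mul_apply_zero (t : ℝ) (g : SU2) :
    (torus t * g).1 0 0 = Complex.exp (t * Complex.I) * g.1 0 0 := by
  rw [coe_mul, Matrix.mul_apply, Fin.sum_univ_two, apply_zero_one, (torus_apply t).1,
    (torus_apply t).2]
  simp

theorem torus_conj_apply (t : ℝ) (g : SU2) :
    (torus t * g * (torus t)⁻¹).1 0 0 = g.1 0 0 ∧
    (torus t * g * (torus t)⁻¹).1 0 1 = Complex.exp (t * Complex.I) ^ 2 * g.1 0 1 := by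
  have hu : Complex.exp (t * Complex.I) * Complex.exp (-(t * Complex.I)) = 1 := by
    rw [← Complex.exp_add, add_neg_cancel, Complex.exp_zero]
  constructor
  · simp only [coe_mul, coe_inv, Matrix.mul_apply, Fin.sum_univ_two, Matrix.star_apply,
      apply_zero_one (torus t), (torus_apply t).1, (torus_apply t).2,
      RCLike.star_def, conj_exp, map_zero, neg_zero]
    linear_combination g.1 0 0 * hu
  · simp only [coe_mul, coe_inv, Matrix.mul_apply, Fin.sum_univ_two, Matrix.star_apply,
      apply_zero_one (torus t), apply_one_one (torus t), (torus_apply t).1, (torus_apply t).2,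
      RCLike.star_def, conj_exp, map_zero, neg_zero]
    rw [← conj_exp, Complex.conj_conj]
    ring

theorem continuous_conj_entry (g : SU2) (i j : Fin 2) :
    Continuous fun k : SU2 => (k * g * k⁻¹).1 i j :=
  (continuous_entry i j).comp (by fun_prop)

/-- The average of the matrix coefficient `⟨0|·|0⟩ ^ n` over the conjugacy class of `g`. -/
noncomputable def classAverage (n : ℕ) (g : SU2) : ℂ := ∫ k, (k * g * k⁻¹).1 0 0 ^ n ∂haar

/-- Conjugation with the torus multiplies the off-diagonal entry by an arbitrary phase. -/
theorem integral_conj_torus (n m : ℕ) (hm : m ≠ 0) (g : SU2) :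
    ∫ k, (k * g * k⁻¹).1 0 0 ^ n * (k * g * k⁻¹).1 0 1 ^ m ∂haar = 0 := by
  refine integral_eq_zero_of_mul_left_eq_neg (g := torus (Real.pi / (2 * m))) fun k => ?_
  have h := torus_conj_apply (Real.pi / (2 * m)) (k * g * k⁻¹)
  have e : torus (Real.pi / (2 * m)) * k * g * (torus (Real.pi / (2 * m)) * k)⁻¹ =
      torus (Real.pi / (2 * m)) * (k * g * k⁻¹) * (torus (Real.pi / (2 * m)))⁻¹ := by group
  have h2 : (Complex.exp ((Real.pi / (2 * m) : ℝ) * Complex.I) ^ 2) ^ m = -1 := by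
    rw [← pow_mul, ← Complex.exp_nat_mul, ← Complex.exp_pi_mul_I]
    congr 1
    have : (m : ℂ) ≠ 0 := by exact_mod_cast hm
    push_cast
    field_simp
  rw [e, h.1, h.2, mul_pow, h2]
  ring

theorem integral_conj_linear_pow (n : ℕ) (g : SU2) (v : Spinor) :
    ∫ k, act (k * g * k⁻¹) v 0 ^ n ∂haar = v 0 ^ n * classAverage n g := by
  have h1 : ∀ k : SU2, act (k * g * k⁻¹) v 0 ^ n = ∑ m ∈ Finset.range (n + 1),
      (v 0 ^ m * v 1 ^ (n - m) * (n.choose m : ℂ)) *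
        ((k * g * k⁻¹).1 0 0 ^ m * (k * g * k⁻¹).1 0 1 ^ (n - m)) := by
    intro k
    rw [act_apply, add_pow]
    refine Finset.sum_congr rfl fun m _ => ?_
    simp only [mul_pow]
    ring
  simp_rw [h1]
  rw [integral_finsetSum]
  swap
  · intro m _
    exact Continuous.integrable_of_compactSpace (continuous_const.mul
      (((continuous_conj_entry g 0 0).pow m).mul ((continuous_conj_entry g 0 1).pow (n - m))))
  simp_rw [integral_const_mul]
  rw [Finset.sum_eq_single n]
  · simp [classAverage]
  · intro m hm hmn
    rw [Finset.mem_range] at hm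
    rw [integral_conj_torus _ _ (by omega), mul_zero]
  · simp

/-- Schur's lemma for the symmetric powers: conjugation averages an operator to a scalar. -/
theorem integral_bracket_conj_pow (n : ℕ) (g : SU2) (u v : Spinor) :
    ∫ k, Spinor.bracket u (act (k * g * k⁻¹) v) ^ n ∂haar =
      Spinor.bracket u v ^ n * classAverage n g := by
  -- rotate the dual of `u` into a multiple of the first basis vector
  obtain ⟨κ, r, hκ⟩ := exists_act_eq (Spinor.dual u)
  have hb : ∀ w, Spinor.bracket u (act κ w) = (r : ℂ) * w 0 := by
    intro w
    rw [Spinor.bracket, ← hκ, herm_act_act]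
    simp [Spinor.herm]
  have h1 := integral_mul_left_eq_self (μ := haar)
    (fun k => Spinor.bracket u (act (k * g * k⁻¹) v) ^ n) κ
  rw [← h1]
  have h2 : ∀ k : SU2, Spinor.bracket u (act (κ * k * g * (κ * k)⁻¹) v) ^ n =
      (r : ℂ) ^ n * act (k * g * k⁻¹) (act κ⁻¹ v) 0 ^ n := by
    intro k
    have e : κ * k * g * (κ * k)⁻¹ = κ * ((k * g * k⁻¹) * κ⁻¹) := by group
    rw [e, act_mul, hb, act_mul, mul_pow]
  simp_rw [h2]
  rw [integral_const_mul, integral_conj_linear_pow, ← mul_assoc, ← mul_pow, ← hb, ← act_mul,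
    mul_inv_cancel, act_one]

theorem _root_.Spinor.bracket_neg_dual (z w : Spinor) :
    Spinor.bracket (-Spinor.dual z) w = Spinor.herm z w := by
  simp [Spinor.bracket, Spinor.herm, Spinor.dual]

theorem integral_herm_conj_pow (n : ℕ) (g : SU2) (z : Spinor) :
    ∫ k, Spinor.herm z (act (k * g * k⁻¹) z) ^ n ∂haar =
      (Spinor.normSq z : ℂ) ^ n * classAverage n g := by
  simp_rw [← Spinor.bracket_neg_dual]
  rw [integral_bracket_conj_pow, Spinor.bracket_neg_dual, Spinor.herm_self]

theorem _root_.Spinor.norm_herm_le (z w : Spinor) :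
    ‖Spinor.herm z w‖ ≤ (Spinor.normSq z + Spinor.normSq w) / 2 := by
  unfold Spinor.herm Spinor.normSq
  refine (norm_add_le _ _).trans ?_
  rw [norm_mul, norm_mul, RCLike.norm_conj, RCLike.norm_conj]
  nlinarith [sq_nonneg (‖z 0‖ - ‖w 0‖), sq_nonneg (‖z 1‖ - ‖w 1‖)]

theorem _root_.Spinor.continuous_herm :
    Continuous fun p : Spinor × Spinor => Spinor.herm p.1 p.2 := by
  unfold Spinor.herm
  have h : ∀ i, Continuous fun p : Spinor × Spinor => (starRingEnd ℂ) (p.1 i) := fun i =>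
    Complex.continuous_conj.comp ((continuous_apply i).comp continuous_fst)
  have h' : ∀ i, Continuous fun p : Spinor × Spinor => p.2 i := fun i =>
    (continuous_apply i).comp continuous_snd
  exact ((h 0).mul (h' 0)).add ((h 1).mul (h' 1))

/-- The class average of the matrix coefficient is the normalized character: integrate
`⟨z|k g k⁻¹|z⟩ ^ n` over `z` and `k` in both orders. -/
theorem classAverage_eq (n : ℕ) (g : SU2) : classAverage n g = chi n g / ((n : ℂ) + 1) := by
  have hn : (n : ℂ) + 1 ≠ 0 := by exact_mod_cast n.succ_ne_zero
  have hf : (n.factorial : ℂ) ≠ 0 := by exact_mod_cast (Nat.factorial_pos n).ne'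
  have hcont : Continuous fun p : Spinor × SU2 =>
      Spinor.herm p.1 (act (p.2 * g * p.2⁻¹) p.1) ^ n := by
    refine Continuous.pow (Spinor.continuous_herm.comp (continuous_fst.prodMk
      (continuous_act.comp (Continuous.prodMk ?_ continuous_fst)))) n
    fun_prop
  have htame : Tame (fun p : Spinor × SU2 => Spinor.normSq p.1) fun p =>
      Spinor.herm p.1 (act (p.2 * g * p.2⁻¹) p.1) ^ n := by
    refine ⟨hcont, 1, n, fun p => ?_⟩
    rw [norm_pow, one_mul]
    gcongr
    refine (Spinor.norm_herm_le _ _).trans ?_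
    rw [normSq_act]
    linarith
  have hint : Integrable (fun p : Spinor × SU2 =>
      Spinor.herm p.1 (act (p.2 * g * p.2⁻¹) p.1) ^ n) (Spinor.gaussian.prod haar) := by
    obtain ⟨C, _, hC⟩ := htame.exists_le_exp (fun p : Spinor × SU2 => Spinor.normSq_nonneg p.1)
      (c := 1 / 2) (by norm_num)
    have := ((Spinor.integrable_exp_mul_normSq (c := 1 / 2)
      (by norm_num)).const_mul C).comp_fst haar
    exact this.mono' hcont.aestronglyMeasurable (ae_of_all _ hC)
  have h := integral_integral_swap (μ := Spinor.gaussian) (ν := haar)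
    (f := fun z k => Spinor.herm z (act (k * g * k⁻¹) z) ^ n) hint
  simp_rw [integral_herm_conj_pow, integral_herm_act_pow, chi_conj] at h
  rw [integral_mul_const, Spinor.integral_normSq_pow, integral_const, probReal_univ, one_smul] at h
  rw [eq_div_iff hn]
  apply mul_left_cancel₀ hf
  linear_combination h

theorem classAverage_conj (n : ℕ) (k g : SU2) :
    classAverage n (k * g * k⁻¹) = classAverage n g := by
  rw [classAverage_eq, classAverage_eq, chi_conj]

theorem integral_chi (n : ℕ) : ∫ g, chi n g ∂haar = if n = 0 then 1 else 0 := by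
  split_ifs with h
  · subst h
    simp [chi]
  · have hn : (n : ℂ) + 1 ≠ 0 := by exact_mod_cast n.succ_ne_zero
    -- left multiplication with the torus element of angle `π / n` changes the sign
    have h0 : ∫ g : SU2, g.1 0 0 ^ n ∂haar = 0 := by
      refine integral_eq_zero_of_mul_left_eq_neg (g := torus (Real.pi / n)) fun k => ?_
      have h2 : Complex.exp ((Real.pi / n : ℝ) * Complex.I) ^ n = -1 := by
        rw [← Complex.exp_nat_mul, ← Complex.exp_pi_mul_I]
        congr 1
        have : (n : ℂ) ≠ 0 := by exact_mod_cast h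
        push_cast
        field_simp
      rw [torus_mul_apply_zero, mul_pow, h2]
      ring
    have h1 : ∀ g, chi n g = ((n : ℂ) + 1) * classAverage n g := by
      intro g
      rw [classAverage_eq]
      field_simp
    simp_rw [h1, classAverage]
    have hint : Integrable (fun p : SU2 × SU2 => (p.2 * p.1 * p.2⁻¹).1 0 0 ^ n) (haar.prod haar) :=
      Continuous.integrable_of_compactSpace (((continuous_entry 0 0).comp (by fun_prop)).pow n)
    rw [integral_const_mul, integral_integral_swap hint]
    have h3 : ∀ k : SU2, ∫ g, (k * g * k⁻¹).1 0 0 ^ n ∂haar = 0 := by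
      intro k
      rw [integral_mul_right_eq_self (fun g : SU2 => (k * g * k⁻¹).1 0 0 ^ n) k |>.symm]
      have e : ∀ g : SU2, k * (g * k) * k⁻¹ = k * g := fun g => by group
      simp_rw [e]
      rw [integral_mul_left_eq_self (fun g : SU2 => g.1 0 0 ^ n) k, h0]
    rw [integral_congr_ae (ae_of_all _ h3), integral_zero, mul_zero]

/-- A product formula for all integers `b`; for `b < a` there are terms of negative index, which
vanish or cancel against other terms. -/
theorem _root_.Polynomial.Chebyshev.S_mul_S {R : Type*} [CommRing R] (a : ℕ) (b : ℤ) :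
    Polynomial.Chebyshev.S R a * Polynomial.Chebyshev.S R b =
      ∑ i ∈ Finset.range (a + 1), Polynomial.Chebyshev.S R (b + a - 2 * i) := by
  induction a using Nat.twoStepInduction with
  | zero => simp
  | one =>
    have h := Polynomial.Chebyshev.S_add_one R b
    simp only [Nat.cast_one, Polynomial.Chebyshev.S_one, Finset.sum_range_succ,
      Finset.sum_range_zero, Nat.cast_zero]
    rw [mul_zero, sub_zero, zero_add, h, mul_one, show b + 1 - 2 = b - 1 by ring]
    ring
  | more a ih0 ih1 =>
    have e1 : ((a + 2 : ℕ) : ℤ) = (a : ℤ) + 2 := by push_cast; ring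
    have e2 : ((a + 1 : ℕ) : ℤ) = (a : ℤ) + 1 := by push_cast; ring
    have hX : ∀ c : ℤ, Polynomial.X * Polynomial.Chebyshev.S R c =
        Polynomial.Chebyshev.S R (c + 1) + Polynomial.Chebyshev.S R (c - 1) := by
      intro c
      rw [Polynomial.Chebyshev.S_add_one]
      ring
    rw [e1, Polynomial.Chebyshev.S_add_two, sub_mul, mul_assoc, ← e2, ih1, ih0, Finset.mul_sum]
    simp_rw [hX]
    rw [Finset.sum_add_distrib, Finset.sum_range_succ _ (a + 1 + 1)]
    rw [Finset.sum_range_succ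
      (fun i : ℕ => Polynomial.Chebyshev.S R (b + ((a + 1 : ℕ) : ℤ) - 2 * (i : ℤ) - 1)) (a + 1)]
    have e3 : ∀ i : ℕ, b + ((a + 1 : ℕ) : ℤ) - 2 * (i : ℤ) - 1 = b + a - 2 * i := by
      intro i; push_cast; ring
    have e4 : ∀ i : ℕ, b + ((a + 1 : ℕ) : ℤ) - 2 * (i : ℤ) + 1 = b + ((a : ℤ) + 2) - 2 * i := by
      intro i; push_cast; ring
    simp_rw [e3, e4]
    have e5 : b + (a : ℤ) - 2 * ((a + 1 : ℕ) : ℤ) =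
        b + ((a : ℤ) + 2) - 2 * ((a + 1 + 1 : ℕ) : ℤ) := by
      push_cast; ring
    rw [e5]
    ring

theorem S_mul_S_nat {R : Type*} [CommRing R] (a b : ℕ) :
    Polynomial.Chebyshev.S R a * Polynomial.Chebyshev.S R b =
      ∑ i ∈ Finset.range (min a b + 1), Polynomial.Chebyshev.S R ((a + b - 2 * i : ℕ) : ℤ) := by
  wlog hab : a ≤ b generalizing a b
  · rw [mul_comm, this b a (by omega), min_comm, add_comm a b]
  · rw [Polynomial.Chebyshev.S_mul_S, min_eq_left hab]
    refine Finset.sum_congr rfl fun i hi => ?_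
    rw [Finset.mem_range] at hi
    congr 1
    omega

/-- The Clebsch-Gordan decomposition of a product of two characters. -/
theorem chi_mul_chi (a b : ℕ) (g : SU2) :
    chi a g * chi b g = ∑ i ∈ Finset.range (min a b + 1), chi (a + b - 2 * i) g := by
  rw [chi, chi, ← Polynomial.eval_mul, S_mul_S_nat, Polynomial.eval_finsetSum]
  rfl

theorem integral_chi_mul_chi (a b : ℕ) :
    ∫ g, chi a g * chi b g ∂haar = if a = b then 1 else 0 := by
  simp_rw [chi_mul_chi]
  rw [integral_finsetSum _ fun i _ => (continuous_chi _).integrable_of_compactSpace]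
  simp_rw [integral_chi]
  split_ifs with h
  · subst h
    rw [Finset.sum_eq_single a]
    · rw [if_pos (by omega)]
    · intro i hi hia
      rw [Finset.mem_range] at hi
      rw [if_neg (by omega)]
    · simp
  · refine Finset.sum_eq_zero fun i hi => ?_
    rw [Finset.mem_range] at hi
    rw [if_neg (by omega)]

/-- The multiplicity of the trivial representation in the tensor product of the representations of
spins `a / 2`, `b / 2` and `c / 2`, read off from the Clebsch-Gordan decomposition for `b` and `c`.
The subtraction does not truncate, since `2 * i ≤ b + c`. -/
noncomputable def multiplicity (a b c : ℕ) : ℝ :=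
  ∑ i ∈ Finset.range (min b c + 1), if a = b + c - 2 * i then 1 else 0

theorem multiplicity_nonneg (a b c : ℕ) : 0 ≤ multiplicity a b c :=
  Finset.sum_nonneg fun i _ => by split_ifs <;> norm_num

theorem even_of_multiplicity_ne_zero {a b c : ℕ} (h : multiplicity a b c ≠ 0) :
    Even (a + b + c) := by
  obtain ⟨i, hi, h'⟩ := Finset.exists_ne_zero_of_sum_ne_zero h
  rw [Finset.mem_range] at hi
  have : a = b + c - 2 * i := by
    by_contra hne
    exact h' (if_neg hne)
  exact ⟨b + c - i, by omega⟩

theorem integral_chi_mul_chi_mul_chi (a b c : ℕ) :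
    ∫ g, chi a g * (chi b g * chi c g) ∂haar = (multiplicity a b c : ℂ) := by
  simp_rw [chi_mul_chi, Finset.mul_sum]
  rw [integral_finsetSum]
  swap
  · exact fun i _ => Continuous.integrable_of_compactSpace
      ((continuous_chi _).mul (continuous_chi _))
  simp_rw [integral_chi_mul_chi]
  rw [multiplicity, Complex.ofReal_sum]
  exact Finset.sum_congr rfl fun i _ => by split_ifs <;> simp

/-- The dimensions on both sides of the Clebsch-Gordan decomposition agree. -/
theorem hasSum_mul_multiplicity (b c : ℕ) :
    HasSum (fun a : ℕ => ((a : ℝ) + 1) * multiplicity a b c) (((b : ℝ) + 1) * ((c : ℝ) + 1)) := by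
  have h1 : ∀ i : ℕ, HasSum (fun a : ℕ => ((a : ℝ) + 1) * if a = b + c - 2 * i then 1 else 0)
      (((b + c - 2 * i : ℕ) : ℝ) + 1) := by
    intro i
    convert! hasSum_ite_eq (b + c - 2 * i) (((b + c - 2 * i : ℕ) : ℝ) + 1) using 2 with a
    split_ifs with h
    · rw [← h, mul_one]
    · rw [mul_zero]
  have h2 := hasSum_sum (s := Finset.range (min b c + 1)) fun i _ => h1 i
  -- `2` is the trace of the identity
  have h3 := congrArg (Polynomial.eval (2 : ℝ)) (S_mul_S_nat (R := ℝ) b c)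
  simp only [Polynomial.eval_mul, Polynomial.eval_finsetSum, Polynomial.Chebyshev.S_eval_two,
    Int.cast_natCast] at h3
  rw [h3]
  simpa only [multiplicity, Finset.mul_sum] using h2

end SU2

/-! ### Gaussian integration over some of the half-links -/

section TotalNormSq

variable {X : Type*} [Fintype X]

/-- The sum of the norms squared of all spinors. -/
noncomputable def totalNormSq (ζ : X → Spinor) : ℝ := ∑ x, Spinor.normSq (ζ x)

theorem totalNormSq_nonneg (ζ : X → Spinor) : 0 ≤ totalNormSq ζ :=
  Finset.sum_nonneg fun _ _ => Spinor.normSq_nonneg _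

theorem continuous_totalNormSq : Continuous (totalNormSq : (X → Spinor) → ℝ) :=
  continuous_finsetSum _ fun x _ => Spinor.continuous_normSq.comp (continuous_apply x)

theorem normSq_le_totalNormSq (ζ : X → Spinor) (x : X) : Spinor.normSq (ζ x) ≤ totalNormSq ζ :=
  Finset.single_le_sum (f := fun x => Spinor.normSq (ζ x)) (fun _ _ => Spinor.normSq_nonneg _)
    (Finset.mem_univ x)

variable {H : Type*} [TopologicalSpace H] [CompactSpace H] [MeasurableSpace H] [BorelSpace H]
  (ν : Measure H) [IsProbabilityMeasure ν]

theorem Tame.integral_right {f : (X → Spinor) × H → ℂ}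
    (hf : Tame (fun p : (X → Spinor) × H => totalNormSq p.1) f) :
    Tame totalNormSq fun ζ => ∫ h, f (ζ, h) ∂ν := by
  obtain ⟨C, hC, D, hb⟩ := hf.exists_bound (fun p : (X → Spinor) × H => totalNormSq_nonneg p.1)
  refine ⟨?_, C, D, fun ζ => ?_⟩
  · have := continuous_parametric_integral_of_continuous (μ := ν) (f := fun ζ h => f (ζ, h)) hf.cont
      isCompact_univ
    simpa using this
  · refine (norm_integral_le_of_norm_le_const (C := C * (1 + totalNormSq ζ) ^ D)
      (ae_of_all _ fun h => hb (ζ, h))).trans ?_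
    simp

end TotalNormSq

section Marginal

variable {X : Type*} [DecidableEq X]

/-- The integral of a function of spinors over the spinors labelled by `A`, against the Gaussian
measure, as a function of all spinors. -/
noncomputable def marginal (A : Finset X) (f : (X → Spinor) → ℂ) (ζ : X → Spinor) : ℂ :=
  ∫ η : A → Spinor, f (overwrite A ζ η) ∂(Measure.pi fun _ => Spinor.gaussian)

theorem continuous_overwrite (A : Finset X) (ζ : X → Spinor) : Continuous (overwrite A ζ) := by
  refine continuous_pi fun x => ?_
  unfold overwrite
  by_cases h : x ∈ A
  · simpa only [h, dif_pos] using continuous_apply _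
  · simpa only [h, dif_neg, not_false_eq_true] using continuous_const

theorem marginal_empty (f : (X → Spinor) → ℂ) (ζ : X → Spinor) : marginal ∅ f ζ = f ζ := by
  have : ∀ η : (∅ : Finset X) → Spinor, overwrite ∅ ζ η = ζ := fun η => rfl
  simp [marginal, this]

theorem overwrite_insert {A : Finset X} {x : X} (hx : x ∉ A) :
    ∃ e : (({x} : Finset X) → Spinor) × (A → Spinor) ≃ᵐ
        ((({x} : Finset X) ∪ A : Finset X) → Spinor),
      MeasurePreserving e ((Measure.pi fun _ => Spinor.gaussian).prod
        (Measure.pi fun _ => Spinor.gaussian)) (Measure.pi fun _ => Spinor.gaussian) ∧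
      ∀ ζ p, overwrite ({x} ∪ A) ζ (e p) =
        overwrite A (Function.update ζ x (p.1 ⟨x, Finset.mem_singleton_self x⟩)) p.2 := by
  have hd : Disjoint ({x} : Finset X) A := Finset.disjoint_singleton_left.2 hx
  refine ⟨MeasurableEquiv.piFinsetUnion (fun _ : X => Spinor) hd,
    measurePreserving_piFinsetUnion hd fun _ => Spinor.gaussian, fun ζ p => ?_⟩
  have h := Function.updateFinset_updateFinset (x := ζ) (y := p.1) (z := p.2) hd
  rw [Function.updateFinset_singleton] at h
  exact h.symm

theorem integral_overwrite_insert {A : Finset X} {x : X} (hx : x ∉ A) (f : (X → Spinor) → ℂ)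
    (ζ : X → Spinor) : marginal (insert x A) f ζ =
      ∫ p : Spinor × (A → Spinor), f (overwrite A (Function.update ζ x p.1) p.2)
        ∂(Spinor.gaussian.prod (Measure.pi fun _ => Spinor.gaussian)) := by
  obtain ⟨e, he, hov⟩ := overwrite_insert hx
  rw [Finset.insert_eq, marginal, ← he.integral_comp']
  simp_rw [hov]
  have h1 := (measurePreserving_piUnique fun _ : ({x} : Finset X) => Spinor.gaussian).prod
    (MeasurePreserving.id (Measure.pi fun _ : A => Spinor.gaussian))
  exact h1.integral_comp ((MeasurableEquiv.piUnique _).prodCongr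
    (MeasurableEquiv.refl _)).measurableEmbedding
    (fun p : Spinor × (A → Spinor) => f (overwrite A (Function.update ζ x p.1) p.2))

theorem integrable_overwrite_insert {A : Finset X} {x : X} (hx : x ∉ A) (f : (X → Spinor) → ℂ)
    (ζ : X → Spinor) (hf : Integrable (fun η => f (overwrite (insert x A) ζ η))
      (Measure.pi fun _ => Spinor.gaussian)) :
    Integrable (fun p : Spinor × (A → Spinor) => f (overwrite A (Function.update ζ x p.1) p.2))
        (Spinor.gaussian.prod (Measure.pi fun _ => Spinor.gaussian)) := by
  obtain ⟨e, he, hov⟩ := overwrite_insert hx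
  rw [Finset.insert_eq, ← he.integrable_comp_emb e.measurableEmbedding] at hf
  simp only [Function.comp_def, hov] at hf
  have h1 := (measurePreserving_piUnique fun _ : ({x} : Finset X) => Spinor.gaussian).prod
    (MeasurePreserving.id (Measure.pi fun _ : A => Spinor.gaussian))
  rw [← h1.integrable_comp_emb ((MeasurableEquiv.piUnique _).prodCongr
    (MeasurableEquiv.refl _)).measurableEmbedding]
  exact hf

/-- Fubini: one spinor may be integrated over last. -/
theorem marginal_insert {A : Finset X} {x : X} (hx : x ∉ A) (f : (X → Spinor) → ℂ)
    (ζ : X → Spinor) (hf : Integrable (fun η => f (overwrite (insert x A) ζ η))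
      (Measure.pi fun _ => Spinor.gaussian)) :
    marginal (insert x A) f ζ = ∫ y, marginal A f (Function.update ζ x y) ∂Spinor.gaussian := by
  rw [integral_overwrite_insert hx, integral_prod _ (integrable_overwrite_insert hx f ζ hf)]
  rfl

theorem overwrite_update {A : Finset X} {x : X} (hx : x ∉ A) (ζ : X → Spinor) (y : Spinor)
    (η : A → Spinor) :
    overwrite A (Function.update ζ x y) η = Function.update (overwrite A ζ η) x y := by
  ext1 x'
  unfold overwrite
  by_cases h : x' = x
  · subst h
    simp [hx]
  · simp [Function.update_of_ne h]

/-- Fubini: one spinor may be integrated over first. -/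
theorem marginal_insert' {A : Finset X} {x : X} (hx : x ∉ A) (f : (X → Spinor) → ℂ)
    (ζ : X → Spinor) (hf : Integrable (fun η => f (overwrite (insert x A) ζ η))
      (Measure.pi fun _ => Spinor.gaussian)) :
    marginal (insert x A) f ζ =
      marginal A (fun ζ' => ∫ y, f (Function.update ζ' x y) ∂Spinor.gaussian) ζ := by
  rw [integral_overwrite_insert hx, integral_prod_symm _ (integrable_overwrite_insert hx f ζ hf)]
  simp_rw [overwrite_update hx]
  rfl

variable [Fintype X]

theorem totalNormSq_overwrite_le (A : Finset X) (ζ : X → Spinor) (η : A → Spinor) :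
    totalNormSq (overwrite A ζ η) ≤ totalNormSq ζ + ∑ x : A, Spinor.normSq (η x) := by
  unfold totalNormSq
  rw [← Finset.sum_add_sum_compl A]
  rw [← Finset.sum_add_sum_compl A fun x => Spinor.normSq (ζ x)]
  have h1 : ∑ x ∈ A, Spinor.normSq (overwrite A ζ η x) = ∑ x : A, Spinor.normSq (η x) := by
    rw [← Finset.sum_attach, Finset.univ_eq_attach]
    refine Finset.sum_congr rfl fun x _ => ?_
    simp [overwrite]
  have h2 : ∑ x ∈ Aᶜ, Spinor.normSq (overwrite A ζ η x) = ∑ x ∈ Aᶜ, Spinor.normSq (ζ x) := by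
    refine Finset.sum_congr rfl fun x hx => ?_
    rw [overwrite, dif_neg (Finset.mem_compl.1 hx)]
  have h3 : 0 ≤ ∑ x ∈ A, Spinor.normSq (ζ x) :=
    Finset.sum_nonneg fun _ _ => Spinor.normSq_nonneg _
  rw [h1, h2]
  linarith

theorem integrable_exp_totalNormSq (A : Finset X) (ζ : X → Spinor) {c : ℝ} (hc0 : 0 ≤ c)
    (hc : c < 1) : Integrable (fun η : A → Spinor => Real.exp (c * totalNormSq (overwrite A ζ η)))
      (Measure.pi fun _ => Spinor.gaussian) := by
  have h := (Integrable.fintype_prod (μ := fun _ : A => Spinor.gaussian)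
    (f := fun _ (z : Spinor) => Real.exp (c * Spinor.normSq z))
    (fun _ => Spinor.integrable_exp_mul_normSq hc)).const_mul (Real.exp (c * totalNormSq ζ))
  refine h.mono' ?_ (ae_of_all _ fun η => ?_)
  · exact (Real.continuous_exp.comp (continuous_const.mul
      (continuous_totalNormSq.comp (continuous_overwrite A ζ)))).aestronglyMeasurable
  · rw [Real.norm_of_nonneg (Real.exp_pos _).le, ← Real.exp_sum, ← Real.exp_add, ← Finset.mul_sum,
      ← mul_add]
    exact Real.exp_le_exp.2 (mul_le_mul_of_nonneg_left (totalNormSq_overwrite_le A ζ η) hc0)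

theorem integrable_overwrite_of_le_exp {f : (X → Spinor) → ℂ} {C c : ℝ} (A : Finset X)
    (ζ : X → Spinor) (hc0 : 0 ≤ c) (hc : c < 1)
    (hm : AEStronglyMeasurable (fun η => f (overwrite A ζ η)) (Measure.pi fun _ => Spinor.gaussian))
    (hf : ∀ ζ, ‖f ζ‖ ≤ C * Real.exp (c * totalNormSq ζ)) :
    Integrable (fun η => f (overwrite A ζ η)) (Measure.pi fun _ => Spinor.gaussian) :=
  ((integrable_exp_totalNormSq A ζ hc0 hc).const_mul C).mono' hm (ae_of_all _ fun _ => hf _)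

theorem Tame.integrable_overwrite {f : (X → Spinor) → ℂ} (hf : Tame totalNormSq f) (A : Finset X)
    (ζ : X → Spinor) :
    Integrable (fun η => f (overwrite A ζ η)) (Measure.pi fun _ => Spinor.gaussian) := by
  obtain ⟨C, _, h⟩ := hf.exists_le_exp totalNormSq_nonneg (c := 1 / 2) (by norm_num)
  exact integrable_overwrite_of_le_exp A ζ (by norm_num) (by norm_num)
    (hf.cont.comp (continuous_overwrite A ζ)).aestronglyMeasurable h

variable {H : Type*} [TopologicalSpace H] [MeasurableSpace H] [BorelSpace H]
  [SecondCountableTopology H] (ν : Measure H) [IsProbabilityMeasure ν]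

theorem marginal_integral_swap {f : (X → Spinor) × H → ℂ}
    (hf : Tame (fun p : (X → Spinor) × H => totalNormSq p.1) f) (A : Finset X) (ζ : X → Spinor) :
    marginal A (fun ζ => ∫ h, f (ζ, h) ∂ν) ζ = ∫ h, marginal A (fun ζ => f (ζ, h)) ζ ∂ν := by
  obtain ⟨C, hC, hb⟩ := hf.exists_le_exp (fun p : (X → Spinor) × H => totalNormSq_nonneg p.1)
    (c := 1 / 2) (by norm_num)
  have hcont : Continuous fun p : (A → Spinor) × H => f (overwrite A ζ p.1, p.2) :=
    hf.cont.comp (((continuous_overwrite A ζ).comp continuous_fst).prodMk continuous_snd)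
  have hint : Integrable (fun p : (A → Spinor) × H => f (overwrite A ζ p.1, p.2))
      ((Measure.pi fun _ => Spinor.gaussian).prod ν) := by
    have h := ((integrable_exp_totalNormSq A ζ (c := 1 / 2) (by norm_num) (by norm_num)).const_mul
      C).comp_fst ν
    exact h.mono' hcont.aestronglyMeasurable (ae_of_all _ fun p => hb _)
  exact integral_integral_swap (f := fun η h => f (overwrite A ζ η, h)) hint

end Marginal

/-! ### The Gaussian integral over five spinors at fixed group elements -/

namespace Spinor

theorem bracket_eq (v w : Spinor) : bracket v w = v 0 * w 1 - v 1 * w 0 := by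
  simp [bracket, herm, dual]
  ring

theorem herm_dual_right (z w : Spinor) : herm z (dual w) = herm w (-dual z) := by
  simp [herm, dual]
  ring

theorem bracket_dual_right (z w : Spinor) : bracket z (dual w) = herm w z := by
  rw [bracket_eq]
  simp [herm, dual]
  ring

theorem normSq_dual (z : Spinor) : normSq (dual z) = normSq z := by
  simp [normSq, dual]
  ring

/-- The shifted divided power `C ^ (m - j) / (m - j)!`, which vanishes for `m < j`. -/
noncomputable def dpow (C : ℂ) (m j : ℕ) : ℂ :=
  if j ≤ m then C ^ (m - j) / ((m - j).factorial : ℂ) else 0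

theorem dpow_zero_left (m j : ℕ) : dpow 0 m j = if m = j then 1 else 0 := by
  unfold dpow
  split_ifs with h1 h2 h2
  · simp [h2]
  · rw [zero_pow (by omega), zero_div]
  · omega
  · rfl

/-- Integration over a spinor which occurs in a power of a linear form and in a divided power of the
edge sum: the spinor is replaced by its partner, and the divided power loses the degree of the
linear form. -/
theorem integral_linear_pow_mul_dpow (α β C : ℂ) (u : Spinor) (n m j : ℕ) :
    ∫ z, (α * z 0 + β * z 1) ^ n * dpow (C + herm z u) m j ∂gaussian =
      (α * u 0 + β * u 1) ^ n * dpow C m (j + n) := by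
  unfold dpow
  by_cases h : j ≤ m
  · simp only [if_pos h]
    rw [integral_linear_pow_mul_add_herm_pow]
    by_cases h' : j + n ≤ m
    · rw [if_pos h', if_pos (by omega), Nat.sub_sub]
    · rw [if_neg h', if_neg (by omega), mul_zero]
  · simp only [if_neg h, mul_zero, integral_zero]
    rw [if_neg (by omega), mul_zero]

/-- Integration over the spinor at the source of a link. -/
theorem integral_source (v : Spinor) (g : SU2) (C : ℂ) (u : Spinor) (n m j : ℕ) :
    ∫ z, bracket v (SU2.act g z) ^ n * dpow (C + herm z u) m j ∂gaussian =
      bracket v (SU2.act g u) ^ n * dpow C m (j + n) := by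
  have h : ∀ z, bracket v (SU2.act g z) = (v 0 * g.1 1 0 - v 1 * g.1 0 0) * z 0 +
      (v 0 * g.1 1 1 - v 1 * g.1 0 1) * z 1 := by
    intro z
    rw [bracket_eq, SU2.act_apply, SU2.act_apply]
    ring
  simp_rw [h]
  exact integral_linear_pow_mul_dpow _ _ _ _ _ _ _

/-- Integration over the spinor at the target of a link. -/
theorem integral_target (v : Spinor) (C : ℂ) (z : Spinor) (n m j : ℕ) :
    ∫ w, bracket w v ^ n * dpow (C + herm z (dual w)) m j ∂gaussian =
      herm z v ^ n * dpow C m (j + n) := by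
  have h : ∀ w, bracket w v = v 1 * w 0 + -v 0 * w 1 := by
    intro w
    rw [bracket_eq]
    ring
  simp_rw [herm_dual_right z]
  rw [← bracket_neg_dual]
  simp_rw [h]
  exact integral_linear_pow_mul_dpow _ _ _ _ _ _ _

/-- Two links are joined by integrating over a pair of dual spinors at their ends. -/
theorem integral_bracket_pow_mul_bracket_dual_pow (u v : Spinor) (g : SU2) (n m : ℕ) :
    ∫ w, bracket u (SU2.act g (dual w)) ^ n * bracket w v ^ m ∂gaussian =
      if n = m then (n.factorial : ℂ) * bracket u (SU2.act g v) ^ n else 0 := by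
  have h : ∀ w, bracket u (SU2.act g (dual w)) ^ n * bracket w v ^ m =
      (v 1 * w 0 + -v 0 * w 1) ^ m * herm w (SU2.act g⁻¹ u) ^ n := by
    intro w
    rw [← bracket_dual_right, SU2.bracket_act_left, inv_inv, bracket_eq w v]
    ring
  simp_rw [h]
  rw [integral_linear_pow_mul_herm_pow]
  by_cases hnm : n = m
  · subst hnm
    rw [if_pos rfl, if_pos rfl]
    congr 2
    have : v 1 * SU2.act g⁻¹ u 0 + -v 0 * SU2.act g⁻¹ u 1 = bracket (SU2.act g⁻¹ u) v := by
      rw [bracket_eq]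
      ring
    rw [this, SU2.bracket_act_left, inv_inv]
  · rw [if_neg hnm, if_neg (Ne.symm hnm)]

/-- The base spinor of a face, replaced by its dual if it sits at the target of its link. -/
noncomputable def base (c : Bool) (x : Spinor) : Spinor := if c then dual x else x

theorem normSq_base (c : Bool) (x : Spinor) : normSq (base c x) = normSq x := by
  cases c
  · rfl
  · exact normSq_dual x

theorem continuous_base (c : Bool) : Continuous (base c) := by
  cases c
  · exact continuous_id
  · exact continuous_dual

theorem integral_faceAmplitude_mul_herm_base_pow (c : Bool) (n : ℕ) (g : SU2) :
    ∫ x, herm (base c x) (SU2.act g (base c x)) ^ n * (faceAmplitude x : ℂ) ∂gaussian =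
      ((n : ℂ) + 1) * (n.factorial : ℂ) * SU2.chi n g := by
  simp_rw [mul_comm _ (faceAmplitude _ : ℂ)]
  cases c
  · exact SU2.integral_faceAmplitude_mul_herm_act_pow n g
  · have h : ∀ x, herm (dual x) (SU2.act g (dual x)) = herm x (SU2.act g⁻¹ x) := by
      intro x
      have h := SU2.bracket_act_left g⁻¹ x (dual x)
      rw [inv_inv, bracket_dual_right] at h
      exact h.symm
    simp only [base, if_true, h]
    rw [SU2.integral_faceAmplitude_mul_herm_act_pow, SU2.chi, SU2.chi, SU2.coe_inv_eq_adjugate,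
      Matrix.adjugate_fin_two, Matrix.trace_fin_two_of, Matrix.trace_fin_two, add_comm (g.1 1 1)]

end Spinor

theorem Tame.dpow {Y : Type*} [TopologicalSpace Y] {ρ : Y → ℝ} (hρ : ∀ y, 0 ≤ ρ y) {f : Y → ℂ}
    (hf : Tame ρ f) (m j : ℕ) : Tame ρ fun y => Spinor.dpow (f y) m j := by
  unfold Spinor.dpow
  split_ifs
  · simpa only [div_eq_mul_inv] using (hf.pow hρ _).mul hρ (.const _)
  · exact .const 0

theorem Tame.herm {Y : Type*} [TopologicalSpace Y] {ρ : Y → ℝ} {a b : Y → Spinor}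
    (ha : Continuous a) (hb : Continuous b) (ha' : ∀ y, Spinor.normSq (a y) ≤ ρ y)
    (hb' : ∀ y, Spinor.normSq (b y) ≤ ρ y) : Tame ρ fun y => Spinor.herm (a y) (b y) := by
  refine ⟨Spinor.continuous_herm.comp (ha.prodMk hb), 1, 1, fun y => ?_⟩
  have h1 := Spinor.norm_herm_le (a y) (b y)
  have h2 := ha' y
  have h3 := hb' y
  linarith

theorem SU2.continuous_act_right (g : SU2) : Continuous (SU2.act g) :=
  SU2.continuous_act.comp (continuous_const.prodMk continuous_id)

theorem Spinor.tame_faceAmplitude : Tame Spinor.normSq fun z => (faceAmplitude z : ℂ) := by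
  simpa [faceAmplitude, sub_eq_add_neg] using
    Spinor.tame_normSq.add Spinor.normSq_nonneg (Tame.const (-1))

theorem integral_eq_const_mul {α : Type*} [MeasurableSpace α] {μ : Measure α} {f g : α → ℂ}
    {c I : ℂ} (h : ∀ y, f y = c * g y) (hg : ∫ y, g y ∂μ = I) : ∫ y, f y ∂μ = c * I := by
  simp_rw [h, integral_const_mul, hg]

namespace TrivalentGraph.TypeIII

variable {N L : Type*} [DecidableEq N] [Fintype L] [DecidableEq L]
  {Γ : TrivalentGraph N L} (T : Γ.TypeIII)

/-- The sum of the three products `⟨z|w]` in the edge amplitude; the third one pairs the source of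
`p` with the target of `q`. -/
noncomputable def edgeSum (ζ : L × Bool → Spinor) : ℂ :=
  Spinor.herm (ζ (T.e₁, false)) (Spinor.dual (ζ (T.e₁, true))) +
    Spinor.herm (ζ (T.e₂, false)) (Spinor.dual (ζ (T.e₂, true))) +
    Spinor.herm (ζ (T.p, false)) (Spinor.dual (ζ (T.q, true)))

theorem fixedHalfLinks_eq (c₁ c₂ : Bool) : T.fixedHalfLinks (T.e₂, c₂) =
    insert (T.p, false) (insert (T.q, true) (insert (T.e₁, !c₁) (insert (T.e₂, !c₂)
      (insert (T.e₁, c₁) ∅)))) := by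
  have h1 := T.e₁_ne_e₂
  have h2 := T.p_ne_e₁
  have h3 := T.p_ne_e₂
  have h4 := T.q_ne_e₁
  have h5 := T.q_ne_e₂
  have h6 := T.p_ne_q
  ext ⟨l, b⟩
  simp only [fixedHalfLinks, halfLinks, Finset.mem_erase, Finset.mem_insert, Finset.mem_singleton,
    Prod.mk.injEq, ne_eq, Finset.notMem_empty, or_false]
  cases c₁ <;> cases c₂ <;> cases b <;> simp <;> grind

/-- The Gaussian integral over the spinors of the two glued triangles, for fixed `SU(2)` elements
and a given power of the edge sum: only one power contributes, and only if the spins of the links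
`p` and `q` agree. -/
theorem marginal_fixedHalfLinks (c₁ c₂ : Bool) {K : (L × Bool → Spinor) → ℂ}
    (hK : Tame totalNormSq K)
    (hK' : ∀ ζ x y, x ∈ T.halfLinks → K (Function.update ζ x y) = K ζ)
    (g A B : SU2) (n₁ n₂ n₃ m₃ m : ℕ) (ζ : L × Bool → Spinor) :
    marginal (T.fixedHalfLinks (T.e₂, c₂)) (fun ζ => K ζ *
      (Spinor.bracket (ζ (T.e₁, true)) (SU2.act g (ζ (T.e₁, false))) ^ n₁ *
      Spinor.bracket (ζ (T.e₂, true)) (SU2.act g (ζ (T.e₂, false))) ^ n₂ *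
      Spinor.bracket (ζ (T.p, true)) (SU2.act A (ζ (T.p, false))) ^ n₃ *
      Spinor.bracket (ζ (T.q, true)) (SU2.act B (ζ (T.q, false))) ^ m₃) *
      (faceAmplitude (ζ (T.e₁, c₁)) : ℂ) * Spinor.dpow (T.edgeSum ζ) m 0) ζ =
    (if n₃ = m₃ ∧ m = n₁ + n₂ + n₃ then 1 else 0) *
      ((n₁.factorial : ℂ) * (n₃.factorial : ℂ) * ((n₁ : ℂ) + 1)) *
      (K ζ * Spinor.bracket (ζ (T.p, true)) (SU2.act (A * B) (ζ (T.q, false))) ^ n₃ *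
        SU2.chi n₁ g * Spinor.herm (Spinor.base c₂ (ζ (T.e₂, c₂)))
          (SU2.act g (Spinor.base c₂ (ζ (T.e₂, c₂)))) ^ n₂) := by
  have hn : T.e₁ ≠ T.e₂ ∧ T.e₂ ≠ T.e₁ ∧ T.p ≠ T.e₁ ∧ T.e₁ ≠ T.p ∧ T.p ≠ T.e₂ ∧ T.e₂ ≠ T.p ∧
      T.q ≠ T.e₁ ∧ T.e₁ ≠ T.q ∧ T.q ≠ T.e₂ ∧ T.e₂ ≠ T.q ∧ T.p ≠ T.q ∧ T.q ≠ T.p :=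
    ⟨T.e₁_ne_e₂, T.e₁_ne_e₂.symm, T.p_ne_e₁, T.p_ne_e₁.symm, T.p_ne_e₂, T.p_ne_e₂.symm,
      T.q_ne_e₁, T.q_ne_e₁.symm, T.q_ne_e₂, T.q_ne_e₂.symm, T.p_ne_q, T.p_ne_q.symm⟩
  have hρ := totalNormSq_nonneg (X := L × Bool)
  have hc : ∀ x : L × Bool, Continuous fun ζ : L × Bool → Spinor => ζ x := continuous_apply
  have hle := normSq_le_totalNormSq (X := L × Bool)
  have tB : ∀ (x y : L × Bool) (g : SU2) (n : ℕ), Tame totalNormSq fun ζ : L × Bool → Spinor =>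
      Spinor.bracket (ζ x) (SU2.act g (ζ y)) ^ n := fun x y g n =>
    (Tame.herm (Spinor.continuous_dual.comp (hc x)) ((SU2.continuous_act_right g).comp (hc y))
      (fun ζ => (Spinor.normSq_dual _).trans_le (hle ζ x))
      (fun ζ => (SU2.normSq_act _ _).trans_le (hle ζ y))).pow hρ n
  have tD : ∀ (x y : L × Bool) (g : SU2) (n : ℕ), Tame totalNormSq fun ζ : L × Bool → Spinor =>
      Spinor.bracket (ζ x) (SU2.act g (Spinor.dual (ζ y))) ^ n := fun x y g n =>
    (Tame.herm (Spinor.continuous_dual.comp (hc x))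
      ((SU2.continuous_act_right g).comp (Spinor.continuous_dual.comp (hc y)))
      (fun ζ => (Spinor.normSq_dual _).trans_le (hle ζ x))
      (fun ζ => ((SU2.normSq_act _ _).trans (Spinor.normSq_dual _)).trans_le (hle ζ y))).pow hρ n
  have tH : ∀ (x : L × Bool) (c : Bool) (n : ℕ), Tame totalNormSq fun ζ : L × Bool → Spinor =>
      Spinor.herm (Spinor.base c (ζ x)) (SU2.act g (Spinor.base c (ζ x))) ^ n := fun x c n =>
    (Tame.herm ((Spinor.continuous_base c).comp (hc x))
      ((SU2.continuous_act_right g).comp ((Spinor.continuous_base c).comp (hc x)))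
      (fun ζ => (Spinor.normSq_base _ _).trans_le (hle ζ x))
      (fun ζ => ((SU2.normSq_act _ _).trans (Spinor.normSq_base _ _)).trans_le (hle ζ x))).pow hρ n
  have tS : ∀ (x y : L × Bool), Tame totalNormSq fun ζ : L × Bool → Spinor =>
      Spinor.herm (ζ x) (Spinor.dual (ζ y)) := fun x y =>
    Tame.herm (hc x) (Spinor.continuous_dual.comp (hc y)) (fun ζ => hle ζ x)
      (fun ζ => (Spinor.normSq_dual _).trans_le (hle ζ y))
  have tF : Tame totalNormSq fun ζ : L × Bool → Spinor => (faceAmplitude (ζ (T.e₁, c₁)) : ℂ) :=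
    Spinor.tame_faceAmplitude.comp Spinor.normSq_nonneg (hc _) (fun ζ => hle ζ _)
  have hK1 : ∀ ζ y, K (Function.update ζ (T.p, false) y) = K ζ := fun ζ y =>
    hK' ζ _ y (by simp [halfLinks])
  have hK2 : ∀ ζ y, K (Function.update ζ (T.q, true) y) = K ζ := fun ζ y =>
    hK' ζ _ y (by simp [halfLinks])
  have hK3 : ∀ ζ y c, K (Function.update ζ (T.e₁, c) y) = K ζ := fun ζ y c =>
    hK' ζ _ y (by cases c <;> simp [halfLinks])
  have hK4 : ∀ ζ y c, K (Function.update ζ (T.e₂, c) y) = K ζ := fun ζ y c =>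
    hK' ζ _ y (by cases c <;> simp [halfLinks])
  -- `f₀` is the integrand, `f₁`, ..., `f₄` are the results of integrating it over the spinors at
  -- `(p, false)`, `(q, true)`, `(e₁, !c₁)` and `(e₂, !c₂)`, in this order
  obtain ⟨f₀, hf₀⟩ : ∃ f, f = fun ζ : L × Bool → Spinor => K ζ *
      (Spinor.bracket (ζ (T.e₁, true)) (SU2.act g (ζ (T.e₁, false))) ^ n₁ *
      Spinor.bracket (ζ (T.e₂, true)) (SU2.act g (ζ (T.e₂, false))) ^ n₂ *
      Spinor.bracket (ζ (T.p, true)) (SU2.act A (ζ (T.p, false))) ^ n₃ *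
      Spinor.bracket (ζ (T.q, true)) (SU2.act B (ζ (T.q, false))) ^ m₃) *
      (faceAmplitude (ζ (T.e₁, c₁)) : ℂ) * Spinor.dpow (T.edgeSum ζ) m 0 := ⟨_, rfl⟩
  obtain ⟨f₁, hf₁⟩ : ∃ f, f = fun ζ : L × Bool → Spinor => K ζ *
      (Spinor.bracket (ζ (T.e₁, true)) (SU2.act g (ζ (T.e₁, false))) ^ n₁ *
      Spinor.bracket (ζ (T.e₂, true)) (SU2.act g (ζ (T.e₂, false))) ^ n₂ *
      Spinor.bracket (ζ (T.p, true)) (SU2.act A (Spinor.dual (ζ (T.q, true)))) ^ n₃ *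
      Spinor.bracket (ζ (T.q, true)) (SU2.act B (ζ (T.q, false))) ^ m₃) *
      (faceAmplitude (ζ (T.e₁, c₁)) : ℂ) * Spinor.dpow (
        Spinor.herm (ζ (T.e₁, false)) (Spinor.dual (ζ (T.e₁, true))) +
        Spinor.herm (ζ (T.e₂, false)) (Spinor.dual (ζ (T.e₂, true)))) m n₃ := ⟨_, rfl⟩
  obtain ⟨f₂, hf₂⟩ : ∃ f, f = fun ζ : L × Bool → Spinor => K ζ *
      (Spinor.bracket (ζ (T.e₁, true)) (SU2.act g (ζ (T.e₁, false))) ^ n₁ *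
      Spinor.bracket (ζ (T.e₂, true)) (SU2.act g (ζ (T.e₂, false))) ^ n₂ *
      ((if n₃ = m₃ then (n₃.factorial : ℂ) else 0) *
        Spinor.bracket (ζ (T.p, true)) (SU2.act (A * B) (ζ (T.q, false))) ^ n₃)) *
      (faceAmplitude (ζ (T.e₁, c₁)) : ℂ) * Spinor.dpow (
        Spinor.herm (ζ (T.e₁, false)) (Spinor.dual (ζ (T.e₁, true))) +
        Spinor.herm (ζ (T.e₂, false)) (Spinor.dual (ζ (T.e₂, true)))) m n₃ := ⟨_, rfl⟩
  obtain ⟨f₃, hf₃⟩ : ∃ f, f = fun ζ : L × Bool → Spinor => K ζ *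
      (Spinor.herm (Spinor.base c₁ (ζ (T.e₁, c₁)))
        (SU2.act g (Spinor.base c₁ (ζ (T.e₁, c₁)))) ^ n₁ *
      Spinor.bracket (ζ (T.e₂, true)) (SU2.act g (ζ (T.e₂, false))) ^ n₂ *
      ((if n₃ = m₃ then (n₃.factorial : ℂ) else 0) *
        Spinor.bracket (ζ (T.p, true)) (SU2.act (A * B) (ζ (T.q, false))) ^ n₃)) *
      (faceAmplitude (ζ (T.e₁, c₁)) : ℂ) * Spinor.dpow (
        Spinor.herm (ζ (T.e₂, false)) (Spinor.dual (ζ (T.e₂, true)))) m (n₃ + n₁) := ⟨_, rfl⟩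
  obtain ⟨f₄, hf₄⟩ : ∃ f, f = fun ζ : L × Bool → Spinor => K ζ *
      (Spinor.herm (Spinor.base c₁ (ζ (T.e₁, c₁)))
        (SU2.act g (Spinor.base c₁ (ζ (T.e₁, c₁)))) ^ n₁ *
      Spinor.herm (Spinor.base c₂ (ζ (T.e₂, c₂)))
        (SU2.act g (Spinor.base c₂ (ζ (T.e₂, c₂)))) ^ n₂ *
      ((if n₃ = m₃ then (n₃.factorial : ℂ) else 0) *
        Spinor.bracket (ζ (T.p, true)) (SU2.act (A * B) (ζ (T.q, false))) ^ n₃)) *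
      (faceAmplitude (ζ (T.e₁, c₁)) : ℂ) * Spinor.dpow 0 m (n₃ + n₁ + n₂) := ⟨_, rfl⟩
  have t₀ : Tame totalNormSq f₀ := by
    rw [hf₀]
    exact ((hK.mul hρ ((((tB _ _ _ _).mul hρ (tB _ _ _ _)).mul hρ (tB _ _ _ _)).mul hρ
      (tB _ _ _ _))).mul hρ tF).mul hρ
        ((((tS _ _).add hρ (tS _ _)).add hρ (tS _ _)).dpow hρ _ _)
  have t₁ : Tame totalNormSq f₁ := by
    rw [hf₁]
    exact ((hK.mul hρ ((((tB _ _ _ _).mul hρ (tB _ _ _ _)).mul hρ (tD _ _ _ _)).mul hρ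
      (tB _ _ _ _))).mul hρ tF).mul hρ (((tS _ _).add hρ (tS _ _)).dpow hρ _ _)
  have t₂ : Tame totalNormSq f₂ := by
    rw [hf₂]
    exact ((hK.mul hρ (((tB _ _ _ _).mul hρ (tB _ _ _ _)).mul hρ
      ((Tame.const _).mul hρ (tB _ _ _ _)))).mul hρ tF).mul hρ
        (((tS _ _).add hρ (tS _ _)).dpow hρ _ _)
  have t₃ : Tame totalNormSq f₃ := by
    rw [hf₃]
    exact ((hK.mul hρ (((tH _ _ _).mul hρ (tB _ _ _ _)).mul hρ
      ((Tame.const _).mul hρ (tB _ _ _ _)))).mul hρ tF).mul hρ ((tS _ _).dpow hρ _ _)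
  have t₄ : Tame totalNormSq f₄ := by
    rw [hf₄]
    exact ((hK.mul hρ (((tH _ _ _).mul hρ (tH _ _ _)).mul hρ
      ((Tame.const _).mul hρ (tB _ _ _ _)))).mul hρ tF).mul hρ (.const _)
  have e₁ : (fun ζ => ∫ y, f₀ (Function.update ζ (T.p, false) y) ∂Spinor.gaussian) = f₁ := by
    funext ζ
    rw [hf₀, hf₁]
    simp only [hK1, edgeSum, Function.update_apply, Prod.mk.injEq, hn, false_and, if_false,
      and_false, reduceCtorEq, and_self, if_true]
    have h := Spinor.integral_source (ζ (T.p, true)) A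
      (Spinor.herm (ζ (T.e₁, false)) (Spinor.dual (ζ (T.e₁, true))) +
        Spinor.herm (ζ (T.e₂, false)) (Spinor.dual (ζ (T.e₂, true))))
      (Spinor.dual (ζ (T.q, true))) n₃ m 0
    rw [zero_add] at h
    refine (integral_eq_const_mul (c := K ζ *
      (Spinor.bracket (ζ (T.e₁, true)) (SU2.act g (ζ (T.e₁, false))) ^ n₁ *
      Spinor.bracket (ζ (T.e₂, true)) (SU2.act g (ζ (T.e₂, false))) ^ n₂ *
      Spinor.bracket (ζ (T.q, true)) (SU2.act B (ζ (T.q, false))) ^ m₃) *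
      (faceAmplitude (ζ (T.e₁, c₁)) : ℂ))
      ?_ h).trans ?_
    · intro y
      ring
    · ring
  have e₂ : (fun ζ => ∫ y, f₁ (Function.update ζ (T.q, true) y) ∂Spinor.gaussian) = f₂ := by
    funext ζ
    rw [hf₁, hf₂]
    simp only [hK2, Function.update_apply, Prod.mk.injEq, hn, false_and, if_false,
      and_false, reduceCtorEq, and_self, if_true]
    have h := Spinor.integral_bracket_pow_mul_bracket_dual_pow (ζ (T.p, true))
      (SU2.act B (ζ (T.q, false))) A n₃ m₃
    refine (integral_eq_const_mul (c := K ζ *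
      (Spinor.bracket (ζ (T.e₁, true)) (SU2.act g (ζ (T.e₁, false))) ^ n₁ *
      Spinor.bracket (ζ (T.e₂, true)) (SU2.act g (ζ (T.e₂, false))) ^ n₂) *
      (faceAmplitude (ζ (T.e₁, c₁)) : ℂ) * Spinor.dpow (
        Spinor.herm (ζ (T.e₁, false)) (Spinor.dual (ζ (T.e₁, true))) +
        Spinor.herm (ζ (T.e₂, false)) (Spinor.dual (ζ (T.e₂, true)))) m n₃)
      ?_ h).trans ?_
    · intro y
      ring
    · rw [SU2.act_mul]
      split_ifs <;> ring
  have e₃ : (fun ζ => ∫ y, f₂ (Function.update ζ (T.e₁, !c₁) y) ∂Spinor.gaussian) = f₃ := by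
    funext ζ
    rw [hf₂, hf₃]
    cases c₁
    · simp only [hK3, Function.update_apply, Prod.mk.injEq, hn, false_and, if_false, Bool.not_false,
        and_false, reduceCtorEq, and_self, if_true]
      have h := Spinor.integral_target (SU2.act g (ζ (T.e₁, false)))
        (Spinor.herm (ζ (T.e₂, false)) (Spinor.dual (ζ (T.e₂, true)))) (ζ (T.e₁, false)) n₁ m n₃
      refine (integral_eq_const_mul (c := K ζ *
        (Spinor.bracket (ζ (T.e₂, true)) (SU2.act g (ζ (T.e₂, false))) ^ n₂ *
        ((if n₃ = m₃ then (n₃.factorial : ℂ) else 0) *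
        Spinor.bracket (ζ (T.p, true)) (SU2.act (A * B) (ζ (T.q, false))) ^ n₃)) *
      (faceAmplitude (ζ (T.e₁, false)) : ℂ))
      ?_ h).trans ?_
      · intro y
        rw [add_comm (Spinor.herm (ζ (T.e₂, false)) _)]
        ring
      · simp only [Spinor.base, Bool.false_eq_true, if_false]
        ring
    · simp only [hK3, Function.update_apply, Prod.mk.injEq, hn, false_and, if_false, Bool.not_true,
        and_false, reduceCtorEq, and_self, if_true]
      have h := Spinor.integral_source (ζ (T.e₁, true)) g
        (Spinor.herm (ζ (T.e₂, false)) (Spinor.dual (ζ (T.e₂, true))))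
        (Spinor.dual (ζ (T.e₁, true))) n₁ m n₃
      refine (integral_eq_const_mul (c := K ζ *
        (Spinor.bracket (ζ (T.e₂, true)) (SU2.act g (ζ (T.e₂, false))) ^ n₂ *
        ((if n₃ = m₃ then (n₃.factorial : ℂ) else 0) *
        Spinor.bracket (ζ (T.p, true)) (SU2.act (A * B) (ζ (T.q, false))) ^ n₃)) *
      (faceAmplitude (ζ (T.e₁, true)) : ℂ))
      ?_ h).trans ?_
      · intro y
        rw [add_comm (Spinor.herm (ζ (T.e₂, false)) _)]
        ring
      · simp only [Spinor.base, if_true, Spinor.bracket]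
        ring
  have e₄ : (fun ζ => ∫ y, f₃ (Function.update ζ (T.e₂, !c₂) y) ∂Spinor.gaussian) = f₄ := by
    funext ζ
    rw [hf₃, hf₄]
    cases c₂
    · simp only [hK4, Function.update_apply, Prod.mk.injEq, hn, false_and, if_false, Bool.not_false,
        and_false, reduceCtorEq, and_self, if_true]
      have h := Spinor.integral_target (SU2.act g (ζ (T.e₂, false))) 0 (ζ (T.e₂, false)) n₂ m
        (n₃ + n₁)
      simp only [zero_add] at h
      refine (integral_eq_const_mul (c := K ζ * (Spinor.herm (Spinor.base c₁ (ζ (T.e₁, c₁)))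
        (SU2.act g (Spinor.base c₁ (ζ (T.e₁, c₁)))) ^ n₁ *
        ((if n₃ = m₃ then (n₃.factorial : ℂ) else 0) *
        Spinor.bracket (ζ (T.p, true)) (SU2.act (A * B) (ζ (T.q, false))) ^ n₃)) *
      (faceAmplitude (ζ (T.e₁, c₁)) : ℂ))
      ?_ h).trans ?_
      · intro y
        ring
      · simp only [Spinor.base, Bool.false_eq_true, if_false]
        ring
    · simp only [hK4, Function.update_apply, Prod.mk.injEq, hn, false_and, if_false, Bool.not_true,
        and_false, reduceCtorEq, and_self, if_true]
      have h := Spinor.integral_source (ζ (T.e₂, true)) g 0 (Spinor.dual (ζ (T.e₂, true))) n₂ m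
        (n₃ + n₁)
      simp only [zero_add] at h
      refine (integral_eq_const_mul (c := K ζ * (Spinor.herm (Spinor.base c₁ (ζ (T.e₁, c₁)))
        (SU2.act g (Spinor.base c₁ (ζ (T.e₁, c₁)))) ^ n₁ *
        ((if n₃ = m₃ then (n₃.factorial : ℂ) else 0) *
        Spinor.bracket (ζ (T.p, true)) (SU2.act (A * B) (ζ (T.q, false))) ^ n₃)) *
      (faceAmplitude (ζ (T.e₁, c₁)) : ℂ))
      ?_ h).trans ?_
      · intro y
        ring
      · simp only [Spinor.base, if_true, Spinor.bracket]
        ring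
  have e₅ : ∫ y, f₄ (Function.update ζ (T.e₁, c₁) y) ∂Spinor.gaussian =
      (if n₃ = m₃ ∧ m = n₁ + n₂ + n₃ then 1 else 0) *
      ((n₁.factorial : ℂ) * (n₃.factorial : ℂ) * ((n₁ : ℂ) + 1)) *
      (K ζ * Spinor.bracket (ζ (T.p, true)) (SU2.act (A * B) (ζ (T.q, false))) ^ n₃ *
        SU2.chi n₁ g * Spinor.herm (Spinor.base c₂ (ζ (T.e₂, c₂)))
          (SU2.act g (Spinor.base c₂ (ζ (T.e₂, c₂)))) ^ n₂) := by
    rw [hf₄]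
    simp only [hK3, Function.update_apply, Prod.mk.injEq, hn, false_and, if_false, if_true,
      Spinor.dpow_zero_left]
    have h := Spinor.integral_faceAmplitude_mul_herm_base_pow c₁ n₁ g
    refine (integral_eq_const_mul (c := K ζ * (Spinor.herm (Spinor.base c₂ (ζ (T.e₂, c₂)))
        (SU2.act g (Spinor.base c₂ (ζ (T.e₂, c₂)))) ^ n₂ *
        ((if n₃ = m₃ then (n₃.factorial : ℂ) else 0) *
        Spinor.bracket (ζ (T.p, true)) (SU2.act (A * B) (ζ (T.q, false))) ^ n₃)) *
      (if m = n₃ + n₁ + n₂ then 1 else 0))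
      ?_ h).trans ?_
    · intro y
      ring
    · have h6 : n₃ + n₁ + n₂ = n₁ + n₂ + n₃ := by ring
      rw [ite_and, h6]
      split_ifs <;> ring
  rw [← hf₀, fixedHalfLinks_eq T c₁, marginal_insert' ?_ _ _ (t₀.integrable_overwrite _ _), e₁,
    marginal_insert' ?_ _ _ (t₁.integrable_overwrite _ _), e₂,
    marginal_insert' ?_ _ _ (t₂.integrable_overwrite _ _), e₃,
    marginal_insert' ?_ _ _ (t₃.integrable_overwrite _ _), e₄,
    marginal_insert' ?_ _ _ (t₄.integrable_overwrite _ _), marginal_empty, e₅]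
  all_goals simp [hn]

end TrivalentGraph.TypeIII

/-! ### Averaging over the gauge group -/

section HaarProduct

variable {N : Type*} [Fintype N]

/-- The normalized Haar measure of the group of `SU(2)` elements at the nodes. -/
noncomputable abbrev haarPi (N : Type*) [Fintype N] : Measure (N → SU2) :=
  Measure.pi fun _ => SU2.haar

theorem integral_eq_average_left {F : (N → SU2) → ℂ} (hF : Continuous F) {ι : SU2 → N → SU2}
    (hι : Continuous ι) : ∫ h, F h ∂haarPi N = ∫ h, ∫ k, F (ι k * h) ∂SU2.haar ∂haarPi N := by
  have hc : Continuous fun p : (N → SU2) × SU2 => F (ι p.2 * p.1) :=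
    hF.comp ((hι.comp continuous_snd).mul continuous_fst)
  rw [integral_integral_swap (f := fun h k => F (ι k * h)) hc.integrable_of_compactSpace]
  simp_rw [integral_mul_left_eq_self F]
  simp

theorem integral_eq_average_right {F : (N → SU2) → ℂ} (hF : Continuous F) {ι : SU2 → N → SU2}
    (hι : Continuous ι) : ∫ h, F h ∂haarPi N = ∫ h, ∫ k, F (h * ι k) ∂SU2.haar ∂haarPi N := by
  have hc : Continuous fun p : (N → SU2) × SU2 => F (p.1 * ι p.2) :=
    hF.comp (continuous_fst.mul (hι.comp continuous_snd))
  rw [integral_integral_swap (f := fun h k => F (h * ι k)) hc.integrable_of_compactSpace]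
  simp_rw [integral_mul_right_eq_self F]
  simp

theorem integral_restrict_eq (p : N → Prop) [DecidablePred p] {G : ({n // p n} → SU2) → ℂ}
    (hG : Continuous G) :
    ∫ h, G (fun n => h n.1) ∂haarPi N = ∫ h, G h ∂haarPi {n // p n} := by
  have h1 := measurePreserving_piEquivPiSubtypeProd (fun _ : N => SU2.haar) p
  have h2 : MeasurePreserving (fun h : N → SU2 => fun n : {n // p n} => h n.1) (haarPi N)
      (haarPi {n // p n}) := measurePreserving_fst.comp h1
  rw [← h2.map_eq, integral_map h2.measurable.aemeasurable hG.aestronglyMeasurable]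

variable [DecidableEq N]

/-- Gauge averaging at two nodes `a` and `b`: conjugation invariance turns the two matrix
coefficients into characters, and the remaining integral counts invariants. -/
theorem integral_gauge_average {a b : N} (hab : a ≠ b) {Y : (N → SU2) → ℂ}
    {u v : (N → SU2) → Spinor} (hYc : Continuous Y) (huc : Continuous u) (hvc : Continuous v)
    (hY : ∀ h h' : N → SU2, (∀ n, n ≠ a → n ≠ b → h n = h' n) → Y h = Y h')
    (hu : ∀ h h' : N → SU2, (∀ n, n ≠ a → n ≠ b → h n = h' n) → u h = u h')
    (hv : ∀ h h' : N → SU2, (∀ n, n ≠ a → n ≠ b → h n = h' n) → v h = v h')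
    (x : Spinor) (n₁ n₂ n : ℕ) :
    ∫ h, Y h * Spinor.bracket (u h) (SU2.act (h a * (h b)⁻¹) (v h)) ^ n *
      SU2.chi n₁ ((h b)⁻¹ * h a) * Spinor.herm x (SU2.act ((h b)⁻¹ * h a) x) ^ n₂ ∂haarPi N =
    (∫ h, Y h * Spinor.bracket (u h) (v h) ^ n ∂haarPi N) *
      ((Spinor.normSq x : ℂ) ^ n₂ *
        ((SU2.multiplicity n₁ n₂ n : ℂ) / (((n₂ : ℂ) + 1) * ((n : ℂ) + 1)))) := by
  have hA : ∀ n, Continuous (SU2.classAverage n) := by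
    intro n
    simp_rw [funext (SU2.classAverage_eq n)]
    exact (SU2.continuous_chi n).div_const _
  have hb : Continuous fun p : Spinor × Spinor => Spinor.bracket p.1 p.2 :=
    Spinor.continuous_herm.comp ((Spinor.continuous_dual.comp continuous_fst).prodMk continuous_snd)
  have hg : Continuous fun h : N → SU2 => (h b)⁻¹ * h a :=
    (continuous_apply b).inv.mul (continuous_apply a)
  have hg' : Continuous fun h : N → SU2 => h a * (h b)⁻¹ :=
    (continuous_apply a).mul (continuous_apply b).inv
  have hx : Continuous fun h : N → SU2 => Spinor.herm x (SU2.act ((h b)⁻¹ * h a) x) ^ n₂ :=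
    (Spinor.continuous_herm.comp (continuous_const.prodMk
      (SU2.continuous_act.comp (hg.prodMk continuous_const)))).pow n₂
  have hχ : Continuous fun h : N → SU2 => SU2.chi n₁ ((h b)⁻¹ * h a) :=
    (SU2.continuous_chi n₁).comp hg
  have hAg : ∀ n, Continuous fun h : N → SU2 => SU2.classAverage n ((h b)⁻¹ * h a) := fun n =>
    (hA n).comp hg
  have huv : Continuous fun h : N → SU2 => Spinor.bracket (u h) (v h) ^ n :=
    (hb.comp (huc.prodMk hvc)).pow n
  have hι : Continuous fun k : SU2 => fun n : N => if n = a ∨ n = b then k else 1 := by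
    refine continuous_pi fun n => ?_
    split_ifs
    · exact continuous_id
    · exact continuous_const
  have hκ : Continuous fun k : SU2 => fun n : N => if n = a then k else 1 := by
    refine continuous_pi fun n => ?_
    split_ifs
    · exact continuous_id
    · exact continuous_const
  -- multiplying `h_a` and `h_b` by `k` from the left conjugates `h_a h_b⁻¹` and fixes `h_b⁻¹ h_a`
  have e₁ : ∀ h : N → SU2, ∫ k, Y ((fun n => if n = a ∨ n = b then k else 1) * h) *
      Spinor.bracket (u ((fun n => if n = a ∨ n = b then k else 1) * h))
        (SU2.act (((fun n => if n = a ∨ n = b then k else 1) * h) a *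
          (((fun n => if n = a ∨ n = b then k else 1) * h) b)⁻¹)
            (v ((fun n => if n = a ∨ n = b then k else 1) * h))) ^ n *
      SU2.chi n₁ ((((fun n => if n = a ∨ n = b then k else 1) * h) b)⁻¹ *
        ((fun n => if n = a ∨ n = b then k else 1) * h) a) *
      Spinor.herm x (SU2.act ((((fun n => if n = a ∨ n = b then k else 1) * h) b)⁻¹ *
        ((fun n => if n = a ∨ n = b then k else 1) * h) a) x) ^ n₂ ∂SU2.haar =
      Y h * Spinor.bracket (u h) (v h) ^ n * SU2.classAverage n ((h b)⁻¹ * h a) *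
        SU2.chi n₁ ((h b)⁻¹ * h a) * Spinor.herm x (SU2.act ((h b)⁻¹ * h a) x) ^ n₂ := by
    intro h
    have hne : ∀ k : SU2, ∀ n, n ≠ a → n ≠ b →
        ((fun n => if n = a ∨ n = b then k else 1) * h) n = h n := by
      intro k n h1 h2
      simp [h1, h2]
    have hka : ∀ k : SU2, ((fun n => if n = a ∨ n = b then k else 1) * h) a = k * h a := by
      intro k
      simp
    have hkb : ∀ k : SU2, ((fun n => if n = a ∨ n = b then k else 1) * h) b = k * h b := by
      intro k
      simp
    have h1 : ∀ k : SU2, (k * h b)⁻¹ * (k * h a) = (h b)⁻¹ * h a := fun k => by group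
    have h2 : ∀ k : SU2, k * h a * (k * h b)⁻¹ = k * (h a * (h b)⁻¹) * k⁻¹ := fun k => by group
    simp only [hY _ _ (hne _), hu _ _ (hne _), hv _ _ (hne _), hka, hkb, h1, h2]
    have h3 := SU2.integral_bracket_conj_pow n (h a * (h b)⁻¹) (u h) (v h)
    have h4 : SU2.classAverage n (h a * (h b)⁻¹) = SU2.classAverage n ((h b)⁻¹ * h a) := by
      rw [← SU2.classAverage_conj n (h b)⁻¹ (h a * (h b)⁻¹)]
      congr 1
      group
    refine (integral_eq_const_mul (c := Y h * SU2.chi n₁ ((h b)⁻¹ * h a) *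
      Spinor.herm x (SU2.act ((h b)⁻¹ * h a) x) ^ n₂) ?_ h3).trans ?_
    · intro k
      ring
    · rw [h4]
      ring
  -- multiplying them from the right conjugates `h_b⁻¹ h_a`
  have e₂ : ∀ h : N → SU2, ∫ k, Y (h * (fun n => if n = a ∨ n = b then k⁻¹ else 1)) *
      Spinor.bracket (u (h * (fun n => if n = a ∨ n = b then k⁻¹ else 1)))
        (v (h * (fun n => if n = a ∨ n = b then k⁻¹ else 1))) ^ n *
      SU2.classAverage n (((h * (fun n => if n = a ∨ n = b then k⁻¹ else 1)) b)⁻¹ *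
        (h * (fun n => if n = a ∨ n = b then k⁻¹ else 1)) a) *
      SU2.chi n₁ (((h * (fun n => if n = a ∨ n = b then k⁻¹ else 1)) b)⁻¹ *
        (h * (fun n => if n = a ∨ n = b then k⁻¹ else 1)) a) *
      Spinor.herm x (SU2.act (((h * (fun n => if n = a ∨ n = b then k⁻¹ else 1)) b)⁻¹ *
        (h * (fun n => if n = a ∨ n = b then k⁻¹ else 1)) a) x) ^ n₂ ∂SU2.haar =
      Y h * Spinor.bracket (u h) (v h) ^ n * (Spinor.normSq x : ℂ) ^ n₂ *
        (SU2.chi n₁ ((h b)⁻¹ * h a) * (SU2.classAverage n₂ ((h b)⁻¹ * h a) *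
          SU2.classAverage n ((h b)⁻¹ * h a))) := by
    intro h
    have hne : ∀ k : SU2, ∀ n, n ≠ a → n ≠ b →
        (h * (fun n => if n = a ∨ n = b then k else 1)) n = h n := by
      intro k n h1 h2
      simp [h1, h2]
    have hka : ∀ k : SU2, (h * (fun n => if n = a ∨ n = b then k else 1)) a = h a * k := by
      intro k
      simp
    have hkb : ∀ k : SU2, (h * (fun n => if n = a ∨ n = b then k else 1)) b = h b * k := by
      intro k
      simp
    have h1 : ∀ k : SU2, (h b * k⁻¹)⁻¹ * (h a * k⁻¹) = k * ((h b)⁻¹ * h a) * k⁻¹ :=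
      fun k => by group
    simp only [hY _ _ (hne _), hu _ _ (hne _), hv _ _ (hne _), hka, hkb, h1, SU2.chi_conj,
      SU2.classAverage_conj]
    have h3 := SU2.integral_herm_conj_pow n₂ ((h b)⁻¹ * h a) x
    refine (integral_eq_const_mul (c := Y h * Spinor.bracket (u h) (v h) ^ n *
      SU2.classAverage n ((h b)⁻¹ * h a) * SU2.chi n₁ ((h b)⁻¹ * h a)) ?_ h3).trans ?_
    · intro k
      ring
    · ring
  -- class functions of `h_b⁻¹ h_a` are left, which are integrated over `h_a`
  have e₃ : ∀ h : N → SU2, ∫ k, Y (h * (fun n => if n = a then k else 1)) *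
      Spinor.bracket (u (h * (fun n => if n = a then k else 1)))
        (v (h * (fun n => if n = a then k else 1))) ^ n * (Spinor.normSq x : ℂ) ^ n₂ *
      (SU2.chi n₁ (((h * (fun n => if n = a then k else 1)) b)⁻¹ *
          (h * (fun n => if n = a then k else 1)) a) *
        (SU2.classAverage n₂ (((h * (fun n => if n = a then k else 1)) b)⁻¹ *
            (h * (fun n => if n = a then k else 1)) a) *
          SU2.classAverage n (((h * (fun n => if n = a then k else 1)) b)⁻¹ *
            (h * (fun n => if n = a then k else 1)) a))) ∂SU2.haar =
      Y h * Spinor.bracket (u h) (v h) ^ n * ((Spinor.normSq x : ℂ) ^ n₂ *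
        ((SU2.multiplicity n₁ n₂ n : ℂ) / (((n₂ : ℂ) + 1) * ((n : ℂ) + 1)))) := by
    intro h
    have hne : ∀ k : SU2, ∀ n, n ≠ a → n ≠ b →
        (h * (fun n => if n = a then k else 1)) n = h n := by
      intro k n h1 h2
      simp [h1]
    have hka : ∀ k : SU2, (h * (fun n => if n = a then k else 1)) a = h a * k := by
      intro k
      simp
    have hkb : ∀ k : SU2, (h * (fun n => if n = a then k else 1)) b = h b := by
      intro k
      simp [hab.symm]
    simp only [hY _ _ (hne _), hu _ _ (hne _), hv _ _ (hne _), hka, hkb, ← mul_assoc _ (h a)]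
    have h3 := integral_mul_left_eq_self (μ := SU2.haar) (fun k => SU2.chi n₁ k *
      (SU2.classAverage n₂ k * SU2.classAverage n k)) ((h b)⁻¹ * h a)
    have h4 : ∀ k, SU2.chi n₁ k * (SU2.classAverage n₂ k * SU2.classAverage n k) =
        (((n₂ : ℂ) + 1) * ((n : ℂ) + 1))⁻¹ * (SU2.chi n₁ k * (SU2.chi n₂ k * SU2.chi n k)) := by
      intro k
      rw [SU2.classAverage_eq, SU2.classAverage_eq]
      have : (n : ℂ) + 1 ≠ 0 := by exact_mod_cast n.succ_ne_zero
      have : (n₂ : ℂ) + 1 ≠ 0 := by exact_mod_cast n₂.succ_ne_zero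
      field_simp
    rw [integral_eq_const_mul h4 (SU2.integral_chi_mul_chi_mul_chi n₁ n₂ n)] at h3
    refine (integral_eq_const_mul (c := Y h * Spinor.bracket (u h) (v h) ^ n *
      (Spinor.normSq x : ℂ) ^ n₂) ?_ h3).trans ?_
    · intro k
      ring
    · ring
  rw [integral_eq_average_left ?_ hι, integral_congr_ae (ae_of_all _ e₁),
    integral_eq_average_right ?_ (hι.comp continuous_inv)]
  · refine (integral_congr_ae (ae_of_all _ e₂)).trans ?_
    rw [integral_eq_average_right ?_ hκ, integral_congr_ae (ae_of_all _ e₃), integral_mul_const]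
    exact ((hYc.mul huv).mul continuous_const).mul (hχ.mul ((hAg n₂).mul (hAg n)))
  · exact (((hYc.mul huv).mul (hAg n)).mul hχ).mul hx
  · exact ((hYc.mul ((hb.comp (huc.prodMk (SU2.continuous_act.comp (hg'.prodMk hvc)))).pow n)).mul
      hχ).mul hx

end HaarProduct

/-! ### Spin networks and the integral over the glued triangles -/

namespace TrivalentGraph

variable {N L : Type*} [DecidableEq N] [Fintype L]

/-- The factor of the link `l` in a spin network evaluation, as a function of the spinors and of the
`SU(2)` elements at the nodes. -/
noncomputable def linkFactor (Γ : TrivalentGraph N L) (k : L → ℕ) (l : L) (ζ : L × Bool → Spinor)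
    (h : N → SU2) : ℂ :=
  Spinor.bracket (ζ (l, true)) (SU2.act ((h (Γ.tgt l))⁻¹ * h (Γ.src l)) (ζ (l, false))) ^ k l

theorem spinNetwork_one [Fintype N] (Γ : TrivalentGraph N L) (k : L → ℕ) (ζ : L × Bool → Spinor) :
    Γ.spinNetwork k ζ 1 = ∫ h, ∏ l, Γ.linkFactor k l ζ h ∂haarPi N := by
  simp only [spinNetwork, linkFactor, Pi.one_apply, mul_one]

theorem tame_linkFactor (Γ : TrivalentGraph N L) (k : L → ℕ) (l : L) :
    Tame (fun p : (L × Bool → Spinor) × (N → SU2) => totalNormSq p.1)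
      fun p => Γ.linkFactor k l p.1 p.2 := by
  refine Tame.pow (fun p : (L × Bool → Spinor) × (N → SU2) => totalNormSq_nonneg p.1) ?_ _
  refine Tame.herm (Spinor.continuous_dual.comp ((continuous_apply _).comp continuous_fst))
    (SU2.continuous_act.comp ((Continuous.mul ?_ ?_).prodMk
      ((continuous_apply _).comp continuous_fst))) (fun p => ?_) fun p => ?_
  · exact ((continuous_apply _).comp continuous_snd).inv
  · exact (continuous_apply _).comp continuous_snd
  · exact (Spinor.normSq_dual _).trans_le (normSq_le_totalNormSq _ _)
  · exact (SU2.normSq_act _ _).trans_le (normSq_le_totalNormSq _ _)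

theorem continuous_prod_linkFactor (Γ : TrivalentGraph N L) (k : L → ℕ) (ζ : L × Bool → Spinor) :
    Continuous fun h : N → SU2 => ∏ l, Γ.linkFactor k l ζ h :=
  continuous_finsetProd _ fun l _ =>
    Continuous.comp (g := fun p : (L × Bool → Spinor) × (N → SU2) => Γ.linkFactor k l p.1 p.2)
      (f := fun h => (ζ, h)) (Γ.tame_linkFactor k l).cont (continuous_const.prodMk continuous_id)

theorem tame_spinNetwork [Fintype N] (Γ : TrivalentGraph N L) (k : L → ℕ) :
    Tame totalNormSq fun ζ => Γ.spinNetwork k ζ 1 := by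
  simp_rw [spinNetwork_one]
  exact Tame.integral_right (haarPi N) (f := fun p => ∏ l, Γ.linkFactor k l p.1 p.2)
    (Tame.prod (fun p : (L × Bool → Spinor) × (N → SU2) => totalNormSq_nonneg p.1) _
      (Γ.tame_linkFactor k))

theorem tame_scalelessTerm [Fintype N] (Γ : TrivalentGraph N L) (k : L → ℕ) :
    Tame totalNormSq fun ζ => Γ.scalelessTerm k ζ :=
  (Tame.const _).mul totalNormSq_nonneg (Γ.tame_spinNetwork k)

namespace TypeIII

variable {Γ : TrivalentGraph N L} (T : Γ.TypeIII)

theorem tame_edgeSum : Tame totalNormSq fun ζ => T.edgeSum ζ := by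
  have tS : ∀ x y : L × Bool, Tame totalNormSq
      fun ζ : L × Bool → Spinor => Spinor.herm (ζ x) (Spinor.dual (ζ y)) := fun x y =>
    Tame.herm (continuous_apply x) (Spinor.continuous_dual.comp (continuous_apply y))
      (fun p => normSq_le_totalNormSq p x)
      (fun p => (Spinor.normSq_dual _).trans_le (normSq_le_totalNormSq p y))
  exact ((tS _ _).add totalNormSq_nonneg (tS _ _)).add totalNormSq_nonneg (tS _ _)

theorem tame_faceAmplitude_apply (x : L × Bool) :
    Tame totalNormSq fun ζ : L × Bool → Spinor => (faceAmplitude (ζ x) : ℂ) :=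
  Spinor.tame_faceAmplitude.comp Spinor.normSq_nonneg (continuous_apply x)
    (fun p => normSq_le_totalNormSq p x)

variable [DecidableEq L]

/-- The links away from the glued triangles. -/
def outerLinks : Finset L :=
  Finset.univ.filter fun l => l ≠ T.e₁ ∧ l ≠ T.e₂ ∧ l ≠ T.p ∧ l ≠ T.q

/-- The product of the factors of the links away from the glued triangles. -/
noncomputable def outerFactor (k : L → ℕ) (ζ : L × Bool → Spinor) (h : N → SU2) : ℂ :=
  ∏ l ∈ T.outerLinks, Γ.linkFactor k l ζ h

theorem prod_eq_outer {M : Type*} [CommMonoid M] (f : L → M) :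
    ∏ l, f l = (∏ l ∈ T.outerLinks, f l) * (f T.e₁ * f T.e₂ * f T.p * f T.q) := by
  have hn := T.e₁_ne_e₂
  have h : ({T.e₁, T.e₂, T.p, T.q} : Finset L)ᶜ = T.outerLinks := by
    ext l
    simp [outerLinks]
  rw [← h, ← Finset.prod_compl_mul_prod ({T.e₁, T.e₂, T.p, T.q} : Finset L),
    Finset.prod_insert, Finset.prod_insert, Finset.prod_insert, Finset.prod_singleton]
  · simp only [mul_assoc]
  · simp [T.p_ne_q]
  · simp [T.p_ne_e₂.symm, T.q_ne_e₂.symm]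
  · simp [T.e₁_ne_e₂, T.p_ne_e₁.symm, T.q_ne_e₁.symm]

theorem prod_links_eq {M : Type*} [CommMonoid M] (f : L → M) :
    ∏ l : T.Links, f l.1 = (∏ l ∈ T.outerLinks, f l) * f T.q := by
  have h : ∀ l, l ∈ insert T.q T.outerLinks ↔ l ≠ T.e₁ ∧ l ≠ T.e₂ ∧ l ≠ T.p := by
    intro l
    simp only [outerLinks, Finset.mem_insert, Finset.mem_filter, Finset.mem_univ, true_and]
    constructor
    · rintro (rfl | h)
      · exact ⟨T.q_ne_e₁, T.q_ne_e₂, T.p_ne_q.symm⟩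
      · exact ⟨h.1, h.2.1, h.2.2.1⟩
    · intro h
      by_cases hq : l = T.q
      · exact Or.inl hq
      · exact Or.inr ⟨h.1, h.2.1, h.2.2, hq⟩
  rw [← Finset.prod_subtype (insert T.q T.outerLinks) h f, Finset.prod_insert, mul_comm]
  simp [outerLinks]

theorem outer_src (l : L) (hl : l ∈ T.outerLinks) : Γ.src l ≠ T.a ∧ Γ.src l ≠ T.b := by
  simp only [outerLinks, Finset.mem_filter, Finset.mem_univ, true_and] at hl
  exact T.src_mem ⟨l, hl.1, hl.2.1, hl.2.2.1⟩

theorem outer_tgt (l : L) (hl : l ∈ T.outerLinks) : Γ.tgt l ≠ T.a ∧ Γ.tgt l ≠ T.b := by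
  simp only [outerLinks, Finset.mem_filter, Finset.mem_univ, true_and] at hl
  have := T.newTgt_mem ⟨l, hl.1, hl.2.1, hl.2.2.1⟩
  simpa [newTgt, hl.2.2.2] using this

theorem newTgt_q : T.newTgt T.q = Γ.tgt T.p := by simp [newTgt]

theorem outerFactor_congr (k : L → ℕ) (ζ : L × Bool → Spinor) (h h' : N → SU2)
    (hh : ∀ n, n ≠ T.a → n ≠ T.b → h n = h' n) :
    T.outerFactor k ζ h = T.outerFactor k ζ h' := by
  refine Finset.prod_congr rfl fun l hl => ?_
  have h1 := T.outer_src l hl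
  have h2 := T.outer_tgt l hl
  rw [linkFactor, linkFactor, hh _ h1.1 h1.2, hh _ h2.1 h2.2]

theorem outerFactor_update (k : L → ℕ) (ζ : L × Bool → Spinor) (h : N → SU2) (x : L × Bool)
    (y : Spinor) (hx : x ∈ T.halfLinks) :
    T.outerFactor k (Function.update ζ x y) h = T.outerFactor k ζ h := by
  refine Finset.prod_congr rfl fun l hl => ?_
  have hne : ∀ c, (l, c) ≠ x := by
    rintro c rfl
    simp only [outerLinks, Finset.mem_filter, Finset.mem_univ, true_and] at hl
    simp only [halfLinks, Finset.mem_insert, Finset.mem_singleton, Prod.mk.injEq] at hx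
    tauto
  rw [linkFactor, linkFactor, Function.update_of_ne (hne _), Function.update_of_ne (hne _)]

theorem prod_glued_linkFactor (k : L → ℕ) (ζ : L × Bool → Spinor) (h : N → SU2) :
    ∏ l, T.glued.linkFactor (T.boundarySpins k) l (T.boundarySpinors ζ) (fun n => h n.1) =
      T.outerFactor k ζ h * Spinor.bracket (SU2.act (h (Γ.tgt T.p)) (ζ (T.p, true)))
        (SU2.act (h (Γ.src T.q)) (ζ (T.q, false))) ^ k T.q := by
  have h0 : ∀ l : T.Links,
      T.glued.linkFactor (T.boundarySpins k) l (T.boundarySpinors ζ) (fun n => h n.1) =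
      Spinor.bracket (if l.1 = T.q ∧ true = true then ζ (T.p, true) else ζ (l.1, true))
        (SU2.act ((h (T.newTgt l.1))⁻¹ * h (Γ.src l.1))
          (if l.1 = T.q ∧ false = true then ζ (T.p, true) else ζ (l.1, false))) ^ k l.1 := by
    intro l
    simp only [linkFactor, glued, boundarySpinors, boundarySpins]
  rw [Finset.prod_congr rfl fun l _ => h0 l, T.prod_links_eq fun l : L => Spinor.bracket
    (if l = T.q ∧ true = true then ζ (T.p, true) else ζ (l, true))
    (SU2.act ((h (T.newTgt l))⁻¹ * h (Γ.src l))
      (if l = T.q ∧ false = true then ζ (T.p, true) else ζ (l, false))) ^ k l]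
  simp only [and_true, if_true, Bool.false_eq_true, and_false, if_false, newTgt_q]
  congr 1
  · refine Finset.prod_congr rfl fun l hl => ?_
    have hq : l ≠ T.q := by
      simp only [outerLinks, Finset.mem_filter, Finset.mem_univ, true_and] at hl
      exact hl.2.2.2
    rw [if_neg hq, linkFactor, newTgt, if_neg hq]
  · rw [SU2.bracket_act_left, ← SU2.act_mul]

/-- The spin network of the glued graph as an integral over the `SU(2)` elements at all nodes of
the original graph. -/
theorem glued_spinNetwork_eq [Fintype N] (k : L → ℕ) (ζ : L × Bool → Spinor) :
    T.glued.spinNetwork (T.boundarySpins k) (T.boundarySpinors ζ) 1 =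
      ∫ h, T.outerFactor k ζ h * Spinor.bracket (SU2.act (h (Γ.tgt T.p)) (ζ (T.p, true)))
        (SU2.act (h (Γ.src T.q)) (ζ (T.q, false))) ^ k T.q ∂haarPi N := by
  rw [spinNetwork_one]
  have h1 := integral_restrict_eq (fun n => n ≠ T.a ∧ n ≠ T.b)
    (T.glued.continuous_prod_linkFactor (T.boundarySpins k) (T.boundarySpinors ζ))
  rw [← h1]
  simp only [prod_glued_linkFactor]

theorem tame_outerFactor (k : L → ℕ) :
    Tame (fun p : (L × Bool → Spinor) × (N → SU2) => totalNormSq p.1)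
      fun p => T.outerFactor k p.1 p.2 :=
  Tame.prod (fun p : (L × Bool → Spinor) × (N → SU2) => totalNormSq_nonneg p.1) T.outerLinks
    (Γ.tame_linkFactor k)

/-- The Gaussian integral over the spinors of the glued triangles at fixed `SU(2)` elements: the
two triangles become the parallel transport `h_a h_b⁻¹` times a character of `h_b⁻¹ h_a`. -/
theorem marginal_linkFactor [Fintype N] (c₁ c₂ : Bool) (k : L → ℕ) (m : ℕ) (ζ : L × Bool → Spinor)
    (h : N → SU2) : marginal (T.fixedHalfLinks (T.e₂, c₂)) (fun ζ =>
      (∏ l, Γ.linkFactor k l ζ h) * (faceAmplitude (ζ (T.e₁, c₁)) : ℂ) *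
        Spinor.dpow (T.edgeSum ζ) m 0) ζ =
      ((if k T.p = k T.q ∧ m = k T.e₁ + k T.e₂ + k T.p then 1 else 0) *
      (((k T.e₁).factorial : ℂ) * ((k T.p).factorial : ℂ) * ((k T.e₁ : ℂ) + 1))) *
      (T.outerFactor k ζ h * Spinor.bracket (SU2.act (h (Γ.tgt T.p)) (ζ (T.p, true)))
        (SU2.act (h T.a * (h T.b)⁻¹) (SU2.act (h (Γ.src T.q)) (ζ (T.q, false)))) ^ k T.p *
        SU2.chi (k T.e₁) ((h T.b)⁻¹ * h T.a) * Spinor.herm (Spinor.base c₂ (ζ (T.e₂, c₂)))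
          (SU2.act ((h T.b)⁻¹ * h T.a) (Spinor.base c₂ (ζ (T.e₂, c₂)))) ^ k T.e₂) := by
  have hK : Tame totalNormSq fun ζ => T.outerFactor k ζ h :=
    (T.tame_outerFactor k).comp (φ := fun ζ => (ζ, h))
      (fun p : (L × Bool → Spinor) × (N → SU2) => totalNormSq_nonneg p.1)
      (continuous_id.prodMk continuous_const) (fun ζ => le_rfl)
  have h3 := T.marginal_fixedHalfLinks c₁ c₂ hK
    (fun ζ x y hx => T.outerFactor_update k ζ h x y hx) ((h T.b)⁻¹ * h T.a)
    ((h (Γ.tgt T.p))⁻¹ * h T.a) ((h T.b)⁻¹ * h (Γ.src T.q)) (k T.e₁) (k T.e₂) (k T.p) (k T.q) m ζ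
  have h4 : (h (Γ.tgt T.p))⁻¹ * h T.a * ((h T.b)⁻¹ * h (Γ.src T.q)) =
      (h (Γ.tgt T.p))⁻¹ * ((h T.a * (h T.b)⁻¹) * h (Γ.src T.q)) := by group
  rw [h4, SU2.act_mul _ (h T.a * (h T.b)⁻¹ * h (Γ.src T.q)), ← SU2.bracket_act_left,
    SU2.act_mul] at h3
  refine Eq.trans ?_ h3
  congr 1
  funext ζ
  rw [T.prod_eq_outer]
  simp only [linkFactor, T.src_e₁, T.src_e₂, T.src_p, T.tgt_e₁, T.tgt_e₂, T.tgt_q]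
  rfl

/-- The Gaussian integral of a spin network of `Γ` over the spinors of the glued triangles is a
multiple of the spin network of the glued graph. -/
theorem marginal_spinNetwork [Fintype N] (c₁ c₂ : Bool) (k : L → ℕ) (m : ℕ)
    (ζ : L × Bool → Spinor) :
    marginal (T.fixedHalfLinks (T.e₂, c₂)) (fun ζ => Γ.spinNetwork k ζ 1 *
      (faceAmplitude (ζ (T.e₁, c₁)) : ℂ) * Spinor.dpow (T.edgeSum ζ) m 0) ζ =
    (if k T.p = k T.q ∧ m = k T.e₁ + k T.e₂ + k T.p then 1 else 0) *
      (((k T.e₁).factorial : ℂ) * ((k T.p).factorial : ℂ) * ((k T.e₁ : ℂ) + 1)) *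
      (T.glued.spinNetwork (T.boundarySpins k) (T.boundarySpinors ζ) 1 *
        ((Spinor.normSq (ζ (T.e₂, c₂)) : ℂ) ^ k T.e₂ *
          ((SU2.multiplicity (k T.e₁) (k T.e₂) (k T.p) : ℂ) /
            (((k T.e₂ : ℂ) + 1) * ((k T.p : ℂ) + 1))))) := by
  have hρ : ∀ p : (L × Bool → Spinor) × (N → SU2), 0 ≤ totalNormSq p.1 := fun p =>
    totalNormSq_nonneg p.1
  have tf : Tame (fun p : (L × Bool → Spinor) × (N → SU2) => totalNormSq p.1)
      fun p => (∏ l, Γ.linkFactor k l p.1 p.2) * (faceAmplitude (p.1 (T.e₁, c₁)) : ℂ) *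
        Spinor.dpow (T.edgeSum p.1) m 0 := by
    refine Tame.mul hρ (Tame.mul hρ (Tame.prod hρ _ (Γ.tame_linkFactor k)) ?_) ?_
    · exact (tame_faceAmplitude_apply (T.e₁, c₁)).comp totalNormSq_nonneg continuous_fst
        fun _ => le_rfl
    · exact (T.tame_edgeSum.dpow totalNormSq_nonneg m 0).comp totalNormSq_nonneg continuous_fst
        fun _ => le_rfl
  have h1 : (fun ζ => Γ.spinNetwork k ζ 1 * (faceAmplitude (ζ (T.e₁, c₁)) : ℂ) *
      Spinor.dpow (T.edgeSum ζ) m 0) = fun ζ => ∫ h, (∏ l, Γ.linkFactor k l ζ h) *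
        (faceAmplitude (ζ (T.e₁, c₁)) : ℂ) * Spinor.dpow (T.edgeSum ζ) m 0 ∂haarPi N := by
    funext ζ
    rw [spinNetwork_one, integral_mul_const, integral_mul_const]
  have hYc : Continuous fun h : N → SU2 => T.outerFactor k ζ h :=
    Continuous.comp (g := fun p : (L × Bool → Spinor) × (N → SU2) => T.outerFactor k p.1 p.2)
      (f := fun h => (ζ, h)) (T.tame_outerFactor k).cont (continuous_const.prodMk continuous_id)
  have hact : ∀ (n : N) (z : Spinor), Continuous fun h : N → SU2 => SU2.act (h n) z := fun n z =>
    Continuous.comp (g := fun p : SU2 × Spinor => SU2.act p.1 p.2)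
      (f := fun h : N → SU2 => (h n, z))
      SU2.continuous_act ((continuous_apply n).prodMk continuous_const)
  have hsq : Γ.src T.q ≠ T.a ∧ Γ.src T.q ≠ T.b :=
    T.src_mem ⟨T.q, T.q_ne_e₁, T.q_ne_e₂, T.p_ne_q.symm⟩
  have htp : Γ.tgt T.p ≠ T.a ∧ Γ.tgt T.p ≠ T.b := by
    have := T.newTgt_mem ⟨T.q, T.q_ne_e₁, T.q_ne_e₂, T.p_ne_q.symm⟩
    rwa [newTgt_q] at this
  have h5 := integral_gauge_average T.a_ne_b hYc (hact (Γ.tgt T.p) (ζ (T.p, true)))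
    (hact (Γ.src T.q) (ζ (T.q, false))) (T.outerFactor_congr k ζ)
    (fun h h' hh => by rw [hh _ htp.1 htp.2]) (fun h h' hh => by rw [hh _ hsq.1 hsq.2])
    (Spinor.base c₂ (ζ (T.e₂, c₂))) (k T.e₁) (k T.e₂) (k T.p)
  rw [h1, marginal_integral_swap (haarPi N) tf,
    integral_congr_ae (ae_of_all _ fun h => T.marginal_linkFactor c₁ c₂ k m ζ h),
    integral_const_mul, h5, Spinor.normSq_base]
  by_cases hpq : k T.p = k T.q
  · rw [glued_spinNetwork_eq, hpq]
  · simp [hpq]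

end TypeIII

end TrivalentGraph

/-! ### The edge amplitude -/

namespace TrivalentGraph.TypeIII

variable {N L : Type*} [DecidableEq N] [Fintype L] [DecidableEq L] {Γ : TrivalentGraph N L}
  (T : Γ.TypeIII)

theorem norm_edgeSum_le (ζ : L × Bool → Spinor) : ‖T.edgeSum ζ‖ ≤ totalNormSq ζ / 2 := by
  have h1 : ∀ x y : L × Bool, ‖Spinor.herm (ζ x) (Spinor.dual (ζ y))‖ ≤
      (Spinor.normSq (ζ x) + Spinor.normSq (ζ y)) / 2 := fun x y =>
    (Spinor.norm_herm_le _ _).trans_eq (by rw [Spinor.normSq_dual])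
  have h2 : ∑ x ∈ T.halfLinks, Spinor.normSq (ζ x) ≤ totalNormSq ζ :=
    Finset.sum_le_univ_sum_of_nonneg fun x => Spinor.normSq_nonneg _
  have h3 : ∑ x ∈ T.halfLinks, Spinor.normSq (ζ x) = Spinor.normSq (ζ (T.e₁, false)) +
      (Spinor.normSq (ζ (T.e₂, false)) + (Spinor.normSq (ζ (T.p, false)) +
      (Spinor.normSq (ζ (T.e₁, true)) + (Spinor.normSq (ζ (T.e₂, true)) +
        Spinor.normSq (ζ (T.q, true)))))) := by
    have hn := T.e₁_ne_e₂
    have := T.p_ne_e₁.symm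
    have := T.p_ne_e₂.symm
    have := T.q_ne_e₁.symm
    have := T.q_ne_e₂.symm
    unfold halfLinks
    rw [Finset.sum_insert, Finset.sum_insert, Finset.sum_insert, Finset.sum_insert,
      Finset.sum_insert, Finset.sum_singleton] <;> simp [*]
  have h4 := h1 (T.e₁, false) (T.e₁, true)
  have h5 := h1 (T.e₂, false) (T.e₂, true)
  have h6 := h1 (T.p, false) (T.q, true)
  have h7 := norm_add₃_le (a := Spinor.herm (ζ (T.e₁, false)) (Spinor.dual (ζ (T.e₁, true))))
    (b := Spinor.herm (ζ (T.e₂, false)) (Spinor.dual (ζ (T.e₂, true))))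
    (c := Spinor.herm (ζ (T.p, false)) (Spinor.dual (ζ (T.q, true))))
  unfold edgeSum
  linarith

theorem norm_edge_term_le (ζ : L × Bool → Spinor) (K : ℕ) :
    ‖(((K + 1).factorial : ℂ) ^ 2)⁻¹ * Spinor.dpow (T.edgeSum ζ) (2 * K) 0‖ ≤
      1 / ((K : ℝ) + 1) ^ 2 * Real.exp (1 / 2 * totalNormSq ζ) := by
  have h1 : ‖Spinor.dpow (T.edgeSum ζ) (2 * K) 0‖ ≤ Real.exp (1 / 2 * totalNormSq ζ) := by
    simp only [Spinor.dpow, zero_le, if_true, Nat.sub_zero, norm_div, norm_pow,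
      Complex.norm_natCast]
    refine (Real.pow_div_factorial_le_exp _ (norm_nonneg _) _).trans (Real.exp_le_exp.2 ?_)
    linarith [T.norm_edgeSum_le ζ]
  have h2 : ((K : ℝ) + 1) ≤ ((K + 1).factorial : ℝ) := by
    exact_mod_cast Nat.self_le_factorial (K + 1)
  rw [norm_mul, norm_inv, norm_pow, Complex.norm_natCast, ← one_div]
  refine mul_le_mul ?_ h1 (norm_nonneg _) (by positivity)
  gcongr

theorem summable_one_div_succ_sq : Summable fun K : ℕ => 1 / ((K : ℝ) + 1) ^ 2 := by
  have := (summable_nat_add_iff 1).2 (Real.summable_one_div_nat_pow.2 (by norm_num : 1 < 2))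
  simpa using this

theorem hasSum_edge (ζ : L × Bool → Spinor) :
    HasSum (fun K : ℕ => (((K + 1).factorial : ℂ) ^ 2)⁻¹ * Spinor.dpow (T.edgeSum ζ) (2 * K) 0)
      (T.edge ζ) := by
  have h : T.edge ζ = ∑' K : ℕ, (((K + 1).factorial : ℂ) ^ 2)⁻¹ *
      Spinor.dpow (T.edgeSum ζ) (2 * K) 0 := by
    refine tsum_congr fun K => ?_
    simp only [Fin.sum_univ_three, Matrix.cons_val_zero, Matrix.cons_val_one, Matrix.cons_val,
      Spinor.dpow, zero_le, if_true, Nat.sub_zero, edgeSum]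
    ring
  rw [h]
  exact (Summable.of_norm_bounded (summable_one_div_succ_sq.mul_right _)
    (T.norm_edge_term_le ζ)).hasSum

theorem norm_edge_le (ζ : L × Bool → Spinor) :
    ‖T.edge ζ‖ ≤ (∑' K : ℕ, 1 / ((K : ℝ) + 1) ^ 2) * Real.exp (1 / 2 * totalNormSq ζ) := by
  rw [← (T.hasSum_edge ζ).tsum_eq, ← tsum_mul_right]
  exact tsum_of_norm_bounded (summable_one_div_succ_sq.mul_right _).hasSum
    (T.norm_edge_term_le ζ)

theorem measurable_edge : Measurable T.edge := by
  have h : Tendsto (fun (n : ℕ) (ζ : L × Bool → Spinor) => ∑ K ∈ Finset.range n,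
      (((K + 1).factorial : ℂ) ^ 2)⁻¹ * Spinor.dpow (T.edgeSum ζ) (2 * K) 0) atTop (𝓝 T.edge) :=
    tendsto_pi_nhds.2 fun ζ => (T.hasSum_edge ζ).tendsto_sum_nat
  refine measurable_of_tendsto_metrizable (fun n => ?_) h
  exact (continuous_finsetSum _ fun K _ => continuous_const.mul
    (T.tame_edgeSum.dpow totalNormSq_nonneg _ _).cont).measurable

/-- The edge amplitude grows at most as `exp (R / 2)`, with `R` the sum of all norms squared, and a
tame factor at most as `exp (R / 8)`; the Gaussian measure integrates `exp (c * R)` for `c < 1`. -/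
theorem integrable_mul_edge {P : (L × Bool → Spinor) → ℂ} (hP : Tame totalNormSq P)
    (A : Finset (L × Bool)) (ζ : L × Bool → Spinor) :
    Integrable (fun η => P (overwrite A ζ η) * T.edge (overwrite A ζ η))
      (Measure.pi fun _ => Spinor.gaussian) := by
  obtain ⟨C, hC, hb⟩ := hP.exists_le_exp totalNormSq_nonneg (c := 1 / 8) (by norm_num)
  refine integrable_overwrite_of_le_exp (f := fun ζ => P ζ * T.edge ζ) (c := 5 / 8)
    (C := C * ∑' K : ℕ, 1 / ((K : ℝ) + 1) ^ 2) A ζ (by norm_num) (by norm_num) ?_ fun ζ => ?_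
  · exact ((hP.cont.comp (continuous_overwrite A ζ)).measurable.mul
      (T.measurable_edge.comp (continuous_overwrite A ζ).measurable)).aestronglyMeasurable
  · rw [norm_mul]
    refine (mul_le_mul (hb ζ) (T.norm_edge_le ζ) (norm_nonneg _) (by positivity)).trans_eq ?_
    rw [show (5 / 8 : ℝ) * totalNormSq ζ = 1 / 8 * totalNormSq ζ + 1 / 2 * totalNormSq ζ by ring,
      Real.exp_add]
    ring

/-- The sum defining the edge amplitude may be taken out of the Gaussian integrals, by dominated
convergence. -/
theorem hasSum_marginal_mul_edge {P : (L × Bool → Spinor) → ℂ} (hP : Tame totalNormSq P)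
    (A : Finset (L × Bool)) (ζ : L × Bool → Spinor) :
    HasSum (fun K : ℕ => (((K + 1).factorial : ℂ) ^ 2)⁻¹ *
        marginal A (fun ζ => P ζ * Spinor.dpow (T.edgeSum ζ) (2 * K) 0) ζ)
      (marginal A (fun ζ => P ζ * T.edge ζ) ζ) := by
  have hd : ∀ K, Continuous fun ζ => Spinor.dpow (T.edgeSum ζ) (2 * K) 0 := fun K =>
    (T.tame_edgeSum.dpow totalNormSq_nonneg _ _).cont
  obtain ⟨C, hC, hb⟩ := hP.exists_le_exp totalNormSq_nonneg (c := 1 / 8) (by norm_num)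
  have h := hasSum_integral_of_dominated_convergence
    (μ := Measure.pi fun _ : A => Spinor.gaussian)
    (F := fun (K : ℕ) η => P (overwrite A ζ η) * ((((K + 1).factorial : ℂ) ^ 2)⁻¹ *
      Spinor.dpow (T.edgeSum (overwrite A ζ η)) (2 * K) 0))
    (f := fun η => P (overwrite A ζ η) * T.edge (overwrite A ζ η))
    (fun K η => 1 / ((K : ℝ) + 1) ^ 2 *
      (C * Real.exp (5 / 8 * totalNormSq (overwrite A ζ η))))
    (fun K => ((hP.cont.mul (continuous_const.mul (hd K))).comp
      (continuous_overwrite A ζ)).aestronglyMeasurable)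
    (fun K => ae_of_all _ fun η => ?_)
    (ae_of_all _ fun η => summable_one_div_succ_sq.mul_right _) ?_
    (ae_of_all _ fun η => (T.hasSum_edge _).mul_left _)
  · have h1 : (fun K : ℕ => (((K + 1).factorial : ℂ) ^ 2)⁻¹ *
        marginal A (fun ζ => P ζ * Spinor.dpow (T.edgeSum ζ) (2 * K) 0) ζ) = fun K =>
        ∫ η, P (overwrite A ζ η) * ((((K + 1).factorial : ℂ) ^ 2)⁻¹ *
          Spinor.dpow (T.edgeSum (overwrite A ζ η)) (2 * K) 0)
          ∂(Measure.pi fun _ : A => Spinor.gaussian) := by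
      funext K
      rw [marginal, ← integral_const_mul]
      refine integral_congr_ae (ae_of_all _ fun η => ?_)
      simp only
      ring
    rw [h1]
    exact h
  · rw [norm_mul]
    refine (mul_le_mul (hb _) (T.norm_edge_term_le _ K) (norm_nonneg _) (by positivity)).trans_eq ?_
    rw [show (5 / 8 : ℝ) * totalNormSq (overwrite A ζ η) = 1 / 8 * totalNormSq (overwrite A ζ η) +
      1 / 2 * totalNormSq (overwrite A ζ η) by ring, Real.exp_add]
    ring
  · simp_rw [tsum_mul_right]
    exact ((integrable_exp_totalNormSq A ζ (by norm_num) (by norm_num)).const_mul C).const_mul _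

end TrivalentGraph.TypeIII

/-! ### Closed forms of the gluing integrals -/

theorem marginal_const_mul {X : Type*} [DecidableEq X] (A : Finset X) (c : ℂ)
    (f : (X → Spinor) → ℂ) (ζ : X → Spinor) :
    marginal A (fun ζ => c * f ζ) ζ = c * marginal A f ζ := by
  rw [marginal, marginal, ← integral_const_mul]

theorem faceAmplitude_gaugeFixing (z : Spinor) :
    gaugeFixing (faceAmplitude z) = Real.exp (-Spinor.normSq z) := by
  rw [gaugeFixing, faceAmplitude]
  congr 1
  ring

/-- The weight of the spin `a / 2` of the first shared edge, given the spin `b / 2` of the second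
shared edge and the spin `c / 2` of the new link: `d_a / (d_b d_c)` times the multiplicity of spin
`a / 2` in the tensor product of the other two. -/
noncomputable def SU2.couplingWeight (a b c : ℕ) : ℝ :=
  ((a : ℝ) + 1) * SU2.multiplicity a b c / (((b : ℝ) + 1) * ((c : ℝ) + 1))

theorem SU2.couplingWeight_nonneg (a b c : ℕ) : 0 ≤ SU2.couplingWeight a b c := by
  have := SU2.multiplicity_nonneg a b c
  unfold couplingWeight
  positivity

theorem SU2.hasSum_couplingWeight (b c : ℕ) : HasSum (fun a => SU2.couplingWeight a b c) 1 := by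
  have h := (SU2.hasSum_mul_multiplicity b c).div_const (((b : ℝ) + 1) * ((c : ℝ) + 1))
  rwa [div_self (by positivity)] at h

namespace TrivalentGraph.TypeIII

section

variable {N L : Type*} [DecidableEq N] [Fintype L] {Γ : TrivalentGraph N L} (T : Γ.TypeIII)

theorem prod_nodes_eq [Fintype N] {M : Type*} [CommMonoid M] (f : N → M) :
    ∏ n, f n = f T.a * (f T.b * ∏ n : T.Nodes, f n.1) := by
  have h : ∀ n, n ∈ ((Finset.univ : Finset N).erase T.a).erase T.b ↔ n ≠ T.a ∧ n ≠ T.b := by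
    intro n
    simp [and_comm]
  rw [← Finset.prod_subtype _ h f, Finset.mul_prod_erase _ _ (by simp [T.a_ne_b.symm]),
    Finset.mul_prod_erase _ _ (by simp)]

variable [DecidableEq L]

theorem twoJ_a (k : L → ℕ) : Γ.twoJ k T.a = k T.e₁ + k T.e₂ + k T.p := by
  have h : (Finset.univ.filter fun l => Γ.tgt l = T.a) = ∅ :=
    Finset.filter_eq_empty_iff.2 fun l _ => T.tgt_ne_a l
  rw [twoJ, T.filter_src_a, h, Finset.sum_empty, Finset.sum_insert, Finset.sum_insert,
    Finset.sum_singleton]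
  · ring
  · simp [T.p_ne_e₂.symm]
  · simp [T.e₁_ne_e₂, T.p_ne_e₁.symm]

theorem twoJ_b (k : L → ℕ) : Γ.twoJ k T.b = k T.e₁ + k T.e₂ + k T.q := by
  have h : (Finset.univ.filter fun l => Γ.src l = T.b) = ∅ :=
    Finset.filter_eq_empty_iff.2 fun l _ => T.src_ne_b l
  rw [twoJ, T.filter_tgt_b, h, Finset.sum_empty, Finset.sum_insert, Finset.sum_insert,
    Finset.sum_singleton]
  · ring
  · simp [T.q_ne_e₂.symm]
  · simp [T.e₁_ne_e₂, T.q_ne_e₁.symm]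

/-- The target half-link of the new link is that of `p`, hence the spins at the nodes only agree if
`p` and `q` have the same spin. -/
theorem glued_twoJ {k : L → ℕ} (hk : k T.p = k T.q) (n : T.Nodes) :
    T.glued.twoJ (T.boundarySpins k) n = Γ.twoJ k n.1 := by
  unfold twoJ
  congr 1
  · refine Finset.sum_bij (fun l _ => l.1) ?_ (fun l _ l' _ h => Subtype.ext h) ?_ fun l _ => rfl
    · intro l hl
      simpa [glued, Subtype.ext_iff] using hl
    · intro l hl
      simp only [Finset.mem_filter, Finset.mem_univ, true_and] at hl
      refine ⟨⟨l, ?_, ?_, ?_⟩, ?_, rfl⟩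
      · rintro rfl; exact n.2.1 (hl ▸ T.src_e₁)
      · rintro rfl; exact n.2.1 (hl ▸ T.src_e₂)
      · rintro rfl; exact n.2.1 (hl ▸ T.src_p)
      · simpa [glued, Subtype.ext_iff] using hl
  · refine Finset.sum_bij (fun l _ => if l.1 = T.q then T.p else l.1) ?_ ?_ ?_ ?_
    · intro l hl
      simp only [glued, Finset.mem_filter, Finset.mem_univ, true_and, Subtype.ext_iff,
        newTgt] at hl ⊢
      split_ifs at hl ⊢ <;> exact hl
    · intro l _ l' _ h
      apply Subtype.ext
      have h1 := l.2.2.2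
      have h2 := l'.2.2.2
      split_ifs at h <;> simp_all
    · intro l hl
      simp only [Finset.mem_filter, Finset.mem_univ, true_and] at hl
      by_cases hp : l = T.p
      · refine ⟨⟨T.q, T.q_ne_e₁, T.q_ne_e₂, T.p_ne_q.symm⟩, ?_, ?_⟩
        · subst hp
          simpa [glued, Subtype.ext_iff, newTgt] using hl
        · simp [hp]
      · have hq : l ≠ T.q := by rintro rfl; exact n.2.2 (hl ▸ T.tgt_q)
        refine ⟨⟨l, ?_, ?_, hp⟩, ?_, ?_⟩
        · rintro rfl; exact n.2.2 (hl ▸ T.tgt_e₁)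
        · rintro rfl; exact n.2.2 (hl ▸ T.tgt_e₂)
        · simpa [glued, Subtype.ext_iff, newTgt, hq] using hl
        · simp [hq]
    · intro l _
      split_ifs with h
      · rw [hk, boundarySpins, h]
      · rfl

theorem boundarySpinors_update (ζ : L × Bool → Spinor) (c : Bool) (y : Spinor) :
    T.boundarySpinors (Function.update ζ (T.e₂, c) y) = T.boundarySpinors ζ := by
  funext x
  have h1 : (T.p, true) ≠ (T.e₂, c) := fun h => T.p_ne_e₂ (Prod.mk.inj h).1
  have h2 : (x.1.1, x.2) ≠ (T.e₂, c) := fun h => x.1.2.2.1 (Prod.mk.inj h).1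
  simp only [boundarySpinors, Function.update_of_ne h1, Function.update_of_ne h2]

theorem base_mem_halfLinks (c : Bool) : (T.e₂, c) ∈ T.halfLinks := by
  cases c <;> simp [halfLinks]

theorem overwrite_base (c : Bool) (ζ : L × Bool → Spinor)
    (η : T.fixedHalfLinks (T.e₂, c) → Spinor) :
    overwrite (T.fixedHalfLinks (T.e₂, c)) ζ η (T.e₂, c) = ζ (T.e₂, c) := by
  simp [overwrite, fixedHalfLinks]

end

variable {N L : Type*} [Fintype N] [DecidableEq N] [Fintype L] [DecidableEq L]
  {Γ : TrivalentGraph N L} (T : Γ.TypeIII)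

/-- The gluing integral over the five spinors other than the base spinor of the second shared edge,
without a factor for the face of that edge. -/
theorem marginal_scalelessTerm (c₁ c₂ : Bool) (k : L → ℕ) (ζ : L × Bool → Spinor) :
    marginal (T.fixedHalfLinks (T.e₂, c₂)) (fun ζ => Γ.scalelessTerm k ζ *
      (faceAmplitude (ζ (T.e₁, c₁)) : ℂ) * T.edge ζ) ζ =
    if k T.p = k T.q then T.glued.scalelessTerm (T.boundarySpins k) (T.boundarySpinors ζ) *
      (SU2.couplingWeight (k T.e₁) (k T.e₂) (k T.q) : ℂ) *
        ((Spinor.normSq (ζ (T.e₂, c₂)) : ℂ) ^ k T.e₂ / ((k T.e₂).factorial : ℂ)) else 0 := by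
  have hP : Tame totalNormSq fun ζ : L × Bool → Spinor => Γ.scalelessTerm k ζ *
      (faceAmplitude (ζ (T.e₁, c₁)) : ℂ) :=
    (Γ.tame_scalelessTerm k).mul totalNormSq_nonneg (tame_faceAmplitude_apply _)
  have hsum := T.hasSum_marginal_mul_edge hP (T.fixedHalfLinks (T.e₂, c₂)) ζ
  have h1 : ∀ K : ℕ, marginal (T.fixedHalfLinks (T.e₂, c₂)) (fun ζ => Γ.scalelessTerm k ζ *
      (faceAmplitude (ζ (T.e₁, c₁)) : ℂ) * Spinor.dpow (T.edgeSum ζ) (2 * K) 0) ζ =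
      ((∏ n, ((Γ.twoJ k n / 2 + 1).factorial : ℂ)) * ∏ l, ((k l).factorial : ℂ)⁻¹) *
        marginal (T.fixedHalfLinks (T.e₂, c₂)) (fun ζ => Γ.spinNetwork k ζ 1 *
      (faceAmplitude (ζ (T.e₁, c₁)) : ℂ) * Spinor.dpow (T.edgeSum ζ) (2 * K) 0) ζ := by
    intro K
    rw [← marginal_const_mul]
    congr 1
    funext ζ
    rw [scalelessTerm]
    ring
  simp_rw [h1, T.marginal_spinNetwork] at hsum
  by_cases hk : k T.p = k T.q
  · rw [if_pos hk]
    by_cases hs : Even (k T.e₁ + k T.e₂ + k T.p)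
    · -- only the term of degree `2 J` contributes, where `J` is the total spin at both nodes
      obtain ⟨J, hJ⟩ := hs
      refine hsum.unique ?_
      convert hasSum_single J ?_ using 1
      · have h2 : ∀ n : T.Nodes, T.glued.twoJ (T.boundarySpins k) n = Γ.twoJ k n.1 :=
          T.glued_twoJ hk
        have h3 := T.prod_links_eq fun l => ((k l).factorial : ℂ)⁻¹
        rw [if_pos ⟨hk, by omega⟩, T.prod_nodes_eq, T.prod_eq_outer, scalelessTerm]
        simp only [h2]
        simp only [boundarySpins]
        rw [h3, T.twoJ_a, T.twoJ_b, ← hk, hJ, show (J + J) / 2 = J by omega, SU2.couplingWeight]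
        have hf : ∀ n : ℕ, (n.factorial : ℂ) ≠ 0 := fun n => by exact_mod_cast n.factorial_ne_zero
        have hs : ∀ n : ℕ, (n : ℂ) + 1 ≠ 0 := fun n => by exact_mod_cast n.succ_ne_zero
        have := hf (k T.e₁)
        have := hf (k T.e₂)
        have := hf (k T.p)
        have := hf (J + 1)
        have := hs (k T.e₂)
        have := hs (k T.p)
        push_cast
        field_simp
      · intro K hK
        rw [if_neg (by omega)]
        ring
    · have hm : SU2.multiplicity (k T.e₁) (k T.e₂) (k T.q) = 0 := by
        by_contra h
        exact hs (hk ▸ SU2.even_of_multiplicity_ne_zero h)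
      refine hsum.unique ?_
      have h2 : ∀ K, ¬ (k T.p = k T.q ∧ 2 * K = k T.e₁ + k T.e₂ + k T.p) := fun K h =>
        hs (h.2 ▸ even_two_mul K)
      simp [h2, SU2.couplingWeight, hm]
  · rw [if_neg hk]
    refine hsum.unique ?_
    simp [hk]

theorem gaugeFixedIntegrand_overwrite (c₁ c₂ : Bool) (k : L → ℕ) (ζ : L × Bool → Spinor)
    (η : T.fixedHalfLinks (T.e₂, c₂) → Spinor) :
    T.gaugeFixedIntegrand c₁ c₂ k (overwrite _ ζ η) =
      (Real.exp (-Spinor.normSq (ζ (T.e₂, c₂))) : ℂ) * (Γ.scalelessTerm k (overwrite _ ζ η) *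
      (faceAmplitude (overwrite _ ζ η (T.e₁, c₁)) : ℂ) * T.edge (overwrite _ ζ η)) := by
  rw [gaugeFixedIntegrand, faceAmplitude_gaugeFixing, overwrite_base]
  ring

theorem integrable_gaugeFixedIntegrand (c₁ c₂ : Bool) (k : L → ℕ) (ζ : L × Bool → Spinor) :
    Integrable (fun η : T.fixedHalfLinks (T.e₂, c₂) → Spinor =>
      T.gaugeFixedIntegrand c₁ c₂ k (overwrite _ ζ η))
      (Measure.pi fun _ => Spinor.gaussian) := by
  simp_rw [gaugeFixedIntegrand_overwrite]
  exact (T.integrable_mul_edge ((Γ.tame_scalelessTerm k).mul totalNormSq_nonneg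
    (tame_faceAmplitude_apply (T.e₁, c₁))) _ ζ).const_mul _

/-- Closed form of the gauge-fixed gluing integral: the spin of the second shared edge carries a
Poisson weight, which is a probability distribution for every value of the base spinor. -/
theorem gaugeFixedGluing_eq (c₁ c₂ : Bool) (k : L → ℕ) (ζ : L × Bool → Spinor) :
    T.gaugeFixedGluing c₁ c₂ k ζ =
    if k T.p = k T.q then T.glued.scalelessTerm (T.boundarySpins k) (T.boundarySpinors ζ) *
      ((SU2.couplingWeight (k T.e₁) (k T.e₂) (k T.q) *
        (Real.exp (-Spinor.normSq (ζ (T.e₂, c₂))) *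
          (Spinor.normSq (ζ (T.e₂, c₂)) ^ k T.e₂ / ((k T.e₂).factorial : ℝ))) : ℝ) : ℂ) else 0 := by
  have h := T.marginal_scalelessTerm c₁ c₂ k ζ
  rw [marginal] at h
  rw [gaugeFixedGluing]
  simp_rw [gaugeFixedIntegrand_overwrite]
  rw [integral_const_mul, h]
  split_ifs
  · push_cast
    ring
  · exact mul_zero _

theorem integrable_ungaugedIntegrand (c₁ c₂ : Bool) (k : L → ℕ) (A : Finset (L × Bool))
    (ζ : L × Bool → Spinor) :
    Integrable (fun η : A → Spinor => T.ungaugedIntegrand c₁ c₂ k (overwrite _ ζ η))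
      (Measure.pi fun _ => Spinor.gaussian) := by
  have h : Tame totalNormSq fun ζ : L × Bool → Spinor => Γ.scalelessTerm k ζ *
      (faceAmplitude (ζ (T.e₁, c₁)) : ℂ) * (faceAmplitude (ζ (T.e₂, c₂)) : ℂ) :=
    ((Γ.tame_scalelessTerm k).mul totalNormSq_nonneg
      (tame_faceAmplitude_apply (T.e₁, c₁))).mul totalNormSq_nonneg (tame_faceAmplitude_apply _)
  refine (T.integrable_mul_edge h A ζ).congr (ae_of_all _ fun η => ?_)
  simp only [ungaugedIntegrand]
  ring

/-- Closed form of the gluing integral without gauge fixing: the spin `j` of the second shared edge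
carries the weight `(2 j + 1) ^ 2`. -/
theorem ungaugedGluing_eq (c₁ c₂ : Bool) (k : L → ℕ) (ζ : L × Bool → Spinor) :
    T.ungaugedGluing c₁ c₂ k ζ =
    if k T.p = k T.q then T.glued.scalelessTerm (T.boundarySpins k) (T.boundarySpinors ζ) *
      ((SU2.couplingWeight (k T.e₁) (k T.e₂) (k T.q) * ((k T.e₂ : ℝ) + 1) ^ 2 : ℝ) : ℂ) else 0 := by
  have hins : insert (T.e₂, c₂) (T.fixedHalfLinks (T.e₂, c₂)) = T.halfLinks :=
    Finset.insert_erase (T.base_mem_halfLinks c₂)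
  have h0 : T.ungaugedGluing c₁ c₂ k ζ =
      marginal T.halfLinks (T.ungaugedIntegrand c₁ c₂ k) ζ := rfl
  have h1 := marginal_insert (A := T.fixedHalfLinks (T.e₂, c₂)) (x := (T.e₂, c₂))
    (Finset.notMem_erase _ _) (T.ungaugedIntegrand c₁ c₂ k) ζ
    (T.integrable_ungaugedIntegrand c₁ c₂ k _ ζ)
  have h2 : ∀ y, marginal (T.fixedHalfLinks (T.e₂, c₂)) (T.ungaugedIntegrand c₁ c₂ k)
      (Function.update ζ (T.e₂, c₂) y) = (if k T.p = k T.q then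
        T.glued.scalelessTerm (T.boundarySpins k) (T.boundarySpinors ζ) *
      (SU2.couplingWeight (k T.e₁) (k T.e₂) (k T.q) : ℂ) / ((k T.e₂).factorial : ℂ) else 0) *
        ((faceAmplitude y : ℂ) * (Spinor.normSq y : ℂ) ^ k T.e₂) := by
    intro y
    have h3 := T.marginal_scalelessTerm c₁ c₂ k (Function.update ζ (T.e₂, c₂) y)
    rw [marginal, boundarySpinors_update, Function.update_self] at h3
    rw [marginal]
    simp_rw [ungaugedIntegrand, overwrite_base, Function.update_self]
    rw [integral_mul_const]
    simp_rw [mul_right_comm _ (T.edge _)]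
    rw [h3]
    split_ifs <;> ring
  rw [h0, ← hins, h1]
  simp_rw [h2]
  rw [integral_const_mul, Spinor.integral_faceAmplitude_mul_normSq_pow]
  split_ifs
  · have : ((k T.e₂).factorial : ℂ) ≠ 0 := by exact_mod_cast (k T.e₂).factorial_ne_zero
    push_cast
    field_simp
  · exact zero_mul _

end TrivalentGraph.TypeIII

/-! ### Sums over the spins of the internal edges -/

/-- A convergent expansion stays convergent, with its sum multiplied by `W`, when each of its terms
is spread over a family of nonnegative weights of total `W`. -/
theorem HasSum.mul_weights {α β : Type*} {f : α → ℂ} {A : ℂ} (hf : HasSum f A) {w : α → β → ℝ}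
    (h0 : ∀ i j, 0 ≤ w i j) {W : ℝ} (hw : ∀ i, HasSum (w i) W) :
    HasSum (fun p : α × β => f p.1 * (w p.1 p.2 : ℂ)) (A * (W : ℂ)) := by
  have hn : ∀ p : α × β, ‖f p.1 * (w p.1 p.2 : ℂ)‖ = ‖f p.1‖ * w p.1 p.2 := fun p => by
    rw [norm_mul, Complex.norm_real, Real.norm_of_nonneg (h0 _ _)]
  have hs : Summable fun p : α × β => f p.1 * (w p.1 p.2 : ℂ) := by
    refine Summable.of_norm ?_
    simp_rw [hn]
    have h1 : (0 : α × β → ℝ) ≤ fun p => ‖f p.1‖ * w p.1 p.2 := fun p =>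
      mul_nonneg (norm_nonneg (f p.1)) (h0 p.1 p.2)
    refine (summable_prod_of_nonneg h1).2 ⟨?_, ?_⟩
    · intro i
      have h2 : Summable fun j => ‖f i‖ * w i j := (hw i).summable.mul_left ‖f i‖
      exact h2
    · simp only [tsum_mul_left, (hw _).tsum_eq]
      exact hf.summable.norm.mul_right _
  have h1 := hs.hasSum.prod_fiberwise fun i =>
    ((Complex.hasSum_ofReal.2 (hw i)).mul_left (f i))
  have h2 := h1.unique (hf.mul_right (W : ℂ))
  rw [← h2]
  exact hs.hasSum

theorem hasSum_poissonWeight (x : ℝ) :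
    HasSum (fun n : ℕ => Real.exp (-x) * (x ^ n / (n.factorial : ℝ))) 1 := by
  have h := (NormedSpace.expSeries_div_hasSum_exp x).mul_left (Real.exp (-x))
  rwa [← Real.exp_eq_exp_ℝ, ← Real.exp_add, neg_add_cancel, Real.exp_zero] at h

theorem hasSum_cutoffWeight (M : ℕ) :
    HasSum (fun n : ℕ => if n ≤ M then ((n : ℝ) + 1) ^ 2 else 0)
      (∑ n ∈ Finset.range (M + 1), ((n : ℝ) + 1) ^ 2) := by
  have h : HasSum (fun n : ℕ => if n ≤ M then ((n : ℝ) + 1) ^ 2 else 0)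
      (∑ n ∈ Finset.range (M + 1), if n ≤ M then ((n : ℝ) + 1) ^ 2 else 0) :=
    hasSum_sum_of_ne_finset_zero fun n hn => if_neg fun h => hn (Finset.mem_range.2 (by omega))
  rwa [Finset.sum_congr rfl fun n hn => if_pos (by have := Finset.mem_range.1 hn; omega)] at h

namespace SU2

theorem wigner_one (n : ℕ) : wigner n 1 = 1 := by
  ext b a
  simp [wigner, Polynomial.coeff_X_pow, Matrix.one_apply, Fin.ext_iff]

theorem deltaCutoff_one (M : ℕ) :
    deltaCutoff M 1 = ((∑ n ∈ Finset.range (M + 1), ((n : ℝ) + 1) ^ 2 : ℝ) : ℂ) := by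
  rw [deltaCutoff, Complex.ofReal_sum]
  refine Finset.sum_congr rfl fun n _ => ?_
  rw [character, wigner_one, Matrix.trace_one, Fintype.card_fin]
  push_cast
  ring

theorem tendsto_norm_deltaCutoff_one : Tendsto (fun M : ℕ => ‖deltaCutoff M 1‖) atTop atTop := by
  refine tendsto_atTop_mono (fun M => ?_) tendsto_natCast_atTop_atTop
  have h0 : ∀ n ∈ Finset.range (M + 1), (0 : ℝ) ≤ ((n : ℝ) + 1) ^ 2 := fun n _ => by positivity
  rw [deltaCutoff_one, Complex.norm_real, Real.norm_of_nonneg (Finset.sum_nonneg h0)]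
  have h1 := Finset.single_le_sum h0 (Finset.self_mem_range_succ M)
  nlinarith [(Nat.cast_nonneg M : (0 : ℝ) ≤ M)]

theorem couplingWeight_self_zero (j : ℕ) : couplingWeight j j 0 = 1 := by
  have : ((j : ℝ) + 1) ≠ 0 := by positivity
  rw [couplingWeight, multiplicity, Nat.min_zero, zero_add, Finset.sum_range_one,
    if_pos (by omega)]
  simp [this]

end SU2

namespace TrivalentGraph

variable {N L : Type*} [DecidableEq N] [Fintype L]

theorem scalelessTerm_zero [Fintype N] (Γ : TrivalentGraph N L) (ζ : L × Bool → Spinor) :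
    Γ.scalelessTerm 0 ζ = 1 := by
  simp [scalelessTerm, spinNetwork, twoJ]

namespace TypeIII

variable [DecidableEq L] {Γ : TrivalentGraph N L} (T : Γ.TypeIII)

/-- Spins of `Γ` are spins of the glued graph together with the spins of `p`, `e₂` and `e₁`. -/
def spinsEquiv : (L → ℕ) ≃ (((T.Links → ℕ) × ℕ) × ℕ) × ℕ where
  toFun k := (((T.boundarySpins k, k T.p), k T.e₂), k T.e₁)
  invFun x l := if h : l ≠ T.e₁ ∧ l ≠ T.e₂ ∧ l ≠ T.p then x.1.1.1 ⟨l, h⟩ else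
    if l = T.e₁ then x.2 else if l = T.e₂ then x.1.2 else x.1.1.2
  left_inv k := by
    funext l
    by_cases h1 : l = T.e₁
    · simp [h1]
    by_cases h2 : l = T.e₂
    · simp [h2, T.e₁_ne_e₂.symm]
    by_cases h3 : l = T.p
    · simp [h3, T.p_ne_e₁, T.p_ne_e₂]
    · simp [h1, h2, h3, boundarySpins]
  right_inv x := by
    have h : T.boundarySpins (fun l => if h : l ≠ T.e₁ ∧ l ≠ T.e₂ ∧ l ≠ T.p then
        x.1.1.1 ⟨l, h⟩ else if l = T.e₁ then x.2 else if l = T.e₂ then x.1.2 else x.1.1.2) =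
        x.1.1.1 := by
      funext l
      exact dif_pos l.2
    refine Prod.ext (Prod.ext (Prod.ext h ?_) ?_) ?_
    · simp [T.p_ne_e₁, T.p_ne_e₂]
    · simp [T.e₁_ne_e₂.symm]
    · simp

/-- Summation of the spins of the internal edges: if the spin of the second shared edge carries
nonnegative weights of total `W`, an expansion over the spins of the glued graph is multiplied by
`W`. -/
theorem hasSum_gluing {S : (T.Links → ℕ) → ℂ} {A : ℂ} (hS : HasSum S A) {w : ℕ → ℝ}
    (h0 : ∀ n, 0 ≤ w n) {W : ℝ} (hw : HasSum w W) :
    HasSum (fun k : L → ℕ => if k T.p = k T.q then S (T.boundarySpins k) *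
      ((SU2.couplingWeight (k T.e₁) (k T.e₂) (k T.q) * w (k T.e₂) : ℝ) : ℂ) else 0)
      (A * (W : ℂ)) := by
  have hq : T.q ≠ T.e₁ ∧ T.q ≠ T.e₂ ∧ T.q ≠ T.p := ⟨T.q_ne_e₁, T.q_ne_e₂, T.p_ne_q.symm⟩
  have h1 := hS.mul_weights (w := fun k' c => if c = k' ⟨T.q, hq⟩ then 1 else 0)
    (fun _ _ => by split_ifs <;> norm_num) (fun k' => hasSum_ite_eq (k' ⟨T.q, hq⟩) (1 : ℝ))
  have h2 := h1.mul_weights (w := fun _ b => w b) (fun _ => h0) fun _ => hw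
  have h3 := h2.mul_weights (w := fun x a => SU2.couplingWeight a x.2 (x.1.1 ⟨T.q, hq⟩))
    (fun _ _ => SU2.couplingWeight_nonneg _ _ _) fun _ => SU2.hasSum_couplingWeight _ _
  have h4 := T.spinsEquiv.hasSum_iff.2 h3
  rw [Complex.ofReal_one, mul_one, mul_one] at h4
  convert! h4 using 1
  funext k
  simp only [Function.comp, spinsEquiv, Equiv.coe_fn_mk, boundarySpins]
  by_cases hk : k T.p = k T.q
  · simp only [hk, if_true]
    push_cast
    ring
  · simp [hk]

variable [Fintype N]

theorem hasSum_gaugeFixedGluing (c₁ c₂ : Bool) (ζ : L × Bool → Spinor) {A : ℂ}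
    (h : HasSum (fun k' => T.glued.scalelessTerm k' (T.boundarySpinors ζ)) A) :
    HasSum (fun k => T.gaugeFixedGluing c₁ c₂ k ζ) A := by
  have hx := Spinor.normSq_nonneg (ζ (T.e₂, c₂))
  have h1 := T.hasSum_gluing h (fun n => by positivity)
    (hasSum_poissonWeight (Spinor.normSq (ζ (T.e₂, c₂))))
  rw [Complex.ofReal_one, mul_one] at h1
  simpa only [gaugeFixedGluing_eq] using h1

theorem hasSum_gaugeFixedGluing_boundarySpins (c₁ c₂ : Bool) (ζ : L × Bool → Spinor)
    (k' : T.Links → ℕ) :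
    HasSum (fun k : {k : L → ℕ // T.boundarySpins k = k'} => T.gaugeFixedGluing c₁ c₂ k.1 ζ)
      (T.glued.scalelessTerm k' (T.boundarySpinors ζ)) := by
  have hx := Spinor.normSq_nonneg (ζ (T.e₂, c₂))
  have h1 := T.hasSum_gluing
    (hasSum_ite_eq k' (T.glued.scalelessTerm k' (T.boundarySpinors ζ))) (fun n => by positivity)
    (hasSum_poissonWeight (Spinor.normSq (ζ (T.e₂, c₂))))
  rw [Complex.ofReal_one, mul_one] at h1
  refine (hasSum_subtype_iff_indicator (f := fun k => T.gaugeFixedGluing c₁ c₂ k ζ)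
    (s := {k | T.boundarySpins k = k'})).2 ?_
  convert! h1 using 1
  funext k
  by_cases hk : T.boundarySpins k = k'
  · rw [Set.indicator_of_mem (by exact hk), gaugeFixedGluing_eq, if_pos hk, hk]
  · rw [Set.indicator_of_notMem (by exact hk), if_neg hk, zero_mul, ite_self]

theorem hasSum_ungaugedGluing_cutoff (c₁ c₂ : Bool) (M : ℕ) (ζ : L × Bool → Spinor) {A : ℂ}
    (h : HasSum (fun k' => T.glued.scalelessTerm k' (T.boundarySpinors ζ)) A) :
    HasSum (fun k : {k : L → ℕ // k T.e₂ ≤ M} => T.ungaugedGluing c₁ c₂ k.1 ζ)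
      (A * SU2.deltaCutoff M 1) := by
  have h1 := T.hasSum_gluing h (fun n => by split_ifs <;> positivity) (hasSum_cutoffWeight M)
  rw [SU2.deltaCutoff_one]
  refine (hasSum_subtype_iff_indicator (f := fun k => T.ungaugedGluing c₁ c₂ k ζ)
    (s := {k | k T.e₂ ≤ M})).2 ?_
  convert! h1 using 1
  funext k
  by_cases hk : k T.e₂ ≤ M
  · rw [Set.indicator_of_mem (by exact hk), ungaugedGluing_eq, if_pos hk]
  · rw [Set.indicator_of_notMem (by exact hk), if_neg hk, mul_zero, Complex.ofReal_zero, mul_zero,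
      ite_self]

theorem hasSum_ungaugedGluing_boundarySpins (c₁ c₂ : Bool) (M : ℕ) (ζ : L × Bool → Spinor)
    (k' : T.Links → ℕ) :
    HasSum (fun k : {k : L → ℕ // T.boundarySpins k = k' ∧ k T.e₂ ≤ M} =>
        T.ungaugedGluing c₁ c₂ k.1 ζ)
      (T.glued.scalelessTerm k' (T.boundarySpinors ζ) * SU2.deltaCutoff M 1) := by
  have h1 := T.hasSum_gluing
    (hasSum_ite_eq k' (T.glued.scalelessTerm k' (T.boundarySpinors ζ)))
    (fun n => by split_ifs <;> positivity) (hasSum_cutoffWeight M)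
  rw [SU2.deltaCutoff_one]
  refine (hasSum_subtype_iff_indicator (f := fun k => T.ungaugedGluing c₁ c₂ k ζ)
    (s := {k | T.boundarySpins k = k' ∧ k T.e₂ ≤ M})).2 ?_
  convert! h1 using 1
  funext k
  by_cases hk : T.boundarySpins k = k' ∧ k T.e₂ ≤ M
  · rw [Set.indicator_of_mem (by exact hk), ungaugedGluing_eq, if_pos hk.1, if_pos hk.2, hk.1]
  · rw [Set.indicator_of_notMem (by exact hk)]
    by_cases hk1 : T.boundarySpins k = k'
    · rw [if_neg fun h => hk ⟨hk1, h⟩, mul_zero, Complex.ofReal_zero, mul_zero, ite_self]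
    · rw [if_neg hk1, zero_mul, ite_self]

/-- Already the spins with `j` on both shared edges and `0` elsewhere contribute `(2 j + 1) ^ 2`. -/
theorem not_summable_ungaugedGluing (c₁ c₂ : Bool) (ζ : L × Bool → Spinor) :
    ¬ Summable fun k : L → ℕ => T.ungaugedGluing c₁ c₂ k ζ := by
  intro h
  have hinj : Function.Injective fun (j : ℕ) (l : L) => if l = T.e₁ ∨ l = T.e₂ then j else 0 := by
    intro i j hij
    simpa using congrFun hij T.e₁
  have h1 := (h.comp_injective hinj).tendsto_atTop_zero.norm
  have h2 : ∀ j : ℕ, ((fun k : L → ℕ => T.ungaugedGluing c₁ c₂ k ζ) ∘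
      fun (j : ℕ) (l : L) => if l = T.e₁ ∨ l = T.e₂ then j else 0) j =
      ((((j : ℝ) + 1) ^ 2 : ℝ) : ℂ) := by
    intro j
    have h3 : T.boundarySpins (fun l => if l = T.e₁ ∨ l = T.e₂ then j else 0) = 0 := by
      funext l
      simp [boundarySpins, l.2.1, l.2.2.1]
    simp only [Function.comp, ungaugedGluing_eq, h3, scalelessTerm_zero]
    simp [T.p_ne_e₁, T.p_ne_e₂, T.q_ne_e₁, T.q_ne_e₂, SU2.couplingWeight_self_zero]
  simp_rw [h2] at h1
  rw [norm_zero] at h1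
  obtain ⟨j, hj⟩ := (h1.eventually (gt_mem_nhds one_pos)).exists
  rw [Complex.norm_real, Real.norm_of_nonneg (by positivity)] at hj
  nlinarith [(Nat.cast_nonneg j : (0 : ℝ) ≤ j)]

end TypeIII

end TrivalentGraph

/-! ### Convergence for small spinors -/

theorem summable_prod_pow {L : Type*} [Fintype L] {x : ℝ} (hx0 : 0 ≤ x) (hx1 : x < 1) :
    Summable fun k : L → ℕ => ∏ l, x ^ k l := by
  classical
  refine summable_of_sum_le (c := ((1 - x)⁻¹) ^ Fintype.card L)
    (fun k => Finset.prod_nonneg fun l _ => pow_nonneg hx0 _) fun s => ?_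
  -- a finite set of exponents lies in a box, whose sum factorizes
  have hs : s ⊆ Fintype.piFinset fun l : L => s.image fun k => k l := fun k hk =>
    Fintype.mem_piFinset.2 fun l => Finset.mem_image_of_mem (fun k : L → ℕ => k l) hk
  refine (Finset.sum_le_sum_of_subset_of_nonneg hs fun k _ _ =>
    Finset.prod_nonneg fun l _ => pow_nonneg hx0 _).trans ?_
  rw [← Finset.prod_univ_sum (fun l : L => s.image fun k => k l) fun _ n => x ^ n,
    ← Finset.card_univ, ← Finset.prod_const]
  refine Finset.prod_le_prod (fun l _ => Finset.sum_nonneg fun n _ => pow_nonneg hx0 _)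
    fun l _ => ?_
  rw [← tsum_geometric_of_lt_one hx0 hx1]
  exact (summable_geometric_of_lt_one hx0 hx1).sum_le_tsum _ fun n _ => pow_nonneg hx0 _

theorem Nat.factorial_add_le (a b : ℕ) :
    (a + b).factorial ≤ 2 ^ (a + b) * (a.factorial * b.factorial) := by
  rw [← Nat.add_choose_mul_factorial_mul_factorial, mul_assoc]
  exact Nat.mul_le_mul_right _ (Nat.choose_le_two_pow _ _)

theorem Nat.factorial_sum_le {L : Type*} (s : Finset L) (k : L → ℕ) :
    (∑ l ∈ s, k l).factorial ≤ (2 ^ s.card) ^ (∑ l ∈ s, k l) * ∏ l ∈ s, (k l).factorial := by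
  classical
  induction s using Finset.induction_on with
  | empty => simp
  | insert a s ha ih =>
    rw [Finset.sum_insert ha, Finset.prod_insert ha, Finset.card_insert_of_notMem ha]
    calc (k a + ∑ l ∈ s, k l).factorial
        ≤ 2 ^ (k a + ∑ l ∈ s, k l) * ((k a).factorial * (∑ l ∈ s, k l).factorial) :=
          Nat.factorial_add_le _ _
      _ ≤ 2 ^ (k a + ∑ l ∈ s, k l) * ((k a).factorial *
          ((2 ^ s.card) ^ (k a + ∑ l ∈ s, k l) * ∏ l ∈ s, (k l).factorial)) := by
          gcongr
          refine ih.trans ?_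
          gcongr
          · exact Nat.one_le_two_pow
          · omega
      _ = _ := by
          rw [pow_succ, mul_pow]
          ring

theorem Nat.factorial_half_succ_sq_le (m : ℕ) :
    (m / 2 + 1).factorial ^ 2 ≤ 4 ^ m * m.factorial := by
  have h1 : m / 2 + 1 ≤ 2 ^ m :=
    (Nat.succ_le_of_lt Nat.lt_two_pow_self).trans
      (Nat.pow_le_pow_right two_pos (Nat.div_le_self _ _))
  have h2 : (m / 2).factorial * (m / 2).factorial ≤ m.factorial :=
    (Nat.le_of_dvd (Nat.factorial_pos _) (Nat.factorial_mul_factorial_dvd_factorial_add _ _)).trans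
      (Nat.factorial_le (by omega))
  calc (m / 2 + 1).factorial ^ 2 = (m / 2 + 1) ^ 2 * ((m / 2).factorial * (m / 2).factorial) := by
        rw [Nat.factorial_succ]
        ring
    _ ≤ (2 ^ m) ^ 2 * m.factorial := Nat.mul_le_mul (Nat.pow_le_pow_left h1 2) h2
    _ = 4 ^ m * m.factorial := by rw [← pow_mul, mul_comm m, pow_mul]; norm_num

namespace TrivalentGraph

variable {N L : Type*} [Fintype N] [DecidableEq N] [Fintype L]

/-- Each spin occurs at two half-links, so that the factorials at the nodes are compensated, up to a
geometric factor, by those at the links. -/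
theorem prod_factorial_twoJ_le (Γ : TrivalentGraph N L) (k : L → ℕ) :
    ∏ n, (Γ.twoJ k n / 2 + 1).factorial ≤
      (8 * 2 ^ Fintype.card L) ^ (∑ l, k l) * ∏ l, (k l).factorial := by
  have h1 : ∀ n, (Γ.twoJ k n / 2 + 1).factorial ^ 2 ≤
      (8 * 2 ^ Fintype.card L) ^ Γ.twoJ k n *
        ((∏ l ∈ Finset.univ.filter (fun l => Γ.src l = n), (k l).factorial) *
          ∏ l ∈ Finset.univ.filter (fun l => Γ.tgt l = n), (k l).factorial) := by
    intro n
    have hc : ∀ s : Finset L, (∑ l ∈ s, k l).factorial ≤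
        (2 ^ Fintype.card L) ^ (∑ l ∈ s, k l) * ∏ l ∈ s, (k l).factorial := fun s =>
      (Nat.factorial_sum_le s k).trans (Nat.mul_le_mul_right _ (Nat.pow_le_pow_left
        (Nat.pow_le_pow_right two_pos (Finset.card_le_univ s)) _))
    calc (Γ.twoJ k n / 2 + 1).factorial ^ 2 ≤ 4 ^ Γ.twoJ k n * (Γ.twoJ k n).factorial :=
          Nat.factorial_half_succ_sq_le _
      _ ≤ 4 ^ Γ.twoJ k n * (2 ^ Γ.twoJ k n *
          (((2 ^ Fintype.card L) ^ (∑ l ∈ Finset.univ.filter (fun l => Γ.src l = n), k l) *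
              ∏ l ∈ Finset.univ.filter (fun l => Γ.src l = n), (k l).factorial) *
            ((2 ^ Fintype.card L) ^ (∑ l ∈ Finset.univ.filter (fun l => Γ.tgt l = n), k l) *
              ∏ l ∈ Finset.univ.filter (fun l => Γ.tgt l = n), (k l).factorial))) :=
          Nat.mul_le_mul_left _ ((Nat.factorial_add_le _ _).trans
            (Nat.mul_le_mul_left _ (Nat.mul_le_mul (hc _) (hc _))))
      _ = _ := by
          rw [show (8 * 2 ^ Fintype.card L : ℕ) = 4 * 2 * 2 ^ Fintype.card L by ring, mul_pow,
            mul_pow]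
          unfold twoJ
          ring
  have h2 : ∏ n, ((∏ l ∈ Finset.univ.filter (fun l => Γ.src l = n), (k l).factorial) *
      ∏ l ∈ Finset.univ.filter (fun l => Γ.tgt l = n), (k l).factorial) =
      (∏ l, (k l).factorial) ^ 2 := by
    rw [Finset.prod_mul_distrib, Finset.prod_fiberwise, Finset.prod_fiberwise, sq]
  have h3 : ∑ n, Γ.twoJ k n = 2 * ∑ l, k l := by
    simp only [twoJ]
    rw [Finset.sum_add_distrib, Finset.sum_fiberwise, Finset.sum_fiberwise, two_mul]
  have h4 := Finset.prod_le_prod' fun n (_ : n ∈ Finset.univ) => h1 n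
  rw [Finset.prod_pow, Finset.prod_mul_distrib, h2, Finset.prod_pow_eq_pow_sum, h3, mul_comm 2,
    pow_mul, ← mul_pow] at h4
  exact (Nat.pow_le_pow_iff_left two_ne_zero).1 h4

theorem norm_scalelessTerm_le (Γ : TrivalentGraph N L) (k : L → ℕ) {ζ : L × Bool → Spinor} {t : ℝ}
    (hζ : ∀ x, Spinor.normSq (ζ x) ≤ t) :
    ‖Γ.scalelessTerm k ζ‖ ≤ ∏ l, (8 * 2 ^ Fintype.card L * t) ^ k l := by
  have h1 : ‖Γ.spinNetwork k ζ 1‖ ≤ t ^ (∑ l, k l) := by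
    rw [spinNetwork_one, ← Finset.prod_pow_eq_pow_sum]
    refine (norm_integral_le_of_norm_le_const (C := ∏ l, t ^ k l)
      (ae_of_all _ fun h => ?_)).trans_eq (by simp)
    rw [norm_prod]
    refine Finset.prod_le_prod (fun _ _ => norm_nonneg _) fun l _ => ?_
    rw [linkFactor, norm_pow]
    refine pow_le_pow_left₀ (norm_nonneg _) ?_ _
    have h2 := Spinor.norm_herm_le (Spinor.dual (ζ (l, true)))
      (SU2.act ((h (Γ.tgt l))⁻¹ * h (Γ.src l)) (ζ (l, false)))
    rw [Spinor.normSq_dual, SU2.normSq_act] at h2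
    rw [Spinor.bracket]
    linarith [hζ (l, true), hζ (l, false)]
  have h2 : ((∏ n, (Γ.twoJ k n / 2 + 1).factorial : ℕ) : ℝ) ≤
      (8 * 2 ^ Fintype.card L) ^ (∑ l, k l) * ∏ l, ((k l).factorial : ℝ) := by
    exact_mod_cast Γ.prod_factorial_twoJ_le k
  have h3 : 0 < ∏ l, ((k l).factorial : ℝ) :=
    Finset.prod_pos fun l _ => by exact_mod_cast (k l).factorial_pos
  rw [scalelessTerm, norm_mul, norm_mul, norm_prod, norm_prod]
  simp only [norm_inv, Complex.norm_natCast]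
  rw [← Nat.cast_prod, Finset.prod_inv_distrib, Finset.prod_pow_eq_pow_sum, mul_pow]
  refine mul_le_mul ?_ h1 (norm_nonneg _) (by positivity)
  rwa [← div_eq_mul_inv, div_le_iff₀ h3]

/-- The spin expansion of the scaleless spin network evaluation converges for small spinors. -/
theorem exists_summable_scalelessTerm (Γ : TrivalentGraph N L) :
    ∃ r > 0, ∀ ξ : L × Bool → Spinor, (∀ x, ‖ξ x‖ < r) →
      Summable fun k : L → ℕ => Γ.scalelessTerm k ξ := by
  obtain ⟨D, hD⟩ : ∃ D : ℝ, D = 8 * 2 ^ Fintype.card L := ⟨_, rfl⟩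
  have hD1 : 1 ≤ D := by
    have : (1 : ℝ) ≤ 2 ^ Fintype.card L := one_le_pow₀ (by norm_num)
    linarith
  -- for `‖ξ x‖ < 1 / (2 D)` the ratio of the geometric series is at most `1 / (2 D)`
  refine ⟨1 / (2 * D), by positivity, fun ξ hξ => ?_⟩
  have h1 : ∀ x, Spinor.normSq (ξ x) ≤ 2 * (1 / (2 * D)) ^ 2 := by
    intro x
    have h2 : ∀ i, ‖ξ x i‖ ^ 2 ≤ (1 / (2 * D)) ^ 2 := fun i =>
      pow_le_pow_left₀ (norm_nonneg _) ((norm_le_pi_norm (ξ x) i).trans (hξ x).le) 2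
    have h3 := h2 0
    have h4 := h2 1
    rw [Spinor.normSq]
    linarith
  refine Summable.of_norm_bounded (summable_prod_pow (x := D * (2 * (1 / (2 * D)) ^ 2))
    (by positivity) ?_) fun k => (Γ.norm_scalelessTerm_le k h1).trans_eq (by rw [hD])
  have h5 : D * (2 * (1 / (2 * D)) ^ 2) = 1 / (2 * D) := by
    field_simp
  rw [h5, div_lt_one (by positivity)]
  linarith

end TrivalentGraph

/-! ### The gluing of two triangles along two edges -/

theorem proposition5 {N L : Type*} [Fintype N] [DecidableEq N] [Fintype L] [DecidableEq L]
    (Γ : TrivalentGraph N L) (T : Γ.TypeIII) (c₁ c₂ : Bool) :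
    -- the spin expansion of the glued state converges absolutely for small spinors
    (∃ r > 0, ∀ ξ : T.Links × Bool → Spinor, (∀ x, ‖ξ x‖ < r) →
      Summable fun k' : T.Links → ℕ => T.glued.scalelessTerm k' ξ) ∧
    -- gauge-fixed gluing: the integral at every given spins converges absolutely,
    (∀ (ζ : L × Bool → Spinor) (k : L → ℕ),
      Integrable (fun η : T.fixedHalfLinks (T.e₂, c₂) → Spinor =>
        T.gaugeFixedIntegrand c₁ c₂ k (overwrite _ ζ η))
        (Measure.pi fun _ => Spinor.gaussian)) ∧
    -- the sum over the spins of the internal edges is the glued state, boundary spin by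
    -- boundary spin,
    (∀ (ζ : L × Bool → Spinor) (k' : T.Links → ℕ),
      HasSum (fun k : {k : L → ℕ // T.boundarySpins k = k'} => T.gaugeFixedGluing c₁ c₂ k.1 ζ)
        (T.glued.scalelessTerm k' (T.boundarySpinors ζ))) ∧
    -- and the sum over all spins is the glued state wherever the latter converges
    (∀ ζ : L × Bool → Spinor,
      (Summable fun k' : T.Links → ℕ => T.glued.scalelessTerm k' (T.boundarySpinors ζ)) →
      HasSum (fun k : L → ℕ => T.gaugeFixedGluing c₁ c₂ k ζ)
        (T.glued.scaleless (T.boundarySpinors ζ))) ∧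
    -- without gauge fixing: the integral at every given spins converges absolutely,
    (∀ (ζ : L × Bool → Spinor) (k : L → ℕ),
      Integrable (fun η : T.halfLinks → Spinor =>
        T.ungaugedIntegrand c₁ c₂ k (overwrite _ ζ η))
        (Measure.pi fun _ => Spinor.gaussian)) ∧
    -- the sum over the spins, cut off at `k e₂ ≤ M`, is the glued state times the value at the
    -- identity of the delta distribution with the same cut-off,
    (∀ (M : ℕ) (ζ : L × Bool → Spinor) (k' : T.Links → ℕ),
      HasSum (fun k : {k : L → ℕ // T.boundarySpins k = k' ∧ k T.e₂ ≤ M} =>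
          T.ungaugedGluing c₁ c₂ k.1 ζ)
        (T.glued.scalelessTerm k' (T.boundarySpinors ζ) * SU2.deltaCutoff M 1)) ∧
    (∀ (M : ℕ) (ζ : L × Bool → Spinor),
      (Summable fun k' : T.Links → ℕ => T.glued.scalelessTerm k' (T.boundarySpinors ζ)) →
      HasSum (fun k : {k : L → ℕ // k T.e₂ ≤ M} => T.ungaugedGluing c₁ c₂ k.1 ζ)
        (T.glued.scaleless (T.boundarySpinors ζ) * SU2.deltaCutoff M 1)) ∧
    -- and without the cut-off both diverge
    Tendsto (fun M : ℕ => ‖SU2.deltaCutoff M 1‖) atTop atTop ∧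
    (∀ ζ : L × Bool → Spinor, ¬ Summable fun k : L → ℕ => T.ungaugedGluing c₁ c₂ k ζ) := by
  exact ⟨T.glued.exists_summable_scalelessTerm,
    fun ζ k => T.integrable_gaugeFixedIntegrand c₁ c₂ k ζ,
    T.hasSum_gaugeFixedGluing_boundarySpins c₁ c₂,
    fun ζ h => T.hasSum_gaugeFixedGluing c₁ c₂ ζ h.hasSum,
    fun ζ k => T.integrable_ungaugedIntegrand c₁ c₂ k _ ζ,
    T.hasSum_ungaugedGluing_boundarySpins c₁ c₂,
    fun M ζ h => T.hasSum_ungaugedGluing_cutoff c₁ c₂ M ζ h.hasSum,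
    SU2.tendsto_norm_deltaCutoff_one, T.not_summable_ungaugedGluing c₁ c₂⟩
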